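/- **Setting.** For a finite simple undirected graph $G=(V,E)$, let $\mathrm{LPVC}(G)$ be the linear program minimizing $\sum_{v\in V}x(v)$ over all $x:V\to\mathbb R$ with $x(v)\ge 0$ for all $v\in V$ and $x(u)+x(v)\ge 1$ for every edge $uv\in E$, and let $vc^*(G)$ be its minimum value. For $T\subseteq V$ let $N(T)$ be the set of vertices outside $T$ with a neighbour in $T$; for a nonempty independent set $Z$ let $\mathrm{surplus}(Z)=|N(Z)|-|Z|$. For an instance $(G,k)$, where $k\in\mathbb Z$, let $\mu(G,k)=k-vc^*(G)$. The problem Vertex Cover above LP asks, given $G$ and $k$, whether $G$ has a vertex cover of size at most $k$; it is parameterized by the excess over $vc^*(G)$. **Theorem.** 1. Vertex Cover above LP can be solved in time $O^*(2.6181^{\,k-vc^*(G)})$. That is, there are a program for the unit-cost random access machine (constants, indirect addressing, addition, truncated subtraction, tests for zero; no multiplication) and constants $C,c\in\mathbb N$ such that for every graph $G$ on $n\ge 0$ vertices, given by its adjacency matrix, and every integer $k\ge 0$, the program halts on input $(G,k)$ after at most $C\,(n+1)^{c}\cdot 2.6181^{\max(k-vc^*(G),\,0)}$ steps, with output $1$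 if $G$ has a vertex cover of size at most $k$ and output $0$ otherwise. 2. Consider the following algorithm on instances $(G,k)$. If $\mu(G,k)<0$, answer No. Otherwise apply the first applicable one of the following preprocessing rules, as long as one is applicable: * (R1) If the all-$\frac12$ assignment is not the unique optimum of $\mathrm{LPVC}(G)$: take an optimum $x$ with values in $\{0,\frac12,1\}$ such that all-$\frac12$ is the unique optimum of $\mathrm{LPVC}(G[x^{-1}(\frac12)])$, and replace $(G,k)$ by $(G[x^{-1}(\frac12)],\,k-|x^{-1}(1)|)$. * (R2) If there is a nonempty independent set $Z$ with $\mathrm{surplus}(Z)=1$ and $N(Z)$ not independent: replace $(G,k)$ by $(G-(Z\cup N(Z)),\,k-|N(Z)|)$. * (R3) If there is a nonempty independent set $Z$ with $\mathrm{surplus}(Z)=1$ and $N(Z)$ independent: replace $G$ by the graph obtained by deleting $Z\cup N(Z)$ and adding a new vertex adjacent to every remaining vertex that had a neighbour in $N(Z)$, and replace $k$ by $k-|Z|$. (If $\mu$ becomes negative, answer No.) If no rule applies and no vertex is left, answer Yes. If no rule applies and a vertex is left, pick an arbitrary vertex $u$, recurse on $(G-u,\,k-1)$ and on $(G-(\{u\}\cup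 N(u)),\,k-|N(u)|)$, and answer Yes if and only if one of the two calls does. This algorithm has a run on every instance, and there are constants $C,c\in\mathbb N$ such that for every instance $(G,k)$ with $|V|=n$, every run (whatever choices are made) answers Yes if and only if $G$ has a vertex cover of size at most $k$, and has a search tree with at most $C\,(n+1)^{c}\cdot 2.6181^{\max(\mu(G,k),\,0)}$ nodes. 3. Each application of (R1), (R2) or (R3) strictly decreases the number of vertices and does not increase $\mu$. 4. If none of (R1), (R2), (R3) applies to $(G,k)$, then for every vertex $u$ of $G$, $\mu(G-u,\,k-1)\le\mu(G,k)-\frac12$ and $\mu(G-(\{u\}\cup N(u)),\,k-|N(u)|)\le\mu(G,k)-1$. -/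

import Mathlib

noncomputable section

namespace VCLP

/-! ### Vertex covers, the linear programming relaxation, neighbourhoods -/

section Graphs

variable {V : Type}

/-- `G` has a vertex cover of size at most `k` (the budget `k` may be negative). -/
def HasVertexCover (G : SimpleGraph V) (k : ℤ) : Prop :=
  ∃ S : Set V, S.Finite ∧ G.IsVertexCover S ∧ (S.ncard : ℤ) ≤ k

/-- Feasible (real) solutions of LPVC(`G`). -/
def IsFeasible (G : SimpleGraph V) (x : V → ℝ) : Prop :=
  (∀ v, 0 ≤ x v) ∧ ∀ u v, G.Adj u v → 1 ≤ x u + x v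

/-- Optimum solutions of LPVC(`G`). -/
def IsOptimum [Fintype V] (G : SimpleGraph V) (x : V → ℝ) : Prop :=
  IsFeasible G x ∧ ∀ y, IsFeasible G y → ∑ v, x v ≤ ∑ v, y v

/-- `vc*(G)`, the minimum value of LPVC(`G`). -/
def vcStar [Fintype V] (G : SimpleGraph V) : ℝ :=
  sInf {w : ℝ | ∃ x : V → ℝ, IsFeasible G x ∧ w = ∑ v, x v}

/-- The all-`1/2` assignment is the unique optimum solution of LPVC(`G`). -/
def HalfIsUniqueOptimum [Fintype V] (G : SimpleGraph V) : Prop :=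
  IsOptimum G (fun _ => 1 / 2) ∧ ∀ x, IsOptimum G x → x = fun _ => 1 / 2

/-- The open neighbourhood `N(T)` of a set of vertices `T`. -/
def nbhd (G : SimpleGraph V) (T : Set V) : Set V :=
  {v | v ∉ T ∧ ∃ u ∈ T, G.Adj u v}

/-- `Z` is a nonempty independent set with `surplus(Z) = |N(Z)| - |Z| = 1`. -/
def IsSurplusOne (G : SimpleGraph V) (Z : Set V) : Prop :=
  Z.Nonempty ∧ G.IsIndepSet Z ∧ ((nbhd G Z).ncard : ℤ) - Z.ncard = 1

/-- The graph obtained from `G` by removing `Z ∪ N(Z)` and adding a vertex `none`, adjacent to the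
remaining vertices that have a neighbour in `N(Z)`. -/
def identify (G : SimpleGraph V) (Z : Set V) :
    SimpleGraph (Option ((Z ∪ nbhd G Z)ᶜ : Set V)) where
  Adj a b :=
    match a, b with
    | none, none => False
    | none, some v => ∃ w ∈ nbhd G Z, G.Adj w v
    | some v, none => ∃ w ∈ nbhd G Z, G.Adj w v
    | some u, some v => G.Adj u v
  symm := ⟨by
    intro a b h
    cases a <;> cases b <;> first | exact h | exact SimpleGraph.Adj.symm h⟩
  loopless := ⟨by
    intro a h
    cases a with
    | none => exact h
    | some v => exact G.irrefl h⟩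

end Graphs

/-! ### The branching algorithm -/

/-- A finite graph together with the remaining budget. -/
structure Inst where
  V : Type
  fintypeV : Fintype V
  G : SimpleGraph V
  k : ℤ

attribute [instance] Inst.fintypeV

namespace Inst

/-- The measure `μ(G, k) = k - vc*(G)`. -/
def measure (I : Inst) : ℝ := I.k - vcStar I.G

/-- Pass to the subgraph induced by `S` and decrease the budget by `d`. -/
def keep (I : Inst) (S : Set I.V) (d : ℕ) : Inst :=
  ⟨S, Fintype.ofFinite S, I.G.induce S, I.k - d⟩

/-- Remove `Z`, identify the vertices of `N(Z)`, and decrease the budget by `|Z|`. -/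
def fold (I : Inst) (Z : Set I.V) : Inst :=
  ⟨Option ((Z ∪ nbhd I.G Z)ᶜ : Set I.V), Fintype.ofFinite _, identify I.G Z, I.k - Z.ncard⟩

/-- Put `u` into the vertex cover. -/
def take (I : Inst) (u : I.V) : Inst := I.keep {u}ᶜ 1

/-- Put `N(u)` into the vertex cover and discard `u`. -/
def discard (I : Inst) (u : I.V) : Inst :=
  I.keep ({u} ∪ nbhd I.G {u})ᶜ (nbhd I.G {u}).ncard

/-- The first rule applies when all-`1/2` is not the unique optimum of the LP. -/
def NTApplies (I : Inst) : Prop := ¬ HalfIsUniqueOptimum I.G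

/-- The second rule applies to `Z`: a surplus-1 set whose neighbourhood is not independent. -/
def EdgeRuleApplies (I : Inst) (Z : Set I.V) : Prop :=
  IsSurplusOne I.G Z ∧ ¬ I.G.IsIndepSet (nbhd I.G Z)

/-- The third rule applies to `Z`: a surplus-1 set whose neighbourhood is independent. -/
def FoldRuleApplies (I : Inst) (Z : Set I.V) : Prop :=
  IsSurplusOne I.G Z ∧ I.G.IsIndepSet (nbhd I.G Z)

/-- One application of a preprocessing rule. A rule is applied only when no earlier rule is
applicable. -/
inductive Reduces (I : Inst) : Inst → Prop
  | nemhauserTrotter (x : I.V → ℝ) (happ : I.NTApplies) (hopt : IsOptimum I.G x)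
      (hhalf : ∀ v, x v = 0 ∨ x v = 1 / 2 ∨ x v = 1)
      (huniq : HalfIsUniqueOptimum (I.keep {v | x v = 1 / 2} {v | x v = 1}.ncard).G) :
      Reduces I (I.keep {v | x v = 1 / 2} {v | x v = 1}.ncard)
  | edgeInNeighbourhood (Z : Set I.V) (h1 : ¬ I.NTApplies) (happ : I.EdgeRuleApplies Z) :
      Reduces I (I.keep (Z ∪ nbhd I.G Z)ᶜ (nbhd I.G Z).ncard)
  | foldNeighbourhood (Z : Set I.V) (h1 : ¬ I.NTApplies) (h2 : ∀ Y, ¬ I.EdgeRuleApplies Y)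
      (happ : I.FoldRuleApplies Z) :
      Reduces I (I.fold Z)

/-- No preprocessing rule is applicable. -/
def Reduced (I : Inst) : Prop :=
  ¬ I.NTApplies ∧ (∀ Z, ¬ I.EdgeRuleApplies Z) ∧ ∀ Z, ¬ I.FoldRuleApplies Z

/-- `Run I b t`: some execution of the branching algorithm on `I` answers `b`, with a search tree
of `t` nodes. The algorithm rejects if the measure is negative; otherwise it applies preprocessing
rules as long as possible, accepts if no vertex is left, and else branches on some vertex `u`
(which may be any vertex). -/
inductive Run : Inst → Bool → ℕ → Prop
  | reject (I : Inst) (hμ : I.measure < 0) : Run I false 1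
  | accept (I : Inst) (hμ : 0 ≤ I.measure) (hV : IsEmpty I.V) : Run I true 1
  | reduce (I J : Inst) (b : Bool) (t : ℕ) (hμ : 0 ≤ I.measure) (hred : I.Reduces J)
      (hrun : Run J b t) : Run I b (t + 1)
  | branch (I : Inst) (u : I.V) (b₁ b₂ : Bool) (t₁ t₂ : ℕ) (hμ : 0 ≤ I.measure)
      (hred : I.Reduced) (h₁ : Run (I.take u) b₁ t₁) (h₂ : Run (I.discard u) b₂ t₂) :
      Run I (b₁ || b₂) (t₁ + t₂ + 1)

end Inst

/-! ### Random access machines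

A unit-cost random access machine without multiplication, programmed with structured control flow.
The memory consists of arrays of natural numbers; a program mentions only finitely many of them, so
that they can be interleaved in a single linear memory. -/

namespace RAM

/-- Cell `i` of array `a` holds `σ a i`. -/
abbrev State := ℕ → ℕ → ℕ

/-- Expressions: constants, reading cell `e` of array `a`, addition, truncated subtraction. -/
inductive Expr
  | const (c : ℕ)
  | read (a : ℕ) (e : Expr)
  | add (e₁ e₂ : Expr)
  | sub (e₁ e₂ : Expr)

/-- The value of an expression. -/
def Expr.eval (σ : State) : Expr → ℕ
  | .const c => c
  | .read a e => σ a (e.eval σ)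
  | .add e₁ e₂ => e₁.eval σ + e₂.eval σ
  | .sub e₁ e₂ => e₁.eval σ - e₂.eval σ

/-- The number of steps taken to evaluate an expression: one for every operation. -/
def Expr.cost : Expr → ℕ
  | .const _ => 1
  | .read _ e => e.cost + 1
  | .add e₁ e₂ => e₁.cost + e₂.cost + 1
  | .sub e₁ e₂ => e₁.cost + e₂.cost + 1

/-- Programs: assignment `a[i] := e`, sequencing, branching on `e ≠ 0`, repeating
`p` while `e ≠ 0`. -/
inductive Prog
  | assign (a : ℕ) (i e : Expr)
  | seq (p q : Prog)
  | ite (e : Expr) (p q : Prog)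
  | loop (e : Expr) (p : Prog)

/-- The state after writing `x` into cell `i` of array `a`. -/
def State.write (σ : State) (a i x : ℕ) : State :=
  fun a' i' => if a' = a ∧ i' = i then x else σ a' i'

/-- `Exec p σ t σ'`: started in state `σ`, the program `p` halts in state `σ'` after `t` steps. -/
inductive Exec : Prog → State → ℕ → State → Prop
  | assign (a : ℕ) (i e : Expr) (σ : State) :
      Exec (.assign a i e) σ (i.cost + e.cost + 1) (σ.write a (i.eval σ) (e.eval σ))
  | seq (p q : Prog) (σ σ₁ σ₂ : State) (t₁ t₂ : ℕ) (h₁ : Exec p σ t₁ σ₁) (h₂ : Exec q σ₁ t₂ σ₂) :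
      Exec (.seq p q) σ (t₁ + t₂) σ₂
  | iteTrue (e : Expr) (p q : Prog) (σ σ' : State) (t : ℕ) (he : e.eval σ ≠ 0)
      (h : Exec p σ t σ') : Exec (.ite e p q) σ (e.cost + 1 + t) σ'
  | iteFalse (e : Expr) (p q : Prog) (σ σ' : State) (t : ℕ) (he : e.eval σ = 0)
      (h : Exec q σ t σ') : Exec (.ite e p q) σ (e.cost + 1 + t) σ'
  | loopTrue (e : Expr) (p : Prog) (σ σ₁ σ₂ : State) (t₁ t₂ : ℕ) (he : e.eval σ ≠ 0)
      (h₁ : Exec p σ t₁ σ₁) (h₂ : Exec (.loop e p) σ₁ t₂ σ₂) :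
      Exec (.loop e p) σ (e.cost + 1 + t₁ + t₂) σ₂
  | loopFalse (e : Expr) (p : Prog) (σ : State) (he : e.eval σ = 0) :
      Exec (.loop e p) σ (e.cost + 1) σ

open Classical in
/-- The input `(G, k)`: array `0` holds the number of vertices, array `1` holds `k`, array `2` holds
the adjacency matrix row by row, and every other cell is `0`. -/
def input {n : ℕ} (G : SimpleGraph (Fin n)) (k : ℕ) : State := fun a i =>
  if a = 0 ∧ i = 0 then n
  else if a = 1 ∧ i = 0 then k
  else if a = 2 ∧ ∃ u v : Fin n, i = (u : ℕ) * n + (v : ℕ) ∧ G.Adj u v then 1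
  else 0

end RAM

end VCLP

end

/-! Everything is governed by surpluses. By the deficiency form of Hall's theorem some optimum of
LPVC is a crown assignment: 0 on an independent set Z, 1 on N(Z), 1/2 elsewhere, of value (|V| +
surplus(Z))/2 (`exists_crown_isOptimum`). Hence all-1/2 is the unique optimum exactly when nonempty
independent sets have surplus at least 1 (`halfIsUniqueOptimum_iff`), and no rule applies exactly
when they have surplus at least 2 (`Inst.reduced_iff`). In the latter case vc* = |V|/2. Deleting u
lowers a surplus by at most one, so vc* falls by at most 1/2 while the budget falls by 1. Deleting
N[u] and adding u to an independent set of the rest gives an independent set of G of surplus at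
least 2, so the measure falls by at least 1. With φ the golden ratio, 1/φ + 1/φ² = 1, so these drops
give the base φ² < 2.6181 (`base_rpow_branch`, `treeBound_branch`).

The rules are sound by exchange: a cover S may be replaced by (S \ Z) ∪ N(Z) at no cost when Z has
least surplus among its nonempty subsets and this surplus is at most 1; the only exception is a
cover containing Z and missing N(Z), with surplus 1 (`ncard_exchange_le`). That exception is
impossible if N(Z) spans an edge, and otherwise folding accounts for it. LP solutions of a smaller
instance extend to the larger one at the price paid in budget, so the measure does not grow.

For the machine it remains to find a set of minimum surplus in polynomial time. For each vertex v an
auction, in which the vertices outside N[v] bid for their neighbours there, computes a matching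
together with prices; cutting the prices at a value that does not occur yields an independent set of
minimum surplus through v (`auction_surplus_min`). The program deletes or folds an overall minimum
set while its surplus is at most 1. It never computes a Nemhauser–Trotter decomposition: an
independent set of minimum surplus at most 0 is removed directly. The measure is tested only on
reduced instances, where vc* = |V|/2, and pending branches are kept on a stack. The number of
iterations of its main loop obeys the same recurrence as the search tree (`mainLoop_spec`). -/

namespace VCLP

/-! ### Crowns: half-integral solutions of the linear program -/

section Crowns

variable {V : Type}

/-- The surplus `|N(Z)| - |Z|` of a set of vertices. -/
noncomputable def surplus (G : SimpleGraph V) (Z : Set V) : ℤ :=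
  ((nbhd G Z).ncard : ℤ) - Z.ncard

/-- The assignment that is `0` on `Z`, `1` on `N(Z)` and `1/2` elsewhere. -/
noncomputable def crown (G : SimpleGraph V) (Z : Set V) (v : V) : ℝ :=
  1 / 2 + (nbhd G Z).indicator 1 v / 2 - Z.indicator 1 v / 2

theorem mem_nbhd_of_adj {G : SimpleGraph V} {Z : Set V} (hZ : G.IsIndepSet Z) {u v : V}
    (hu : u ∈ Z) (h : G.Adj u v) : v ∈ nbhd G Z :=
  ⟨fun hv => hZ hu hv h.ne h, u, hu, h⟩

theorem disjoint_nbhd (G : SimpleGraph V) (Z : Set V) : Disjoint Z (nbhd G Z) :=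
  Set.disjoint_left.2 fun _ h h' => h'.1 h

theorem crown_of_mem {G : SimpleGraph V} {Z : Set V} {v : V} (h : v ∈ Z) : crown G Z v = 0 := by
  have : v ∉ nbhd G Z := fun h' => h'.1 h
  simp [crown, h, this]

theorem crown_of_mem_nbhd {G : SimpleGraph V} {Z : Set V} {v : V} (h : v ∈ nbhd G Z) :
    crown G Z v = 1 := by
  simp [crown, h, h.1]; norm_num

theorem crown_of_notMem {G : SimpleGraph V} {Z : Set V} {v : V} (h : v ∉ Z)
    (h' : v ∉ nbhd G Z) : crown G Z v = 1 / 2 := by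
  simp [crown, h, h']

theorem sum_indicator_one [Fintype V] (S : Set V) :
    ∑ v, S.indicator (1 : V → ℝ) v = S.ncard := by
  classical
  rw [Set.ncard_eq_toFinset_card', Finset.sum_indicator_eq_sum_filter]
  simp

theorem sum_crown [Fintype V] (G : SimpleGraph V) (Z : Set V) :
    ∑ v, crown G Z v = (Fintype.card V + surplus G Z : ℝ) / 2 := by
  simp only [crown, Finset.sum_sub_distrib, Finset.sum_add_distrib, ← Finset.sum_div,
    sum_indicator_one, surplus]
  simp; ring

theorem crown_isFeasible {G : SimpleGraph V} {Z : Set V} (hZ : G.IsIndepSet Z) :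
    IsFeasible G (crown G Z) := by
  have key : ∀ v, crown G Z v = 0 ∨ crown G Z v = 1 / 2 ∨ crown G Z v = 1 := fun v => by
    by_cases h : v ∈ Z
    · exact .inl (crown_of_mem h)
    · by_cases h' : v ∈ nbhd G Z
      · exact .inr (.inr (crown_of_mem_nbhd h'))
      · exact .inr (.inl (crown_of_notMem h h'))
  have nn : ∀ v, 0 ≤ crown G Z v := fun v => by
    rcases key v with h | h | h <;> rw [h] <;> norm_num
  refine ⟨nn, fun u v huv => ?_⟩
  by_cases hu : u ∈ Z
  · rw [crown_of_mem_nbhd (mem_nbhd_of_adj hZ hu huv)]; linarith [nn u]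
  by_cases hv : v ∈ Z
  · rw [crown_of_mem_nbhd (mem_nbhd_of_adj hZ hv huv.symm)]; linarith [nn v]
  have half : ∀ w ∉ Z, 1 / 2 ≤ crown G Z w := fun w hw => by
    by_cases h' : w ∈ nbhd G Z
    · rw [crown_of_mem_nbhd h']; norm_num
    · rw [crown_of_notMem hw h']
  linarith [half u hu, half v hv]

theorem indep_sdiff {G : SimpleGraph V} {X Y : Set V}
    (h : ∀ u ∈ X, ∀ v, G.Adj u v → v ∈ Y) : G.IsIndepSet (X \ Y) :=
  fun u hu v hv _ huv => hv.2 (h u hu.1 v huv)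

theorem nbhd_sdiff_subset {G : SimpleGraph V} {X Y : Set V}
    (h : ∀ u ∈ X, ∀ v, G.Adj u v → v ∈ Y) : nbhd G (X \ Y) ⊆ Y \ X := by
  rintro v ⟨-, u, hu, huv⟩
  exact ⟨h u hu.1 v huv, fun hv => hu.2 (h v hv u huv.symm)⟩

/-- `X` and `Y` may overlap: cancelling the intersection does not change the difference of sizes,
and what is left of `X` is independent with all its neighbours in what is left of `Y`. Both Hall
violators and the sets cut out by auction prices become independent sets in this way. -/
theorem surplus_sdiff_le [Finite V] {G : SimpleGraph V} {X Y : Set V}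
    (h : ∀ u ∈ X, ∀ v, G.Adj u v → v ∈ Y) :
    surplus G (X \ Y) ≤ (Y.ncard : ℤ) - X.ncard := by
  have h1 := Set.ncard_le_ncard (nbhd_sdiff_subset h)
  have h2 := Set.ncard_inter_add_ncard_sdiff_eq_ncard X Y
  have h3 := Set.ncard_inter_add_ncard_sdiff_eq_ncard Y X
  rw [Set.inter_comm] at h3
  unfold surplus
  omega

/-- LP duality for the vertex cover LP: some crown is optimal. -/
theorem exists_crown_isOptimum [Fintype V] (G : SimpleGraph V) :
    ∃ Z, G.IsIndepSet Z ∧ IsOptimum G (crown G Z) := by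
  classical
  let nb (X : Finset V) : Finset V := {v | ∃ u ∈ X, G.Adj u v}
  -- `X` has maximum deficiency `d`; here `nb X` is the union of the neighbourhoods and may meet
  -- `X`.
  obtain ⟨X, -, hX⟩ := Finset.exists_max_image Finset.univ
    (fun X : Finset V => (X.card : ℤ) - (nb X).card) ⟨∅, Finset.mem_univ _⟩
  have h0 : (nb ∅).card = 0 := by simp [nb]
  have hd0 := hX ∅ (Finset.mem_univ _)
  simp only [h0, Finset.card_empty] at hd0
  obtain ⟨d, hd⟩ : ∃ d : ℕ, (X.card : ℤ) - (nb X).card = d :=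
    ⟨_, (Int.toNat_of_nonneg (by simpa using hd0)).symm⟩
  -- With `d` dummy partners available to everybody Hall's condition holds, so every vertex is
  -- matched injectively to a neighbour or to a dummy.
  let t (v : V) : Finset (V ⊕ Fin d) := (nb {v}).disjSum Finset.univ
  obtain ⟨f, hf, hft⟩ := (Finset.all_card_le_biUnion_card_iff_exists_injective t).1 (by
    intro s
    rcases s.eq_empty_or_nonempty with rfl | ⟨a, ha⟩
    · simp
    · have : s.biUnion t = (nb s).disjSum Finset.univ := by
        ext w
        rcases w with w | w
        · simp [t, nb]
        · simp [t]; exact ⟨a, ha⟩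
      rw [this, Finset.card_disjSum, Finset.card_univ, Fintype.card_fin]
      have := hX s (Finset.mem_univ _)
      omega)
  have hadj : ∀ u ∈ (X : Set V), ∀ v, G.Adj u v → v ∈ (nb X : Set V) := fun u hu v huv => by
    simpa [nb] using ⟨u, hu, huv⟩
  refine ⟨(X : Set V) \ (nb X : Set V), indep_sdiff hadj, crown_isFeasible (indep_sdiff hadj), fun x hx => ?_⟩
  have hs := surplus_sdiff_le hadj
  rw [Set.ncard_coe_finset, Set.ncard_coe_finset] at hs
  have hs' : (surplus G ((X : Set V) \ (nb X : Set V)) : ℝ) ≤ -d := by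
    have : surplus G ((X : Set V) \ (nb X : Set V)) ≤ -d := by omega
    exact_mod_cast this
  rw [sum_crown]
  -- Giving dummies the weight 1, each vertex and its partner have total weight at least 1. Summing
  -- over all vertices yields |V| ≤ 2 ∑ x + d, which is the dual bound that the crown attains.
  let g : V ⊕ Fin d → ℝ := Sum.elim x fun _ => 1
  have h1 : ∀ v, 1 ≤ x v + g (f v) := fun v => by
    have := hft v
    rcases hfv : f v with r | r
    · rw [hfv] at this
      simp [t, nb] at this
      exact hx.2 _ _ this
    · simpa [g] using hx.1 v
  have h2 : ∑ v, g (f v) ≤ ∑ w, g w := by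
    rw [← Finset.sum_image (f := g) (g := f) (s := Finset.univ) (fun a _ b _ h => hf h)]
    refine Finset.sum_le_univ_sum_of_nonneg fun w => ?_
    rcases w with w | w
    · exact hx.1 w
    · exact zero_le_one
  have h3 : ∑ w, g w = ∑ v, x v + d := by simp [g, Fintype.sum_sum_type]
  have h4 : (Fintype.card V : ℝ) ≤ ∑ v, x v + ∑ v, g (f v) := by
    rw [← Finset.sum_add_distrib]
    calc (Fintype.card V : ℝ) = ∑ _v : V, (1 : ℝ) := by simp
      _ ≤ _ := Finset.sum_le_sum fun v _ => h1 v
  linarith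

theorem vcStar_eq_of_isOptimum [Fintype V] {G : SimpleGraph V} {x : V → ℝ}
    (hx : IsOptimum G x) : vcStar G = ∑ v, x v :=
  IsLeast.csInf_eq ⟨⟨x, hx.1, rfl⟩, by rintro w ⟨y, hy, rfl⟩; exact hx.2 y hy⟩

theorem vcStar_le [Fintype V] {G : SimpleGraph V} {x : V → ℝ}
    (hx : IsFeasible G x) : vcStar G ≤ ∑ v, x v := by
  obtain ⟨Z, -, hZ⟩ := exists_crown_isOptimum G
  rw [vcStar_eq_of_isOptimum hZ]
  exact hZ.2 x hx

theorem exists_isOptimum [Fintype V] (G : SimpleGraph V) :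
    ∃ x, IsOptimum G x ∧ vcStar G = ∑ v, x v := by
  obtain ⟨Z, -, hZ⟩ := exists_crown_isOptimum G
  exact ⟨_, hZ, vcStar_eq_of_isOptimum hZ⟩

theorem exists_vcStar_eq [Fintype V] (G : SimpleGraph V) :
    ∃ Z, G.IsIndepSet Z ∧ IsOptimum G (crown G Z) ∧
      vcStar G = (Fintype.card V + surplus G Z : ℝ) / 2 := by
  obtain ⟨Z, hZ, hopt⟩ := exists_crown_isOptimum G
  exact ⟨Z, hZ, hopt, by rw [vcStar_eq_of_isOptimum hopt, sum_crown]⟩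

theorem surplus_empty (G : SimpleGraph V) : surplus G ∅ = 0 := by
  simp [surplus, nbhd]

theorem crown_empty (G : SimpleGraph V) : crown G ∅ = fun _ => 1 / 2 := by
  funext v
  exact crown_of_notMem (by simp) (by simp [nbhd])

/-- If no independent set has negative surplus then all-`1/2` is an optimum. -/
theorem vcStar_eq_half [Fintype V] {G : SimpleGraph V}
    (h : ∀ Z, Z.Nonempty → G.IsIndepSet Z → 0 ≤ surplus G Z) :
    IsOptimum G (fun _ => 1 / 2) ∧ vcStar G = (Fintype.card V : ℝ) / 2 := by
  obtain ⟨Z, hZ, hopt, hv⟩ := exists_vcStar_eq G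
  have h0 : (0 : ℝ) ≤ surplus G Z := by
    rcases Z.eq_empty_or_nonempty with rfl | hne
    · simp [surplus_empty]
    · exact_mod_cast h Z hne hZ
  have hfe : IsFeasible G (fun _ => 1 / 2) :=
    crown_empty G ▸ crown_isFeasible (by simp : G.IsIndepSet ∅)
  have hle := vcStar_le hfe
  have hsum : ∑ _v : V, (1 / 2 : ℝ) = (Fintype.card V : ℝ) / 2 := by simp; ring
  rw [hsum] at hle
  have heq : vcStar G = (Fintype.card V : ℝ) / 2 := by linarith
  refine ⟨⟨hfe, fun y hy => ?_⟩, heq⟩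
  rw [hsum, ← heq]
  exact vcStar_le hy

theorem vcStar_of_halfIsUniqueOptimum [Fintype V] {G : SimpleGraph V}
    (h : HalfIsUniqueOptimum G) : vcStar G = (Fintype.card V : ℝ) / 2 := by
  rw [vcStar_eq_of_isOptimum h.1]; simp; ring

/-- A set of surplus at most 0 gives a crown as a second optimum. Conversely, a second optimum can
be improved by moving all its values different from 1/2 a little towards 1/2, because more of them
lie above 1/2 than below. -/
theorem halfIsUniqueOptimum_iff [Fintype V] (G : SimpleGraph V) :
    HalfIsUniqueOptimum G ↔ ∀ Z, Z.Nonempty → G.IsIndepSet Z → 1 ≤ surplus G Z := by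
  constructor
  · rintro h Z ⟨z, hz⟩ hZ
    by_contra hlt
    have h1 : (surplus G Z : ℝ) ≤ 0 := by exact_mod_cast (by omega)
    have h2 := vcStar_of_halfIsUniqueOptimum h
    have hopt : IsOptimum G (crown G Z) := by
      refine ⟨crown_isFeasible hZ, fun y hy => ?_⟩
      have := vcStar_le hy
      rw [sum_crown]
      linarith
    have := congrFun (h.2 _ hopt) z
    rw [crown_of_mem hz] at this
    norm_num at this
  · intro h
    refine ⟨(vcStar_eq_half fun Z h1 h2 => by linarith [h Z h1 h2]).1, fun x hx => ?_⟩
    by_contra hne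
    set Z : Set V := {v | x v < 1 / 2} with hZdef
    set W : Set V := {v | 1 / 2 < x v} with hWdef
    have hZ : G.IsIndepSet Z := fun u hu v hv _ huv => by
      have := hx.1.2 u v huv
      have h1 : x u < 1 / 2 := hu
      have h2 : x v < 1 / 2 := hv
      linarith
    have hNW : nbhd G Z ⊆ W := by
      rintro v ⟨-, u, hu, huv⟩
      have := hx.1.2 u v huv
      have h1 : x u < 1 / 2 := hu
      change 1 / 2 < x v
      linarith
    have hhalf : IsOptimum G (fun _ => 1 / 2) :=
      (vcStar_eq_half fun Z h1 h2 => by linarith [h Z h1 h2]).1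
    -- If `Z` is empty, the sum of `x` exceeds |V|/2, contradicting its optimality; otherwise `W`
    -- contains N(Z), which is larger than `Z`.
    have hlt : (Z.ncard : ℝ) < W.ncard := by
      have h1 := Set.ncard_le_ncard hNW (Set.toFinite _)
      rcases Z.eq_empty_or_nonempty with hZe | hZne
      · have hall : ∀ v, 1 / 2 ≤ x v := fun v => by
          by_contra hv
          have : v ∈ Z := lt_of_not_ge hv
          simp [hZe] at this
        obtain ⟨v, hv⟩ := Function.ne_iff.1 hne
        have : ∑ _v : V, (1 / 2 : ℝ) < ∑ v, x v :=
          Finset.sum_lt_sum (fun v _ => hall v) ⟨v, Finset.mem_univ _, lt_of_le_of_ne (hall v) (Ne.symm hv)⟩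
        exact absurd (hx.2 _ hhalf.1) (not_le.2 this)
      · have := h Z hZne hZ
        unfold surplus at this
        exact_mod_cast (by omega)
    -- The smallest nonzero distance to 1/2, so that a shift by `ε` never crosses 1/2.
    obtain ⟨ε, hε, hεx⟩ : ∃ ε > 0, ∀ v, x v ≠ 1 / 2 → ε ≤ |x v - 1 / 2| := by
      classical
      rcases (Finset.univ.filter fun v => x v ≠ 1 / 2).eq_empty_or_nonempty with he | hne'
      · exact ⟨1, one_pos, fun v hv => by
          have : v ∈ Finset.univ.filter fun v => x v ≠ 1 / 2 :=
            Finset.mem_filter.2 ⟨Finset.mem_univ _, hv⟩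
          rw [he] at this
          exact absurd this (Finset.notMem_empty v)⟩
      · obtain ⟨w, hw, hmin⟩ := Finset.exists_min_image _ (fun v => |x v - 1 / 2|) hne'
        refine ⟨|x w - 1 / 2|, abs_pos.2 (sub_ne_zero.2 (Finset.mem_filter.1 hw).2), fun v hv => ?_⟩
        exact hmin v (by simpa using hv)
    let y : V → ℝ := fun v => x v + ε * Z.indicator 1 v - ε * W.indicator 1 v
    have hyZ : ∀ v ∈ Z, y v = x v + ε ∧ x v + ε ≤ 1 / 2 := fun v hv => by
      have hv' : x v < 1 / 2 := hv
      have hvW : v ∉ W := not_lt.2 hv'.le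
      have := hεx v hv'.ne
      rw [abs_of_neg (by linarith)] at this
      exact ⟨by simp [y, hv, hvW], by linarith⟩
    have hyW : ∀ v ∈ W, y v = x v - ε ∧ 1 / 2 ≤ x v - ε := fun v hv => by
      have hv' : 1 / 2 < x v := hv
      have hvW : v ∉ Z := not_lt.2 hv'.le
      have := hεx v hv'.ne'
      rw [abs_of_pos (by linarith)] at this
      exact ⟨by simp [y, hv, hvW], by linarith⟩
    have hyo : ∀ v, v ∉ Z → v ∉ W → y v = 1 / 2 := fun v h1 h2 => by
      have e : x v = 1 / 2 := le_antisymm (not_lt.1 h2) (not_lt.1 h1)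
      simp [y, h1, h2, e]
    have hyge : ∀ v ∉ Z, 1 / 2 ≤ y v := fun v hv => by
      by_cases hvW : v ∈ W
      · rw [(hyW v hvW).1]; exact (hyW v hvW).2
      · rw [hyo v hv hvW]
    -- On an edge with an end in `Z` the other end is in `W`, so the two shifts cancel. All other
    -- edges have both ends at least 1/2.
    have hyadj : ∀ u v, u ∈ Z → G.Adj u v → 1 ≤ y u + y v := fun u v hu huv => by
      rw [(hyZ u hu).1, (hyW v (hNW (mem_nbhd_of_adj hZ hu huv))).1]
      linarith [hx.1.2 u v huv]
    have hy : IsFeasible G y := by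
      refine ⟨fun v => ?_, fun u v huv => ?_⟩
      · by_cases hv : v ∈ Z
        · rw [(hyZ v hv).1]; linarith [hx.1.1 v]
        · linarith [hyge v hv]
      · by_cases hu : u ∈ Z
        · exact hyadj u v hu huv
        by_cases hv : v ∈ Z
        · linarith [hyadj v u hv huv.symm]
        linarith [hyge u hu, hyge v hv]
    have hsum : ∑ v, y v = ∑ v, x v + ε * Z.ncard - ε * W.ncard := by
      simp only [y, Finset.sum_sub_distrib, Finset.sum_add_distrib, ← Finset.mul_sum,
        sum_indicator_one]
    have := hx.2 y hy
    rw [hsum] at this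
    nlinarith

/-- Extending LP solutions of an induced subgraph. -/
theorem vcStar_le_induce [Fintype V] (G : SimpleGraph V) (S D : Set V) [Fintype S]
    (h : ∀ u v, G.Adj u v → u ∉ S → u ∈ D ∨ v ∈ D) :
    vcStar G ≤ vcStar (G.induce S) + D.ncard := by
  classical
  obtain ⟨y, hy, hv⟩ := exists_isOptimum (G.induce S)
  -- The two contributions are added, so `S` and `D` need not be disjoint.
  let x : V → ℝ := fun v => (if hv : v ∈ S then y ⟨v, hv⟩ else 0) + D.indicator 1 v
  have hD : ∀ v, (0 : ℝ) ≤ D.indicator 1 v := fun v => Set.indicator_nonneg (by simp) v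
  have hS : ∀ v, 0 ≤ if hv : v ∈ S then y ⟨v, hv⟩ else 0 := fun v => by
    split_ifs with h
    · exact hy.1.1 _
    · exact le_rfl
  have nn : ∀ v, 0 ≤ x v := fun v => add_nonneg (hS v) (hD v)
  have one : ∀ v ∈ D, 1 ≤ x v := fun v hv => by
    have := hS v
    simp only [x, Set.indicator_of_mem hv, Pi.one_apply]
    linarith
  have hx : IsFeasible G x := by
    refine ⟨nn, fun u v huv => ?_⟩
    by_cases hc : u ∈ S ∧ v ∈ S
    · have := hy.1.2 ⟨u, hc.1⟩ ⟨v, hc.2⟩ huv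
      simp only [x, hc.1, hc.2, dif_pos]
      linarith [hD u, hD v]
    · have : u ∈ D ∨ v ∈ D := by
        by_cases hu : u ∈ S
        · exact (h v u huv.symm fun hv => hc ⟨hu, hv⟩).symm
        · exact h u v huv hu
      rcases this with hu | hu
      · linarith [nn v, one u hu]
      · linarith [nn u, one v hu]
  have hsum : ∑ v, x v = ∑ v, y v + D.ncard := by
    simp only [x, Finset.sum_add_distrib, sum_indicator_one]
    congr 1
    rw [← Finset.sum_subset (Finset.subset_univ (Finset.univ.filter (· ∈ S)))]
    · rw [← Finset.sum_subtype_of_mem (p := (· ∈ S))]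
      · refine Finset.sum_bij' (fun a _ => a) (fun a _ => a) ?_ ?_ ?_ ?_ ?_ <;> simp
      · simp
    · intro v _ hv
      have : v ∉ S := by simpa using hv
      simp [this]
  rw [hv, ← hsum]
  exact vcStar_le hx

theorem indep_union_image {G : SimpleGraph V} {T : Set V} (hT : G.IsIndepSet T)
    {Z : Set ↑(T ∪ nbhd G T)ᶜ} (hZ : (G.induce (T ∪ nbhd G T)ᶜ).IsIndepSet Z) :
    G.IsIndepSet (T ∪ (↑) '' Z) := by
  have key : ∀ u ∈ T, ∀ v : ↑(T ∪ nbhd G T)ᶜ, ¬ G.Adj u v := fun u hu v huv =>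
    v.2 (.inr (mem_nbhd_of_adj hT hu huv))
  rintro u (hu | ⟨u, hu, rfl⟩) v (hv | ⟨v, hv, rfl⟩) hne huv
  · exact hT hu hv hne huv
  · exact key u hu v huv
  · exact key v hv u huv.symm
  · exact hZ hu hv (fun h => hne (by rw [h])) huv

/-- A neighbour of `Z` outside the remaining graph lies in `T` or N(T), so it is either not a
neighbour of the union or already counted in N(T). -/
theorem surplus_union_image_le [Finite V] {G : SimpleGraph V} {T : Set V}
    (Z : Set ↑(T ∪ nbhd G T)ᶜ) :
    surplus G (T ∪ (↑) '' Z) ≤ surplus G T + surplus (G.induce (T ∪ nbhd G T)ᶜ) Z := by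
  have hsub : nbhd G (T ∪ (↑) '' Z) ⊆
      nbhd G T ∪ (↑) '' (nbhd (G.induce (T ∪ nbhd G T)ᶜ) Z) := by
    rintro v ⟨hv, u, hu, huv⟩
    by_cases hvT : v ∈ nbhd G T
    · exact .inl hvT
    rcases hu with hu | ⟨u, hu, rfl⟩
    · exact .inl ⟨fun h => hv (.inl h), u, hu, huv⟩
    · refine .inr ⟨⟨v, fun h => h.elim (fun h => hv (.inl h)) hvT⟩, ⟨fun h => hv (.inr ⟨_, h, rfl⟩),
        u, hu, huv⟩, rfl⟩
  have h1 := (Set.ncard_le_ncard hsub).trans (Set.ncard_union_le _ _)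
  rw [Set.ncard_image_of_injective _ Subtype.val_injective] at h1
  have h2 : (T ∪ (↑) '' Z).ncard = T.ncard + Z.ncard := by
    rw [Set.ncard_union_eq, Set.ncard_image_of_injective _ Subtype.val_injective]
    refine Set.disjoint_left.2 ?_
    rintro _ h ⟨u, -, rfl⟩
    exact u.2 (.inl h)
  unfold surplus
  omega

/-- The LP optimum after deleting `T ∪ N(T)`, in terms of surpluses in the whole graph. -/
theorem exists_vcStar_induce [Fintype V] {G : SimpleGraph V} {T : Set V} [Fintype ↑(T ∪ nbhd G T)ᶜ]
    (hT : G.IsIndepSet T) :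
    ∃ Y, T ⊆ Y ∧ G.IsIndepSet Y ∧
      (Fintype.card V + surplus G Y : ℝ) / 2 ≤
        vcStar (G.induce (T ∪ nbhd G T)ᶜ) + (nbhd G T).ncard := by
  obtain ⟨Z, hZ, -, hv⟩ := exists_vcStar_eq (G.induce (T ∪ nbhd G T)ᶜ)
  refine ⟨_, Set.subset_union_left, indep_union_image hT hZ, ?_⟩
  have h1 : (surplus G (T ∪ (↑) '' Z) : ℝ) ≤
      surplus G T + surplus (G.induce (T ∪ nbhd G T)ᶜ) Z := by
    exact_mod_cast surplus_union_image_le Z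
  have h2 : (Fintype.card V : ℝ) = T.ncard + (nbhd G T).ncard +
      Fintype.card ↑(T ∪ nbhd G T)ᶜ := by
    have h3 := Set.ncard_add_ncard_compl (T ∪ nbhd G T)
    rw [Set.ncard_union_eq (disjoint_nbhd G T), Nat.card_eq_fintype_card,
      ← Nat.card_coe_set_eq (T ∪ nbhd G T)ᶜ, Nat.card_eq_fintype_card] at h3
    exact_mod_cast h3.symm
  have h3 : (surplus G T : ℝ) = (nbhd G T).ncard - T.ncard := by simp [surplus]
  rw [hv]
  linarith

/-- The Nemhauser–Trotter decomposition. -/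
theorem exists_crown_halfIsUniqueOptimum [Fintype V] (G : SimpleGraph V) :
    ∃ Z, G.IsIndepSet Z ∧ IsOptimum G (crown G Z) ∧
      ∀ Y, (Y : Set ↑(Z ∪ nbhd G Z)ᶜ).Nonempty → (G.induce (Z ∪ nbhd G Z)ᶜ).IsIndepSet Y →
        1 ≤ surplus (G.induce (Z ∪ nbhd G Z)ᶜ) Y := by
  -- A largest set with optimal crown: a nonempty independent set of surplus at most 0 in the rest
  -- could be added to it, keeping the crown optimal.
  obtain ⟨Z, ⟨hZ, hopt⟩, hmax⟩ := Set.exists_max_image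
    {Z : Set V | G.IsIndepSet Z ∧ IsOptimum G (crown G Z)} Set.ncard (Set.toFinite _)
    (exists_crown_isOptimum G)
  refine ⟨Z, hZ, hopt, fun Y hY hYi => ?_⟩
  by_contra hlt
  have hle := surplus_union_image_le (G := G) (T := Z) Y
  have hind := indep_union_image hZ hYi
  have h1 : (surplus G (Z ∪ (↑) '' Y) : ℝ) ≤ surplus G Z := by exact_mod_cast (by omega)
  have hopt' : IsOptimum G (crown G (Z ∪ (↑) '' Y)) := by
    refine ⟨crown_isFeasible hind, fun y hy => le_trans ?_ (hopt.2 y hy)⟩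
    rw [sum_crown, sum_crown]
    linarith
  have := hmax _ ⟨hind, hopt'⟩
  obtain ⟨y, hy⟩ := hY
  have hss : Z ⊂ Z ∪ (↑) '' Y := by
    refine ⟨Set.subset_union_left, fun h => y.2 (.inl (h (.inr ⟨y, hy, rfl⟩)))⟩
  exact absurd (Set.ncard_lt_ncard hss) (not_lt.2 this)

end Crowns


/-! ### Vertex covers under deletion and folding -/

section Covers

variable {V : Type}

theorem hasVertexCover_of_induce [Finite V] {G : SimpleGraph V} {S D : Set V} {k : ℤ}
    (h : ∀ u v, G.Adj u v → u ∉ S → u ∈ D ∨ v ∈ D)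
    (hc : HasVertexCover (G.induce S) (k - D.ncard)) : HasVertexCover G k := by
  obtain ⟨C, -, hC, hk⟩ := hc
  refine ⟨(↑) '' C ∪ D, Set.toFinite _, fun u v huv => ?_, ?_⟩
  · by_cases hu : u ∈ S
    · by_cases hv : v ∈ S
      · rcases hC (show (G.induce S).Adj ⟨u, hu⟩ ⟨v, hv⟩ from huv) with h' | h'
        · exact .inl (.inl ⟨_, h', rfl⟩)
        · exact .inr (.inl ⟨_, h', rfl⟩)
      · exact (h v u huv.symm hv).elim (fun h => .inr (.inr h)) fun h => .inl (.inr h)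
    · exact (h u v huv hu).elim (fun h => .inl (.inr h)) fun h => .inr (.inr h)
  · have h1 := Set.ncard_union_le ((↑) '' C) D
    rw [Set.ncard_image_of_injective _ Subtype.val_injective] at h1
    omega

theorem hasVertexCover_induce [Finite V] {G : SimpleGraph V} {S D C : Set V} {k : ℤ}
    (hC : G.IsVertexCover C) (hk : (C.ncard : ℤ) ≤ k) (hD : D ⊆ C) (hSD : Disjoint S D) :
    HasVertexCover (G.induce S) (k - D.ncard) := by
  refine ⟨(↑) ⁻¹' C, Set.toFinite _, fun u v huv =>
    hC (show G.Adj u v from huv), ?_⟩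
  have h1 : ((↑) '' ((↑) ⁻¹' C : Set S) : Set V) ⊆ C \ D := by
    rintro _ ⟨u, hu, rfl⟩
    exact ⟨hu, Set.disjoint_left.1 hSD u.2⟩
  have h2 := Set.ncard_le_ncard h1
  rw [Set.ncard_image_of_injective _ Subtype.val_injective] at h2
  have h3 := Set.ncard_sdiff_add_ncard_of_subset hD
  omega

theorem isVertexCover_exchange {G : SimpleGraph V} {Z S : Set V} (hZ : G.IsIndepSet Z)
    (hS : G.IsVertexCover S) : G.IsVertexCover (S \ Z ∪ nbhd G Z) := by
  have key : ∀ u v, G.Adj u v → u ∈ S → u ∈ S \ Z ∪ nbhd G Z ∨ v ∈ S \ Z ∪ nbhd G Z :=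
    fun u v huv hu => by
      by_cases h : u ∈ Z
      · exact .inr (.inr (mem_nbhd_of_adj hZ h huv))
      · exact .inl (.inl ⟨hu, h⟩)
  intro u v huv
  rcases hS huv with h | h
  · exact key u v huv h
  · exact (key v u huv.symm h).symm

/-- Put A = Z \ S. The cover contains N(A), so for nonempty A comparing the surplus of Z with that
of A gives |N(Z) \ S| ≤ |Z ∩ S|. If A is empty, all of Z is released, which pays for N(Z) \ S unless
|N(Z)| = |Z| + 1 and no vertex of N(Z) was in S. -/
theorem ncard_exchange_le [Finite V] {G : SimpleGraph V} {Z S : Set V}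
    (hs : surplus G Z ≤ 1) (hmin : ∀ A ⊆ Z, A.Nonempty → surplus G Z ≤ surplus G A)
    (hS : G.IsVertexCover S) (hZ : G.IsIndepSet Z) :
    (S \ Z ∪ nbhd G Z).ncard ≤ S.ncard ∨
      (Z ⊆ S ∧ Disjoint (nbhd G Z) S ∧ surplus G Z = 1) := by
  have h1 : (S \ Z ∪ nbhd G Z).ncard ≤ (S \ Z).ncard + (nbhd G Z \ S).ncard := by
    refine (Set.ncard_le_ncard ?_).trans (Set.ncard_union_le _ _)
    rintro v (hv | hv)
    · exact .inl hv
    · by_cases h : v ∈ S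
      · exact .inl ⟨h, hv.1⟩
      · exact .inr ⟨hv, h⟩
  have h2 := Set.ncard_inter_add_ncard_sdiff_eq_ncard S Z
  have h3 := Set.ncard_inter_add_ncard_sdiff_eq_ncard Z S
  have h4 := Set.ncard_inter_add_ncard_sdiff_eq_ncard (nbhd G Z) S
  rw [Set.inter_comm] at h3
  rcases (Z \ S).eq_empty_or_nonempty with hA | hA
  · rw [hA, Set.ncard_empty] at h3
    by_cases hd : Disjoint (nbhd G Z) S
    · by_cases h1' : surplus G Z = 1
      · exact .inr ⟨Set.sdiff_eq_empty.1 hA, hd, h1'⟩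
      · unfold surplus at hs h1'
        omega
    · have : 0 < (nbhd G Z ∩ S).ncard :=
        (Set.ncard_pos).2 (Set.not_disjoint_iff_nonempty_inter.1 hd)
      unfold surplus at hs
      omega
  · have h5 := hmin _ Set.sdiff_subset hA
    have h6 : nbhd G (Z \ S) ⊆ nbhd G Z ∩ S := by
      rintro v ⟨hv, u, hu, huv⟩
      have hvS : v ∈ S := (hS huv).resolve_left hu.2
      exact ⟨mem_nbhd_of_adj hZ hu.1 huv, hvS⟩
    have h7 := Set.ncard_le_ncard h6
    unfold surplus at h5
    omega

theorem adj_meets_nbhd {G : SimpleGraph V} {Z : Set V} (hZ : G.IsIndepSet Z) (u v : V)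
    (huv : G.Adj u v) (hu : u ∉ (Z ∪ nbhd G Z)ᶜ) : u ∈ nbhd G Z ∨ v ∈ nbhd G Z := by
  rcases not_not.1 hu with h | h
  · exact .inr (mem_nbhd_of_adj hZ h huv)
  · exact .inl h

theorem disjoint_compl_union_nbhd (G : SimpleGraph V) (Z : Set V) :
    Disjoint (Z ∪ nbhd G Z)ᶜ (nbhd G Z) :=
  Set.disjoint_left.2 fun _ h h' => h (.inr h')

/-- The exceptional case of the exchange needs surplus 1 and a cover missing N(Z), hence an
independent N(Z); the hypothesis `h` excludes it. With surplus at most 0 this is the reduction that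
the machine uses instead of the Nemhauser–Trotter rule. -/
theorem hasVertexCover_crown [Finite V] {G : SimpleGraph V} {Z : Set V} (k : ℤ)
    (hZ : G.IsIndepSet Z) (hs : surplus G Z ≤ 1)
    (hmin : ∀ A ⊆ Z, A.Nonempty → surplus G Z ≤ surplus G A)
    (h : surplus G Z ≤ 0 ∨ ¬ G.IsIndepSet (nbhd G Z)) :
    HasVertexCover (G.induce (Z ∪ nbhd G Z)ᶜ) (k - (nbhd G Z).ncard) ↔ HasVertexCover G k := by
  refine ⟨hasVertexCover_of_induce (adj_meets_nbhd hZ), ?_⟩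
  rintro ⟨S, -, hS, hk⟩
  rcases ncard_exchange_le hs hmin hS hZ with h1 | ⟨h1, h2, h3⟩
  · exact hasVertexCover_induce (isVertexCover_exchange hZ hS) (by omega) Set.subset_union_right
      (disjoint_compl_union_nbhd G Z)
  · refine absurd (fun u hu v hv _ huv => ?_) (h.resolve_left (by omega))
    exact (hS huv).elim (Set.disjoint_left.1 h2 hu) (Set.disjoint_left.1 h2 hv)

theorem ncard_option_preimage_le [Finite V] {S : Set V} (C : Set V) (D : Set (Option S))
    (hD : ∀ v, some v ∈ D → (v : V) ∈ C) : (D \ {none}).ncard ≤ (C ∩ S).ncard := by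
  have : D \ {none} ⊆ some '' ((↑) ⁻¹' C : Set S) := by
    rintro (_ | v) ⟨h, h'⟩
    · exact absurd rfl h'
    · exact ⟨v, hD v h, rfl⟩
  refine (Set.ncard_le_ncard this).trans ?_
  rw [Set.ncard_image_of_injective _ (Option.some_injective _),
    ← Set.ncard_image_of_injective _ Subtype.val_injective, Subtype.image_preimage_coe,
    Set.inter_comm]

/-- Some best cover takes all of N(Z) and nothing of Z, or all of Z and nothing of N(Z), and the
first choice costs one more. The new vertex records this choice and its cost: it is in the cover
exactly when N(Z) is taken, and otherwise the remaining neighbours of N(Z) must be covered. -/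
theorem hasVertexCover_identify [Finite V] {G : SimpleGraph V} {Z : Set V} (k : ℤ)
    (hZ : G.IsIndepSet Z) (hs : surplus G Z = 1)
    (hmin : ∀ A ⊆ Z, A.Nonempty → surplus G Z ≤ surplus G A) (hN : G.IsIndepSet (nbhd G Z)) :
    HasVertexCover (identify G Z) (k - Z.ncard) ↔ HasVertexCover G k := by
  classical
  have hsur : (nbhd G Z).ncard = Z.ncard + 1 := by unfold surplus at hs; omega
  constructor
  · rintro ⟨C, -, hC, hk⟩
    let C' : Set V := (↑) '' (some ⁻¹' C)
    have hC' : ∀ v (hv : v ∈ (Z ∪ nbhd G Z)ᶜ), some ⟨v, hv⟩ ∈ C → v ∈ C' :=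
      fun v hv h => ⟨_, h, rfl⟩
    have hcard : C'.ncard = (C \ {none}).ncard := by
      rw [Set.ncard_image_of_injective _ Subtype.val_injective,
        ← Set.ncard_image_of_injective _ (Option.some_injective _)]
      congr 1
      ext (_ | v) <;> simp
    by_cases hnone : none ∈ C
    · refine hasVertexCover_of_induce (S := (Z ∪ nbhd G Z)ᶜ) (adj_meets_nbhd hZ) ?_
      refine ⟨some ⁻¹' C, Set.toFinite _, fun u v huv =>
        hC (show (identify G Z).Adj (some u) (some v) from huv), ?_⟩
      have h1 := Set.ncard_sdiff_singleton_add_one hnone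
      rw [Set.ncard_image_of_injective _ Subtype.val_injective] at hcard
      omega
    · refine ⟨C' ∪ Z, Set.toFinite _, ?_, ?_⟩
      · have key : ∀ u v, G.Adj u v → u ∈ nbhd G Z → v ∈ C' ∪ Z := fun u v huv hu => by
          by_cases hv : v ∈ Z ∪ nbhd G Z
          · rcases hv with hv | hv
            · exact .inr hv
            · exact absurd huv (hN hu hv huv.ne)
          · refine .inl (hC' v hv ?_)
            have : (identify G Z).Adj none (some ⟨v, hv⟩) := ⟨u, hu, huv⟩
            exact (hC this).resolve_left hnone
        intro u v huv
        by_cases hu : u ∈ Z ∪ nbhd G Z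
        · rcases hu with hu | hu
          · exact .inl (.inr hu)
          · exact .inr (key u v huv hu)
        by_cases hv : v ∈ Z ∪ nbhd G Z
        · rcases hv with hv | hv
          · exact .inr (.inr hv)
          · exact .inl (key v u huv.symm hv)
        have : (identify G Z).Adj (some ⟨u, hu⟩) (some ⟨v, hv⟩) := huv
        rcases hC this with h | h
        · exact .inl (.inl (hC' u hu h))
        · exact .inr (.inl (hC' v hv h))
      · have h1 := Set.ncard_union_le C' Z
        rw [Set.sdiff_singleton_eq_self hnone] at hcard
        omega
  · rintro ⟨S, -, hS, hk⟩
    rcases ncard_exchange_le hs.le hmin hS hZ with h1 | ⟨h1, h2, h3⟩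
    · set S' := S \ Z ∪ nbhd G Z
      have hS' : G.IsVertexCover S' := isVertexCover_exchange hZ hS
      refine ⟨{o | o = none ∨ ∃ v, o = some v ∧ (v : V) ∈ S'}, Set.toFinite _, ?_, ?_⟩
      · rintro (_ | u) (_ | v) huv
        · exact absurd huv ((identify G Z).irrefl)
        · exact .inl (.inl rfl)
        · exact .inr (.inl rfl)
        · rcases hS' (show G.Adj u v from huv) with h | h
          · exact .inl (.inr ⟨u, rfl, h⟩)
          · exact .inr (.inr ⟨v, rfl, h⟩)
      · set D : Set (Option ↑(Z ∪ nbhd G Z)ᶜ) := {o | o = none ∨ ∃ v, o = some v ∧ (v : V) ∈ S'}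
        have h4 := ncard_option_preimage_le S' D fun v hv => by
          rcases hv with hv | ⟨w, hw, hw'⟩
          · cases hv
          · cases hw; exact hw'
        have h5 : (S' ∩ (Z ∪ nbhd G Z)ᶜ).ncard ≤ (S' \ nbhd G Z).ncard :=
          Set.ncard_le_ncard fun v hv => ⟨hv.1, fun h => hv.2 (.inr h)⟩
        have h6 := Set.ncard_sdiff_add_ncard_of_subset
          (show nbhd G Z ⊆ S' from Set.subset_union_right)
        have h7 := Set.ncard_sdiff_singleton_add_one (show none ∈ D from .inl rfl)
        omega
    · refine ⟨{o | ∃ v, o = some v ∧ (v : V) ∈ S}, Set.toFinite _, ?_, ?_⟩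
      · have key : ∀ v : ↑(Z ∪ nbhd G Z)ᶜ, (∃ w ∈ nbhd G Z, G.Adj w v) → (v : V) ∈ S := by
          rintro v ⟨w, hw, hwv⟩
          exact (hS hwv).resolve_left (Set.disjoint_left.1 h2 hw)
        rintro (_ | u) (_ | v) huv
        · exact absurd huv ((identify G Z).irrefl)
        · exact .inr ⟨v, rfl, key v huv⟩
        · exact .inl ⟨u, rfl, key u huv⟩
        · rcases hS (show G.Adj u v from huv) with h | h
          · exact .inl ⟨u, rfl, h⟩
          · exact .inr ⟨v, rfl, h⟩
      · set D : Set (Option ↑(Z ∪ nbhd G Z)ᶜ) := {o | ∃ v, o = some v ∧ (v : V) ∈ S}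
        have h4 := ncard_option_preimage_le S D fun v hv => by
          obtain ⟨w, hw, hw'⟩ := hv
          cases hw; exact hw'
        have h5 : (S ∩ (Z ∪ nbhd G Z)ᶜ).ncard ≤ (S \ Z).ncard :=
          Set.ncard_le_ncard fun v hv => ⟨hv.1, fun h => hv.2 (.inl h)⟩
        have h6 := Set.ncard_sdiff_add_ncard_of_subset h1
        rw [Set.sdiff_singleton_eq_self (show none ∉ D by rintro ⟨v, hv, -⟩; cases hv)] at h4
        omega

theorem vcStar_le_identify [Fintype V] {G : SimpleGraph V} {Z : Set V}
    [Fintype (Option ↑(Z ∪ nbhd G Z)ᶜ)] (hZ : G.IsIndepSet Z) (hs : surplus G Z = 1)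
    (hN : G.IsIndepSet (nbhd G Z)) : vcStar G ≤ vcStar (identify G Z) + Z.ncard := by
  classical
  obtain ⟨y, hy, hv⟩ := exists_isOptimum (identify G Z)
  -- The value of the new vertex, capped at 1, is spread over N(Z), and Z receives 1 - t. Since
  -- |N(Z)| = |Z| + 1, this costs |Z| + t in total.
  set t := min (y none) 1 with ht
  have ht0 : 0 ≤ t := le_min (hy.1.1 _) zero_le_one
  have ht1 : t ≤ 1 := min_le_right _ _
  let x : V → ℝ := fun v => (if hv : v ∈ (Z ∪ nbhd G Z)ᶜ then y (some ⟨v, hv⟩) else 0) +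
    t * (nbhd G Z).indicator 1 v + (1 - t) * Z.indicator 1 v
  have hxZ : ∀ v ∈ Z, x v = 1 - t := fun v hv => by
    have : v ∉ nbhd G Z := fun h => h.1 hv
    simp [x, hv, this]
  have hxN : ∀ v ∈ nbhd G Z, x v = t := fun v hv => by
    simp [x, hv, hv.1]
  have hxo : ∀ v (hv : v ∈ (Z ∪ nbhd G Z)ᶜ), x v = y (some ⟨v, hv⟩) := fun v hv => by
    have h1 : v ∉ Z := fun h => hv (.inl h)
    have h2 : v ∉ nbhd G Z := fun h => hv (.inr h)
    simp [x, h1, h2]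
  have nn : ∀ v, 0 ≤ x v := fun v => by
    by_cases h : v ∈ (Z ∪ nbhd G Z)ᶜ
    · rw [hxo v h]; exact hy.1.1 _
    · rcases not_not.1 h with h | h
      · rw [hxZ v h]; linarith
      · rw [hxN v h]; exact ht0
  have keyN : ∀ u v, G.Adj u v → u ∈ nbhd G Z → 1 ≤ x u + x v := fun u v huv hu => by
    rw [hxN u hu]
    by_cases h : v ∈ (Z ∪ nbhd G Z)ᶜ
    · rw [hxo v h]
      have := hy.1.2 none (some ⟨v, h⟩) ⟨u, hu, huv⟩
      have h0 := hy.1.1 (some ⟨v, h⟩)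
      rcases min_choice (y none) 1 with h' | h' <;> rw [ht, h'] <;> linarith
    · rcases not_not.1 h with h | h
      · rw [hxZ v h]; linarith
      · exact absurd huv (hN hu h huv.ne)
  have hx : IsFeasible G x := by
    refine ⟨nn, fun u v huv => ?_⟩
    by_cases hu : u ∈ nbhd G Z
    · exact keyN u v huv hu
    by_cases hv : v ∈ nbhd G Z
    · linarith [keyN v u huv.symm hv]
    have hu' : u ∉ Z := fun h => hv (mem_nbhd_of_adj hZ h huv)
    have hv' : v ∉ Z := fun h => hu (mem_nbhd_of_adj hZ h huv.symm)
    rw [hxo u (fun h => h.elim hu' hu), hxo v (fun h => h.elim hv' hv)]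
    exact hy.1.2 (some _) (some _) huv
  have hsum : ∑ v, x v = ∑ v : ↑(Z ∪ nbhd G Z)ᶜ, y (some v) + t * (nbhd G Z).ncard
      + (1 - t) * Z.ncard := by
    simp only [x, Finset.sum_add_distrib, ← Finset.mul_sum, sum_indicator_one]
    congr 2
    rw [← Finset.sum_subset (Finset.subset_univ (Finset.univ.filter (· ∈ (Z ∪ nbhd G Z)ᶜ)))]
    · refine Finset.sum_bij' (fun a ha => ⟨a, (Finset.mem_filter.1 ha).2⟩) (fun a _ => a)
        ?_ ?_ ?_ ?_ ?_ <;> simp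
      intro a h1 h2
      rw [dif_pos ⟨h1, h2⟩]
    · intro v _ hv
      have : v ∉ (Z ∪ nbhd G Z)ᶜ := by simpa using hv
      rw [dif_neg this]
  have hcard : ((nbhd G Z).ncard : ℝ) = Z.ncard + 1 := by
    have : (nbhd G Z).ncard = Z.ncard + 1 := by unfold surplus at hs; omega
    exact_mod_cast this
  have hopt : ∑ o, y o = y none + ∑ v : ↑(Z ∪ nbhd G Z)ᶜ, y (some v) := by
    convert Fintype.sum_option y
  have htle : t ≤ y none := min_le_left _ _
  have := vcStar_le hx
  rw [hsum, hcard] at this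
  rw [hv, hopt]
  linarith

end Covers


/-! ### The LP lower bound and the soundness of the Nemhauser–Trotter rule -/

section Covers

variable {V : Type}

theorem mem_nbhd_singleton {G : SimpleGraph V} {u v : V} : v ∈ nbhd G {u} ↔ G.Adj u v := by
  simp only [nbhd, Set.mem_singleton_iff, exists_eq_left, Set.mem_ofPred_eq]
  exact ⟨fun h => h.2, fun h => ⟨h.ne', h⟩⟩

theorem vcStar_le_of_hasVertexCover [Fintype V] {G : SimpleGraph V} {k : ℤ}
    (h : HasVertexCover G k) : vcStar G ≤ k := by
  obtain ⟨S, -, hS, hk⟩ := h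
  have hx : IsFeasible G (S.indicator 1) := by
    have nn : ∀ v, (0 : ℝ) ≤ S.indicator 1 v := fun v => Set.indicator_nonneg (by simp) v
    refine ⟨nn, fun u v huv => ?_⟩
    rcases hS huv with h | h
    · rw [Set.indicator_of_mem h, Pi.one_apply]; linarith [nn v]
    · rw [Set.indicator_of_mem h, Pi.one_apply]; linarith [nn u]
  have h1 := vcStar_le hx
  rw [sum_indicator_one] at h1
  have h2 : (S.ncard : ℝ) ≤ k := by exact_mod_cast hk
  linarith

/-- Correctness of the Nemhauser–Trotter rule. -/
theorem hasVertexCover_nemhauserTrotter [Fintype V] {G : SimpleGraph V} {x : V → ℝ} (k : ℤ)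
    (hopt : IsOptimum G x) (hhalf : ∀ v, x v = 0 ∨ x v = 1 / 2 ∨ x v = 1) :
    HasVertexCover (G.induce {v | x v = 1 / 2}) (k - {v | x v = 1}.ncard) ↔
      HasVertexCover G k := by
  set Z : Set V := {v | x v = 0} with hZdef
  set W : Set V := {v | x v = 1} with hWdef
  have hZW : ∀ u v, G.Adj u v → u ∈ Z → v ∈ W := fun u v huv hu => by
    have h1 : x u = 0 := hu
    have h2 := hopt.1.2 u v huv
    change x v = 1
    rcases hhalf v with h | h | h <;> linarith
  constructor
  · refine hasVertexCover_of_induce fun u v huv hu => ?_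
    rcases hhalf u with h | h | h
    · exact .inr (hZW u v huv h)
    · exact absurd h hu
    · exact .inl h
  · rintro ⟨S, -, hS, hk⟩
    -- Resetting `W \ S` and `Z ∩ S` to 1/2 keeps `x` feasible, because the neighbours of `W \ S`
    -- lie in the cover `S` and so have value at least 1/2 afterwards. Optimality of `x` then
    -- compares the sizes of the two sets, and replacing `S` by `S \ Z ∪ W` is free.
    have hc : (W \ S).ncard ≤ (Z ∩ S).ncard := by
      let y : V → ℝ := fun v => x v + (Z ∩ S).indicator 1 v / 2 - (W \ S).indicator 1 v / 2
      have hyWS : ∀ v ∈ W \ S, y v = 1 / 2 := fun v hv => by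
        have h1 : x v = 1 := hv.1
        have h2 : v ∉ Z ∩ S := fun h => hv.2 h.2
        simp [y, hv, h2, h1]; norm_num
      have hyZS : ∀ v ∈ Z ∩ S, y v = 1 / 2 := fun v hv => by
        have h1 : x v = 0 := hv.1
        have h2 : v ∉ W \ S := fun h => h.2 hv.2
        simp [y, hv, h2, h1]
      have hyo : ∀ v, v ∉ Z ∩ S → v ∉ W \ S → y v = x v := fun v h1 h2 => by
        simp [y, h1, h2]
      have hyle : ∀ v, v ∉ W \ S → x v ≤ y v := fun v h2 => by
        by_cases h : v ∈ Z ∩ S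
        · rw [hyZS v h]; have h1 : x v = 0 := h.1
          rw [h1]; norm_num
        · rw [hyo v h h2]
      have key : ∀ u v, G.Adj u v → u ∈ W \ S → 1 ≤ y u + y v := fun u v huv hu => by
        rw [hyWS u hu]
        have hv : v ∈ S := (hS huv).resolve_left hu.2
        by_cases hvZ : v ∈ Z
        · rw [hyZS v ⟨hvZ, hv⟩]; norm_num
        · have h1 := hyle v fun h => h.2 hv
          rcases hhalf v with h | h | h
          · exact absurd h hvZ
          · linarith
          · linarith
      have hy : IsFeasible G y := by
        refine ⟨fun v => ?_, fun u v huv => ?_⟩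
        · by_cases h : v ∈ W \ S
          · rw [hyWS v h]; norm_num
          · exact (hopt.1.1 v).trans (hyle v h)
        · by_cases hu : u ∈ W \ S
          · exact key u v huv hu
          by_cases hv : v ∈ W \ S
          · linarith [key v u huv.symm hv]
          linarith [hyle u hu, hyle v hv, hopt.1.2 u v huv]
      have hle := hopt.2 y hy
      simp only [y, Finset.sum_sub_distrib, Finset.sum_add_distrib, ← Finset.sum_div,
        sum_indicator_one] at hle
      have : ((W \ S).ncard : ℝ) ≤ (Z ∩ S).ncard := by linarith
      exact_mod_cast this
    refine hasVertexCover_induce (C := S \ Z ∪ W) ?_ ?_ Set.subset_union_right ?_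
    · have key : ∀ u v, G.Adj u v → u ∈ S → u ∈ S \ Z ∪ W ∨ v ∈ S \ Z ∪ W :=
        fun u v huv hu => by
          by_cases h : u ∈ Z
          · exact .inr (.inr (hZW u v huv h))
          · exact .inl (.inl ⟨hu, h⟩)
      intro u v huv
      rcases hS huv with h | h
      · exact key u v huv h
      · exact (key v u huv.symm h).symm
    · have h1 : (S \ Z ∪ W).ncard ≤ (S \ Z).ncard + (W \ S).ncard := by
        refine (Set.ncard_le_ncard ?_).trans (Set.ncard_union_le _ _)
        rintro v (hv | hv)
        · exact .inl hv
        · by_cases h : v ∈ S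
          · have h1 : x v = 1 := hv
            exact .inl ⟨h, fun h2 : x v = 0 => by rw [h1] at h2; norm_num at h2⟩
          · exact .inr ⟨hv, h⟩
      have h2 := Set.ncard_inter_add_ncard_sdiff_eq_ncard S Z
      rw [Set.inter_comm] at h2
      omega
    · refine Set.disjoint_left.2 fun v (h : x v = 1 / 2) (h' : x v = 1) => ?_
      rw [h] at h'; norm_num at h'

end Covers

/-! ### The branching algorithm -/

namespace Inst

theorem card_keep (I : Inst) (S : Set I.V) (d : ℕ) :
    Fintype.card (I.keep S d).V = S.ncard := by
  rw [← Nat.card_eq_fintype_card]; rfl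

theorem card_keep_lt (I : Inst) {S : Set I.V} (d : ℕ) {v : I.V} (hv : v ∉ S) :
    Fintype.card (I.keep S d).V < Fintype.card I.V := by
  rw [card_keep, ← Nat.card_eq_fintype_card, ← Set.ncard_univ]
  exact Set.ncard_lt_ncard ⟨Set.subset_univ _, fun h => hv (h (Set.mem_univ v))⟩

theorem card_fold_lt (I : Inst) {Z : Set I.V} (h : IsSurplusOne I.G Z) :
    Fintype.card (I.fold Z).V < Fintype.card I.V := by
  obtain ⟨hne, -, hs⟩ := h
  rw [← Nat.card_eq_fintype_card, ← Nat.card_eq_fintype_card]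
  change Nat.card (Option ↑(Z ∪ nbhd I.G Z)ᶜ) < _
  rw [Finite.card_option, Nat.card_coe_set_eq]
  have h1 := Set.ncard_add_ncard_compl (Z ∪ nbhd I.G Z)
  rw [Set.ncard_union_eq (disjoint_nbhd I.G Z)] at h1
  have h2 := (Set.ncard_pos).2 hne
  omega

theorem measure_keep (I : Inst) (S : Set I.V) (d : ℕ) :
    (I.keep S d).measure =
      I.k - d - @vcStar S (Fintype.ofFinite S) (I.G.induce S) := by
  change ((I.k - d : ℤ) : ℝ) - @vcStar S (Fintype.ofFinite S) (I.G.induce S) = _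
  push_cast
  rfl

theorem measure_keep_le (I : Inst) {S D : Set I.V}
    (h : ∀ u v, I.G.Adj u v → u ∉ S → u ∈ D ∨ v ∈ D) :
    (I.keep S D.ncard).measure ≤ I.measure := by
  have := @vcStar_le_induce _ _ I.G S D (Fintype.ofFinite S) h
  rw [measure_keep, measure]
  linarith

theorem measure_keep_crown_le (I : Inst) {Z : Set I.V} (hZ : I.G.IsIndepSet Z) :
    (I.keep (Z ∪ nbhd I.G Z)ᶜ (nbhd I.G Z).ncard).measure ≤ I.measure :=
  measure_keep_le I (adj_meets_nbhd hZ)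

theorem measure_fold_le (I : Inst) {Z : Set I.V} (h : I.FoldRuleApplies Z) :
    (I.fold Z).measure ≤ I.measure := by
  obtain ⟨⟨-, hZ, hs⟩, hN⟩ := h
  have := @vcStar_le_identify _ _ I.G Z (Fintype.ofFinite _) hZ hs hN
  change ((I.k - Z.ncard : ℤ) : ℝ) - @vcStar _ (Fintype.ofFinite _) (identify I.G Z) ≤
    I.k - vcStar I.G
  push_cast
  linarith

/-- Once all-1/2 is the unique optimum surpluses are at least 1, and a set of surplus exactly 1
triggers the second or the third rule according to whether its neighbourhood is independent. -/
theorem reduced_iff (I : Inst) :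
    I.Reduced ↔ ∀ Z, Z.Nonempty → I.G.IsIndepSet Z → 2 ≤ surplus I.G Z := by
  unfold Reduced NTApplies
  rw [not_not, halfIsUniqueOptimum_iff]
  constructor
  · rintro ⟨h1, h2, h3⟩ Z hne hZ
    by_contra hlt
    have hs : surplus I.G Z = 1 := by have := h1 Z hne hZ; omega
    by_cases hN : I.G.IsIndepSet (nbhd I.G Z)
    · exact h3 Z ⟨⟨hne, hZ, hs⟩, hN⟩
    · exact h2 Z ⟨⟨hne, hZ, hs⟩, hN⟩
  · intro h
    have key : ∀ Z, ¬ IsSurplusOne I.G Z := fun Z hZ => by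
      have h1 := h Z hZ.1 hZ.2.1
      have h2 : surplus I.G Z = 1 := hZ.2.2
      omega
    exact ⟨fun Z hne hZ => by have := h Z hne hZ; omega, fun Z hZ => key Z hZ.1,
      fun Z hZ => key Z hZ.1⟩

theorem vcStar_of_reduced {I : Inst} (h : I.Reduced) :
    vcStar I.G = (Fintype.card I.V : ℝ) / 2 :=
  (vcStar_eq_half fun Z h1 h2 => by linarith [(reduced_iff I).1 h Z h1 h2]).2

/-- Restoring `u` adds at most one neighbour to an independent set of G - u, so surpluses in G - u
stay nonnegative and vc*(G - u) is at least (|V| - 1)/2. -/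
theorem measure_take_le (I : Inst) (u : I.V) (h : I.Reduced) :
    (I.take u).measure ≤ I.measure - 1 / 2 := by
  have hv := vcStar_of_reduced h
  let _ : Fintype ↑({u}ᶜ : Set I.V) := Fintype.ofFinite _
  obtain ⟨Z, hZ, -, hv'⟩ := exists_vcStar_eq (I.G.induce {u}ᶜ)
  have hind : I.G.IsIndepSet ((↑) '' Z) := by
    rintro _ ⟨a, ha, rfl⟩ _ ⟨b, hb, rfl⟩ hne hab
    exact hZ ha hb (fun h => hne (by rw [h])) hab
  have hN : nbhd I.G ((↑) '' Z) ⊆ insert u ((↑) '' nbhd (I.G.induce {u}ᶜ) Z) := by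
    rintro v ⟨hv, _, ⟨a, ha, rfl⟩, hav⟩
    by_cases hvu : v = u
    · exact .inl hvu
    · exact .inr ⟨⟨v, hvu⟩, ⟨fun h => hv ⟨_, h, rfl⟩, a, ha, hav⟩, rfl⟩
  have h1 := (Set.ncard_le_ncard hN).trans (Set.ncard_insert_le _ _)
  rw [Set.ncard_image_of_injective _ Subtype.val_injective] at h1
  have h2 : 0 ≤ surplus (I.G.induce {u}ᶜ) Z := by
    rcases Z.eq_empty_or_nonempty with rfl | hne
    · rw [surplus_empty]
    · have h3 := (reduced_iff I).1 h _ (hne.image _) hind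
      unfold surplus at h3 ⊢
      rw [Set.ncard_image_of_injective _ Subtype.val_injective] at h3
      omega
  have h2' : (0 : ℝ) ≤ surplus (I.G.induce {u}ᶜ) Z := by exact_mod_cast h2
  have h4 : (Fintype.card ↑({u}ᶜ : Set I.V) : ℝ) = Fintype.card I.V - 1 := by
    have h5 := Set.ncard_add_ncard_compl ({u} : Set I.V)
    rw [Set.ncard_singleton, Nat.card_eq_fintype_card, ← Nat.card_coe_set_eq,
      Nat.card_eq_fintype_card] at h5
    have : (1 + Fintype.card ↑({u}ᶜ : Set I.V) : ℝ) = Fintype.card I.V := by exact_mod_cast h5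
    linarith
  unfold take
  rw [measure_keep, measure, hv, hv', h4]
  push_cast
  linarith

/-- The optimum crown of the rest, joined with `u`, comes from a nonempty independent set of the
whole graph. Its surplus is at least 2, so paying |N(u)| and solving the rest costs at least |V|/2 +
1. -/
theorem measure_discard_le (I : Inst) (u : I.V) (h : I.Reduced) :
    (I.discard u).measure ≤ I.measure - 1 := by
  have hv := vcStar_of_reduced h
  have hu : I.G.IsIndepSet {u} := Set.pairwise_singleton u _
  obtain ⟨Y, hY, hYi, hle⟩ := @exists_vcStar_induce _ _ I.G {u} (Fintype.ofFinite _) hu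
  have h1 : (2 : ℝ) ≤ surplus I.G Y := by
    exact_mod_cast (reduced_iff I).1 h Y ⟨u, hY rfl⟩ hYi
  unfold discard
  rw [measure_keep, measure, hv]
  linarith

theorem hasVertexCover_branch (I : Inst) (u : I.V) :
    HasVertexCover I.G I.k ↔ HasVertexCover (I.take u).G (I.take u).k ∨
      HasVertexCover (I.discard u).G (I.discard u).k := by
  have hu : I.G.IsIndepSet {u} := Set.pairwise_singleton u _
  constructor
  · rintro ⟨S, -, hS, hk⟩
    by_cases h : u ∈ S
    · refine .inl ?_
      have := hasVertexCover_induce (S := {u}ᶜ) (D := {u}) hS hk (Set.singleton_subset_iff.2 h)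
        disjoint_compl_left
      rwa [Set.ncard_singleton] at this
    · refine .inr (hasVertexCover_induce hS hk (fun v hv => ?_) (disjoint_compl_union_nbhd _ _))
      exact (hS (mem_nbhd_singleton.1 hv)).resolve_left h
  · rintro (h | h)
    · refine hasVertexCover_of_induce (S := {u}ᶜ) (D := {u}) (fun a b _ ha => .inl (not_not.1 ha)) ?_
      rwa [Set.ncard_singleton]
    · exact hasVertexCover_of_induce (adj_meets_nbhd hu) h

theorem hasVertexCover_fold (I : Inst) {Z : Set I.V} (h : I.FoldRuleApplies Z)
    (hmin : ∀ A ⊆ Z, A.Nonempty → surplus I.G Z ≤ surplus I.G A) :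
    HasVertexCover (I.fold Z).G (I.fold Z).k ↔ HasVertexCover I.G I.k :=
  hasVertexCover_identify I.k h.1.2.1 h.1.2.2 hmin h.2

/-- After the first rule no nonempty independent set has surplus below 1, which supplies the
minimality required by the exchange argument. -/
theorem surplus_min_of_not_ntApplies {I : Inst} (h : ¬ I.NTApplies) {Z : Set I.V}
    (hZ : IsSurplusOne I.G Z) : ∀ A ⊆ Z, A.Nonempty → surplus I.G Z ≤ surplus I.G A := by
  intro A hA hne
  rw [show surplus I.G Z = 1 from hZ.2.2]
  exact (halfIsUniqueOptimum_iff _).1 (not_not.1 h) A hne (Set.Pairwise.mono hA hZ.2.1)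

theorem Reduces.hasVertexCover_iff {I J : Inst} (h : I.Reduces J) :
    HasVertexCover J.G J.k ↔ HasVertexCover I.G I.k := by
  cases h with
  | nemhauserTrotter x happ hopt hhalf huniq =>
    exact hasVertexCover_nemhauserTrotter I.k hopt hhalf
  | edgeInNeighbourhood Z h1 happ =>
    exact hasVertexCover_crown I.k happ.1.2.1 happ.1.2.2.le
      (surplus_min_of_not_ntApplies h1 happ.1) (.inr happ.2)
  | foldNeighbourhood Z h1 h2 happ =>
    exact hasVertexCover_fold I happ (surplus_min_of_not_ntApplies h1 happ.1)

theorem Reduces.card_lt {I J : Inst} (h : I.Reduces J) :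
    Fintype.card J.V < Fintype.card I.V := by
  cases h with
  | nemhauserTrotter x happ hopt hhalf huniq =>
    -- If `x` were all-1/2, the new instance would be a copy of the old one, and `huniq` would say
    -- that the rule was not applicable. The rest of this block carries surpluses along that copy.
    obtain ⟨v, hv⟩ : ∃ v, x v ≠ 1 / 2 := by
      by_contra hall
      push Not at hall
      refine happ ((halfIsUniqueOptimum_iff _).2 fun Z hne hZ => ?_)
      have hx : x = fun _ => 1 / 2 := funext hall
      have huniv : {v | x v = 1 / 2} = Set.univ := Set.eq_univ_of_forall hall
      have h1 := (halfIsUniqueOptimum_iff _).1 huniq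
        ((↑) ⁻¹' Z : Set {v | x v = 1 / 2})
        (by obtain ⟨z, hz⟩ := hne; exact ⟨⟨z, hall z⟩, hz⟩)
        (fun a ha b hb hne hab => hZ ha hb (fun h => hne (Subtype.ext h))
          (show I.G.Adj (Subtype.val a) (Subtype.val b) from hab))
      refine h1.trans (le_of_eq ?_)
      have h2 : ((↑) '' ((↑) ⁻¹' Z : Set {v | x v = 1 / 2}) : Set I.V) = Z := by
        rw [Subtype.image_preimage_coe, huniv, Set.univ_inter]
      have h3 : ((↑) '' nbhd (I.G.induce {v | x v = 1 / 2}) ((↑) ⁻¹' Z) : Set I.V)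
          = nbhd I.G Z := by
        ext v
        constructor
        · rintro ⟨a, ⟨ha, b, hb, hab⟩, rfl⟩
          exact ⟨ha, b, hb, hab⟩
        · rintro ⟨ha, b, hb, hab⟩
          exact ⟨⟨v, hall v⟩, ⟨ha, ⟨b, hall b⟩, hb, hab⟩, rfl⟩
      have h4 := Set.ncard_image_of_injective ((↑) ⁻¹' Z : Set {v | x v = 1 / 2})
        Subtype.val_injective
      have h5 := Set.ncard_image_of_injective
        (nbhd (I.G.induce {v | x v = 1 / 2}) ((↑) ⁻¹' Z)) Subtype.val_injective
      rw [h2] at h4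
      rw [h3] at h5
      unfold surplus
      rw [h4, h5]
      rfl
    exact card_keep_lt I _ (v := v) hv
  | edgeInNeighbourhood Z h1 happ =>
    obtain ⟨z, hz⟩ := happ.1.1
    exact card_keep_lt I _ (v := z) fun h => h (.inl hz)
  | foldNeighbourhood Z h1 h2 happ => exact card_fold_lt I happ.1

theorem Reduces.measure_le {I J : Inst} (h : I.Reduces J) : J.measure ≤ I.measure := by
  cases h with
  | nemhauserTrotter x happ hopt hhalf huniq =>
    refine measure_keep_le I fun u v huv hu => ?_
    have h0 : ∀ w, x w ≠ 1 / 2 → x w ≠ 1 → x w = 0 := fun w h h' =>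
      (hhalf w).resolve_right fun h'' => h''.elim h h'
    by_contra hc
    push Not at hc
    have hu0 := h0 u hu hc.1
    have huv' := hopt.1.2 u v huv
    rcases hhalf v with h | h | h
    · linarith
    · linarith
    · exact hc.2 h
  | edgeInNeighbourhood Z h1 happ => exact measure_keep_crown_le I happ.1.2.1
  | foldNeighbourhood Z h1 h2 happ => exact measure_fold_le I happ

/-- Only the first rule needs an argument: its side condition on the half-integral part is met by
the crown of a largest set with optimal crown. -/
theorem exists_reduces {I : Inst} (h : ¬ I.Reduced) : ∃ J, I.Reduces J := by
  by_cases h1 : I.NTApplies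
  · obtain ⟨Z, hZ, hopt, hY⟩ := exists_crown_halfIsUniqueOptimum I.G
    have hcase : ∀ v, crown I.G Z v = 0 ∧ v ∈ Z ∨
        crown I.G Z v = 1 / 2 ∧ v ∉ Z ∧ v ∉ nbhd I.G Z ∨
        crown I.G Z v = 1 := fun v => by
      by_cases h : v ∈ Z
      · exact .inl ⟨crown_of_mem h, h⟩
      by_cases h' : v ∈ nbhd I.G Z
      · exact .inr (.inr (crown_of_mem_nbhd h'))
      · exact .inr (.inl ⟨crown_of_notMem h h', h, h'⟩)
    have hS : {v | crown I.G Z v = 1 / 2} = (Z ∪ nbhd I.G Z)ᶜ := by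
      ext v
      constructor
      · intro (hv : crown I.G Z v = 1 / 2)
        rintro (h | h)
        · rw [crown_of_mem h] at hv; norm_num at hv
        · rw [crown_of_mem_nbhd h] at hv; norm_num at hv
      · intro hv
        exact crown_of_notMem (fun h => hv (.inl h)) fun h => hv (.inr h)
    refine ⟨_, .nemhauserTrotter (crown I.G Z) h1 hopt (fun v => ?_) ?_⟩
    · rcases hcase v with h | h | h
      exacts [.inl h.1, .inr (.inl h.1), .inr (.inr h)]
    · rw [hS]
      exact (halfIsUniqueOptimum_iff _).2 hY
  by_cases h2 : ∃ Z, I.EdgeRuleApplies Z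
  · obtain ⟨Z, hZ⟩ := h2
    exact ⟨_, .edgeInNeighbourhood Z h1 hZ⟩
  push Not at h2
  by_cases h3 : ∃ Z, I.FoldRuleApplies Z
  · obtain ⟨Z, hZ⟩ := h3
    exact ⟨_, .foldNeighbourhood Z h1 h2 hZ⟩
  push Not at h3
  exact absurd ⟨h1, h2, h3⟩ h

theorem card_take_lt (I : Inst) (u : I.V) : Fintype.card (I.take u).V < Fintype.card I.V :=
  card_keep_lt I _ (v := u) fun h => h rfl

theorem card_discard_lt (I : Inst) (u : I.V) :
    Fintype.card (I.discard u).V < Fintype.card I.V :=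
  card_keep_lt I _ (v := u) fun h => h (.inl rfl)

theorem exists_run (I : Inst) : ∃ (b : Bool) (t : ℕ), I.Run b t := by
  induction hn : Fintype.card I.V using Nat.strong_induction_on generalizing I with
  | _ n ih =>
    subst hn
    by_cases hμ : I.measure < 0
    · exact ⟨_, _, .reject I hμ⟩
    by_cases hr : I.Reduced
    · rcases isEmpty_or_nonempty I.V with hV | ⟨⟨u⟩⟩
      · exact ⟨_, _, .accept I (not_lt.1 hμ) hV⟩
      · obtain ⟨b₁, t₁, h₁⟩ := ih _ (card_take_lt I u) _ rfl
        obtain ⟨b₂, t₂, h₂⟩ := ih _ (card_discard_lt I u) _ rfl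
        exact ⟨_, _, .branch I u b₁ b₂ t₁ t₂ (not_lt.1 hμ) hr h₁ h₂⟩
    · obtain ⟨J, hJ⟩ := exists_reduces hr
      obtain ⟨b, t, h⟩ := ih _ hJ.card_lt _ rfl
      exact ⟨_, _, .reduce I J b t (not_lt.1 hμ) hJ h⟩

theorem not_hasVertexCover_of_measure_neg {I : Inst} (h : I.measure < 0) :
    ¬ HasVertexCover I.G I.k := fun hc => by
  have := vcStar_le_of_hasVertexCover hc
  unfold measure at h
  linarith

theorem hasVertexCover_of_isEmpty {I : Inst} (hV : IsEmpty I.V) (h : 0 ≤ I.k) :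
    HasVertexCover I.G I.k :=
  ⟨∅, Set.finite_empty, fun u => (hV.false u).elim, by simpa using h⟩

theorem k_nonneg_of_measure_nonneg {I : Inst} (hV : IsEmpty I.V) (h : 0 ≤ I.measure) :
    0 ≤ I.k := by
  obtain ⟨Z, -, -, hv⟩ := exists_vcStar_eq I.G
  have hZ : Z = ∅ := Set.eq_empty_of_isEmpty Z
  rw [hZ, surplus_empty] at hv
  simp only [Fintype.card_of_isEmpty] at hv
  unfold measure at h
  rw [hv] at h
  have : (0 : ℝ) ≤ I.k := by simpa using h
  exact_mod_cast this

end Inst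

/-! ### The size of the search tree -/

/-- A bound on the size of the search tree of an instance with `n` vertices and measure `μ`. -/
noncomputable def treeBound (n : ℕ) (μ : ℝ) : ℝ :=
  -- A run rejects a negative measure at once, but the machine notices it only on a reduced instance
  -- and may first apply up to `n` rules; hence `n + 1` rather than 1. The square leaves room for
  -- two such linear terms at each branching.
  if μ < 0 then n + 1 else (n + 1 : ℝ) ^ 2 * (2.6181 : ℝ) ^ μ

theorem one_le_base_rpow {μ : ℝ} (h : 0 ≤ μ) : 1 ≤ (2.6181 : ℝ) ^ μ :=
  Real.one_le_rpow (by norm_num) h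

theorem succ_le_treeBound (n : ℕ) (μ : ℝ) : (n + 1 : ℝ) ≤ treeBound n μ := by
  unfold treeBound
  have hn : (0 : ℝ) ≤ n := Nat.cast_nonneg n
  split_ifs with h
  · exact le_rfl
  · have := one_le_base_rpow (not_lt.1 h)
    nlinarith [sq_nonneg (n : ℝ)]

theorem treeBound_le (n : ℕ) (μ : ℝ) :
    treeBound n μ ≤ (n + 1 : ℝ) ^ 2 * (2.6181 : ℝ) ^ max μ 0 := by
  unfold treeBound
  have hn : (0 : ℝ) ≤ n := Nat.cast_nonneg n
  split_ifs with h
  · rw [max_eq_right h.le, Real.rpow_zero]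
    nlinarith
  · rw [max_eq_left (not_lt.1 h)]

theorem treeBound_reduce {m n : ℕ} {μ ν : ℝ} (hmn : m < n) (hμ : ν ≤ μ) :
    treeBound m ν + 1 ≤ treeBound n μ := by
  have hm : (m + 1 : ℝ) ≤ n := by exact_mod_cast hmn
  have hm0 : (0 : ℝ) ≤ m := Nat.cast_nonneg m
  by_cases hν : ν < 0
  · have h1 : treeBound m ν = m + 1 := if_pos hν
    linarith [succ_le_treeBound n μ]
  · have hμ0 : ¬ μ < 0 := by linarith [not_lt.1 hν]
    rw [treeBound, if_neg hν, treeBound, if_neg hμ0]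
    have h1 : (2.6181 : ℝ) ^ ν ≤ (2.6181 : ℝ) ^ μ :=
      Real.rpow_le_rpow_of_exponent_le (by norm_num) hμ
    have h2 := one_le_base_rpow (not_lt.1 hμ0)
    have h3 : ((m : ℝ) + 1) ^ 2 + 1 ≤ (n + 1 : ℝ) ^ 2 := by nlinarith
    nlinarith [sq_nonneg (m + 1 : ℝ)]

/-- The exact base is φ² = 2.61803..., where φ is the golden ratio. The slack up to 2.6181 permits a
rational lower bound on the square root: 1.61805² ≤ 2.6181 and 1/1.61805 + 1/2.6181 ≤ 1. -/
theorem base_rpow_branch (μ : ℝ) :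
    (2.6181 : ℝ) ^ (μ - 1 / 2) + (2.6181 : ℝ) ^ (μ - 1) ≤ (2.6181 : ℝ) ^ μ := by
  have hs : (1.61805 : ℝ) ≤ (2.6181 : ℝ) ^ (1 / 2 : ℝ) := by
    rw [← Real.sqrt_eq_rpow]
    exact Real.le_sqrt_of_sq_le (by norm_num)
  have hpos : (0 : ℝ) < (2.6181 : ℝ) ^ μ := Real.rpow_pos_of_pos (by norm_num) _
  rw [Real.rpow_sub (by norm_num), Real.rpow_sub (by norm_num), Real.rpow_one]
  have h1 : (2.6181 : ℝ) ^ μ / (2.6181 : ℝ) ^ (1 / 2 : ℝ) ≤ (2.6181 : ℝ) ^ μ / 1.61805 := by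
    gcongr
  have h2 : (2.6181 : ℝ) ^ μ / 1.61805 + (2.6181 : ℝ) ^ μ / 2.6181 ≤ (2.6181 : ℝ) ^ μ := by
    rw [div_add_div _ _ (by norm_num) (by norm_num), div_le_iff₀ (by norm_num)]
    nlinarith
  linarith

theorem treeBound_branch {m₁ m₂ n : ℕ} {μ μ₁ μ₂ : ℝ} (h0 : 0 ≤ μ) (h₁ : m₁ < n) (h₂ : m₂ < n)
    (hμ₁ : μ₁ ≤ μ - 1 / 2) (hμ₂ : μ₂ ≤ μ - 1) :
    treeBound m₁ μ₁ + treeBound m₂ μ₂ + 1 ≤ treeBound n μ := by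
  have e1 : (m₁ + 1 : ℝ) ≤ n := by exact_mod_cast h₁
  have e2 : (m₂ + 1 : ℝ) ≤ n := by exact_mod_cast h₂
  have p1 : (0 : ℝ) ≤ m₁ := Nat.cast_nonneg _
  have p2 : (0 : ℝ) ≤ m₂ := Nat.cast_nonneg _
  have hb := base_rpow_branch μ
  have hge := one_le_base_rpow h0
  have pos1 : (0 : ℝ) < (2.6181 : ℝ) ^ (μ - 1 / 2) := Real.rpow_pos_of_pos (by norm_num) _
  have pos2 : (0 : ℝ) < (2.6181 : ℝ) ^ (μ - 1) := Real.rpow_pos_of_pos (by norm_num) _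
  -- One bound for both signs of the child's measure. Two children and the node itself then give at
  -- most n² · 2.6181^μ + 2n + 1, and since 2.6181^μ ≥ 1 this is at most (n + 1)² · 2.6181^μ.
  have key : ∀ (m : ℕ) (ν d : ℝ), (m + 1 : ℝ) ≤ n → ν ≤ d →
      treeBound m ν ≤ (n : ℝ) ^ 2 * (2.6181 : ℝ) ^ d + n := fun m ν d hm hν => by
    have hm0 : (0 : ℝ) ≤ m := Nat.cast_nonneg _
    have hd : (0 : ℝ) < (2.6181 : ℝ) ^ d := Real.rpow_pos_of_pos (by norm_num) _
    unfold treeBound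
    split_ifs with h
    · nlinarith [mul_nonneg (sq_nonneg (n : ℝ)) hd.le]
    · have h1 : (2.6181 : ℝ) ^ ν ≤ (2.6181 : ℝ) ^ d :=
        Real.rpow_le_rpow_of_exponent_le (by norm_num) hν
      have h2 : (m + 1 : ℝ) ^ 2 ≤ (n : ℝ) ^ 2 := by gcongr
      have := mul_le_mul h2 h1 (Real.rpow_nonneg (by norm_num) _) (sq_nonneg _)
      linarith
  have k1 := key m₁ μ₁ _ e1 hμ₁
  have k2 := key m₂ μ₂ _ e2 hμ₂
  rw [show treeBound n μ = (n + 1 : ℝ) ^ 2 * (2.6181 : ℝ) ^ μ from if_neg (not_lt.2 h0)]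
  nlinarith [mul_le_mul_of_nonneg_left hb (sq_nonneg (n : ℝ))]

/-! ### Correctness and search tree size of arbitrary runs -/

namespace Inst

theorem Run.correct {I : Inst} {b : Bool} {t : ℕ} (h : I.Run b t) :
    b = true ↔ HasVertexCover I.G I.k := by
  induction h with
  | reject I hμ => simpa using not_hasVertexCover_of_measure_neg hμ
  | accept I hμ hV =>
    simpa using hasVertexCover_of_isEmpty hV (k_nonneg_of_measure_nonneg hV hμ)
  | reduce I J b t hμ hred hrun ih => rw [ih, hred.hasVertexCover_iff]
  | branch I u b₁ b₂ t₁ t₂ hμ hred h₁ h₂ ih₁ ih₂ =>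
    rw [Bool.or_eq_true, ih₁, ih₂, hasVertexCover_branch I u]

theorem Run.le_treeBound {I : Inst} {b : Bool} {t : ℕ} (h : I.Run b t) :
    (t : ℝ) ≤ treeBound (Fintype.card I.V) I.measure := by
  induction h with
  | reject I hμ =>
    have := succ_le_treeBound (Fintype.card I.V) I.measure
    have h0 : (0 : ℝ) ≤ Fintype.card I.V := Nat.cast_nonneg _
    push_cast
    linarith
  | accept I hμ hV =>
    have := succ_le_treeBound (Fintype.card I.V) I.measure
    have h0 : (0 : ℝ) ≤ Fintype.card I.V := Nat.cast_nonneg _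
    push_cast
    linarith
  | reduce I J b t hμ hred hrun ih =>
    have := treeBound_reduce hred.card_lt hred.measure_le
    push_cast
    linarith
  | branch I u b₁ b₂ t₁ t₂ hμ hred h₁ h₂ ih₁ ih₂ =>
    have := treeBound_branch hμ (card_take_lt I u) (card_discard_lt I u)
      (measure_take_le I u hred) (measure_discard_le I u hred)
    push_cast
    linarith

end Inst


namespace RAM

/-! ### Total correctness with running times -/

/-- A bound on the running time of a program in which every loop is repeated at most `M` times. -/
def Prog.time (M : ℕ) : Prog → ℕ
  | .assign _ i e => i.cost + e.cost + 1
  | .seq p q => p.time M + q.time M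
  -- Adding the branches instead of taking a maximum is wasteful but keeps the bound easy to
  -- estimate.
  | .ite e p q => e.cost + 1 + (p.time M + q.time M)
  | .loop e p => M * (e.cost + 1 + p.time M) + (e.cost + 1)

/-- For a fixed program the bound is a polynomial in `M`: each loop raises the exponent by one, and
exponents of two parts are added so that a single power dominates both. -/
theorem Prog.time_le (p : Prog) : ∃ C c : ℕ, ∀ M, p.time M ≤ C * (M + 1) ^ c := by
  induction p with
  | assign a i e => exact ⟨i.cost + e.cost + 1, 0, fun M => by simp [Prog.time]⟩
  | seq p q hp hq =>
    obtain ⟨C, c, h⟩ := hp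
    obtain ⟨D, d, h'⟩ := hq
    refine ⟨C + D, c + d, fun M => ?_⟩
    have h1 : (M + 1) ^ c ≤ (M + 1) ^ (c + d) := Nat.pow_le_pow_right (by omega) (by omega)
    have h2 : (M + 1) ^ d ≤ (M + 1) ^ (c + d) := Nat.pow_le_pow_right (by omega) (by omega)
    rw [Prog.time, add_mul]
    exact add_le_add ((h M).trans (Nat.mul_le_mul_left _ h1))
      ((h' M).trans (Nat.mul_le_mul_left _ h2))
  | ite e p q hp hq =>
    obtain ⟨C, c, h⟩ := hp
    obtain ⟨D, d, h'⟩ := hq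
    refine ⟨e.cost + 1 + (C + D), c + d, fun M => ?_⟩
    have h0 : 1 ≤ (M + 1) ^ (c + d) := Nat.one_le_pow _ _ (by omega)
    have h1 : (M + 1) ^ c ≤ (M + 1) ^ (c + d) := Nat.pow_le_pow_right (by omega) (by omega)
    have h2 : (M + 1) ^ d ≤ (M + 1) ^ (c + d) := Nat.pow_le_pow_right (by omega) (by omega)
    rw [Prog.time, add_mul, add_mul C D]
    exact add_le_add (Nat.le_mul_of_pos_right _ h0)
      (add_le_add ((h M).trans (Nat.mul_le_mul_left _ h1))
        ((h' M).trans (Nat.mul_le_mul_left _ h2)))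
  | loop e p hp =>
    obtain ⟨C, c, h⟩ := hp
    refine ⟨e.cost + 1 + C, c + 1, fun M => ?_⟩
    have h0 : 1 ≤ (M + 1) ^ c := Nat.one_le_pow _ _ (by omega)
    have h1 : (e.cost + 1) ≤ (e.cost + 1) * (M + 1) ^ c := Nat.le_mul_of_pos_right _ h0
    calc M * (e.cost + 1 + p.time M) + (e.cost + 1)
        ≤ M * ((e.cost + 1) * (M + 1) ^ c + C * (M + 1) ^ c) +
          ((e.cost + 1) * (M + 1) ^ c + C * (M + 1) ^ c) :=
          add_le_add (Nat.mul_le_mul_left _ (add_le_add h1 (h M)))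
            (h1.trans (Nat.le_add_right _ _))
      _ = _ := by ring

/-- Started in `σ`, the program halts in a state satisfying `Q`, within the time that it takes
if every loop is repeated at most `M` times. -/
def Tri (M : ℕ) (p : Prog) (σ : State) (Q : State → Prop) : Prop :=
  ∃ t σ', Exec p σ t σ' ∧ t ≤ p.time M ∧ Q σ'

variable {M : ℕ}

theorem Tri.mono {p : Prog} {σ : State} {Q Q' : State → Prop} (h : Tri M p σ Q)
    (hQ : ∀ σ', Q σ' → Q' σ') : Tri M p σ Q' := by
  obtain ⟨t, σ', h1, h2, h3⟩ := h
  exact ⟨t, σ', h1, h2, hQ _ h3⟩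

theorem Tri.assign {a : ℕ} {i e : Expr} {σ : State} {Q : State → Prop}
    (h : Q (σ.write a (i.eval σ) (e.eval σ))) : Tri M (.assign a i e) σ Q :=
  ⟨_, _, .assign a i e σ, le_rfl, h⟩

theorem Tri.seq {p q : Prog} {σ : State} {R Q : State → Prop} (h₁ : Tri M p σ R)
    (h₂ : ∀ σ', R σ' → Tri M q σ' Q) : Tri M (.seq p q) σ Q := by
  obtain ⟨t₁, σ₁, e₁, l₁, r₁⟩ := h₁
  obtain ⟨t₂, σ₂, e₂, l₂, r₂⟩ := h₂ _ r₁
  exact ⟨_, _, .seq _ _ _ _ _ _ _ e₁ e₂, add_le_add l₁ l₂, r₂⟩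

theorem Tri.ite {e : Expr} {p q : Prog} {σ : State} {Q : State → Prop}
    (h₁ : e.eval σ ≠ 0 → Tri M p σ Q) (h₂ : e.eval σ = 0 → Tri M q σ Q) :
    Tri M (.ite e p q) σ Q := by
  by_cases he : e.eval σ = 0
  · obtain ⟨t, σ', h, hl, hQ⟩ := h₂ he
    exact ⟨_, _, .iteFalse _ _ _ _ _ _ he h, by rw [Prog.time]; omega, hQ⟩
  · obtain ⟨t, σ', h, hl, hQ⟩ := h₁ he
    exact ⟨_, _, .iteTrue _ _ _ _ _ _ he h, by rw [Prog.time]; omega, hQ⟩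

/-- Loops with an invariant and a variant. -/
theorem Tri.loop {e : Expr} {p : Prog} {Inv : State → Prop} {m : State → ℕ}
    (hstep : ∀ σ, Inv σ → e.eval σ ≠ 0 → Tri M p σ fun σ' => Inv σ' ∧ m σ' < m σ)
    {σ : State} (hI : Inv σ) (hm : m σ ≤ M) :
    Tri M (.loop e p) σ fun σ' => Inv σ' ∧ e.eval σ' = 0 := by
  have key : ∀ (N : ℕ) (σ : State), Inv σ → m σ ≤ N → ∃ t σ', Exec (.loop e p) σ t σ' ∧
      t ≤ N * (e.cost + 1 + p.time M) + (e.cost + 1) ∧ Inv σ' ∧ e.eval σ' = 0 := by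
    intro N
    induction N with
    | zero =>
      intro σ hI hm
      by_cases he : e.eval σ = 0
      · exact ⟨_, _, .loopFalse _ _ _ he, by omega, hI, he⟩
      · obtain ⟨_, _, _, _, _, h⟩ := hstep σ hI he
        omega
    | succ N ih =>
      intro σ hI hm
      by_cases he : e.eval σ = 0
      · exact ⟨_, _, .loopFalse _ _ _ he, by omega, hI, he⟩
      · obtain ⟨t₁, σ₁, e₁, l₁, h₁, h₁'⟩ := hstep σ hI he
        obtain ⟨t₂, σ₂, e₂, l₂, h₂⟩ := ih σ₁ h₁ (by omega)
        exact ⟨_, _, .loopTrue _ _ _ _ _ _ _ he e₁ e₂, by rw [Nat.succ_mul]; omega, h₂⟩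
  exact key M σ hI hm

/-! ### Derived expressions -/

/-- The truth value of a proposition as a number. -/
noncomputable def b2n (p : Prop) : ℕ := by
  classical exact if p then 1 else 0

theorem b2n_true {p : Prop} (h : p) : b2n p = 1 := if_pos h
theorem b2n_false {p : Prop} (h : ¬ p) : b2n p = 0 := if_neg h

theorem b2n_congr {p q : Prop} (h : p ↔ q) : b2n p = b2n q := by rw [propext h]

@[simp] theorem b2n_ne_zero {p : Prop} : b2n p ≠ 0 ↔ p := by
  by_cases h : p <;> simp [b2n, h]

@[simp] theorem b2n_eq_zero {p : Prop} : b2n p = 0 ↔ ¬ p := by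
  by_cases h : p <;> simp [b2n, h]

-- This and the next two identities let `simp` read the truncated arithmetic behind `Expr.and`,
-- `Expr.not` and `Expr.le` back as logic.
@[simp] theorem b2n_and (p q : Prop) : b2n p + b2n q - 1 = b2n (p ∧ q) := by
  by_cases hp : p <;> by_cases hq : q <;> simp [b2n, hp, hq]

@[simp] theorem one_sub_b2n (p : Prop) : 1 - b2n p = b2n (¬ p) := by
  by_cases hp : p <;> simp [b2n, hp]

@[simp] theorem one_sub_sub_eq_b2n (a b : ℕ) : 1 - (a - b) = b2n (a ≤ b) := by
  by_cases h : a ≤ b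
  · rw [b2n_true h]; omega
  · rw [b2n_false h]; omega

namespace Expr

/-- The value of cell `0` of an array. -/
abbrev var (a : ℕ) : Expr := .read a (.const 0)

/-- Negation of a truth value. -/
abbrev not (a : Expr) : Expr := .sub (.const 1) a

/-- Conjunction of truth values. -/
abbrev and (a b : Expr) : Expr := .sub (.add a b) (.const 1)

/-- Disjunction of truth values. -/
abbrev or (a b : Expr) : Expr := not (and (not a) (not b))

/-- Comparison of two numbers. -/
abbrev le (a b : Expr) : Expr := not (.sub a b)

/-- Equality of two numbers. -/
abbrev eq (a b : Expr) : Expr := and (le a b) (le b a)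

end Expr

/-! ### Frame conditions and loop schemes for counting, filling and summing -/

/-- Assign to cell `0` of an array. -/
abbrev Prog.set (a : ℕ) (e : Expr) : Prog := .assign a (.const 0) e

/-- Repeat a program with cell `0` of array `i` running through all numbers below the value of
cell `0` of array `b`. -/
def Prog.count (i b : ℕ) (p : Prog) : Prog :=
  .seq (.set i (.const 0)) (.loop (.sub (.var b) (.var i))
    (.seq p (.set i (.add (.var i) (.const 1)))))

@[simp] theorem State.write_self (σ : State) (a i x : ℕ) : σ.write a i x a i = x := by
  simp [State.write]

theorem State.write_other (σ : State) {a a' : ℕ} (i x : ℕ) (h : a' ≠ a) :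
    σ.write a i x a' = σ a' := by
  funext j; simp [State.write, h]

theorem State.write_cell (σ : State) (a i x j : ℕ) :
    σ.write a i x a j = if j = i then x else σ a j := by
  simp [State.write]

/-- The states agree outside the arrays in the list. -/
def Same (S : List ℕ) (σ σ' : State) : Prop := ∀ a, a ∉ S → σ' a = σ a

theorem Same.refl (S : List ℕ) (σ : State) : Same S σ σ := fun _ _ => rfl

theorem Same.trans {S : List ℕ} {σ σ' σ'' : State} (h : Same S σ σ') (h' : Same S σ' σ'') :
    Same S σ σ'' := fun a ha => (h' a ha).trans (h a ha)

theorem Same.mono {S S' : List ℕ} {σ σ' : State} (h : Same S σ σ') (hS : S ⊆ S') :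
    Same S' σ σ' := fun a ha => h a fun h => ha (hS h)

theorem Same.write {S : List ℕ} {σ σ' : State} (h : Same S σ σ') {a : ℕ} (ha : a ∈ S) (i x : ℕ) :
    Same S σ (σ'.write a i x) := fun b hb => by
  rw [State.write_other (a := a) (a' := b) σ' i x fun hba => hb (hba ▸ ha), h b hb]

/-- The loop itself advances the counter, so the invariant must survive any write to the counter's
cell, and the body must leave that cell as it found it. -/
theorem Tri.count {i b : ℕ} {p : Prog} {m : ℕ} {Inv : ℕ → State → Prop} {σ : State}
    (hm : m ≤ M) (hb : ∀ j σ, Inv j σ → σ b 0 = m)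
    (hi : ∀ j σ x, Inv j σ → Inv j (σ.write i 0 x))
    (h0 : Inv 0 σ)
    (hstep : ∀ j < m, ∀ σ, Inv j σ → σ i 0 = j →
      Tri M p σ fun σ' => Inv (j + 1) σ' ∧ σ' i 0 = j) :
    Tri M (.count i b p) σ (Inv m) := by
  refine Tri.seq (Tri.assign (Q := fun σ' => σ' i 0 = 0 ∧ Inv 0 σ') ?_) fun σ' h =>
    (Tri.loop (Inv := fun σ => σ i 0 ≤ m ∧ Inv (σ i 0) σ) (m := fun σ => m - σ i 0)
      ?_ ?_ ?_).mono ?_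
  · simp only [Expr.eval, State.write_self, true_and]
    exact hi _ _ _ h0
  · rintro σ ⟨hle, hI⟩ he
    have hbm := hb _ _ hI
    have hlt : σ i 0 < m := by
      simp only [Expr.eval, hbm] at he
      omega
    refine Tri.seq (hstep _ hlt σ hI rfl) fun σ' h => Tri.assign ?_
    simp only [Expr.eval, State.write_self, h.2]
    exact ⟨⟨hlt, hi _ _ _ h.1⟩, by omega⟩
  · rw [h.1]; exact ⟨Nat.zero_le _, h.2⟩
  · exact (Nat.sub_le _ _).trans hm
  · rintro σ' ⟨⟨hle, hI⟩, he⟩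
    have hbm := hb _ _ hI
    simp only [Expr.eval, hbm] at he
    have : σ' i 0 = m := by omega
    rwa [this] at hI

/-- Fill consecutive cells of the array `d`. -/
def Prog.fill (d i b : ℕ) (off e : Expr) : Prog :=
  .count i b (.assign d (.add off (.var i)) e)

/-- The value `e` may depend on cells of `d` that have not been overwritten yet; this permits
updating an array in place. -/
theorem Tri.fill {d i b m : ℕ} (o : ℕ) {off e : Expr} {σ : State} (v : ℕ → ℕ) (hm : m ≤ M)
    (hbm : σ b 0 = m) (hd : d ≠ i ∧ b ≠ i ∧ b ≠ d)
    (ho : ∀ τ, Same [d, i] σ τ → off.eval τ = o)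
    (he : ∀ j < m, ∀ τ, Same [d, i] σ τ → τ i 0 = j →
      (∀ x, x < o ∨ o + j ≤ x → τ d x = σ d x) → e.eval τ = v j) :
    Tri M (.fill d i b off e) σ fun σ' =>
      Same [d, i] σ σ' ∧ (∀ j < m, σ' d (o + j) = v j) ∧
        ∀ x, x < o ∨ o + m ≤ x → σ' d x = σ d x := by
  obtain ⟨hdi, hbi, hbd⟩ := hd
  refine Tri.count (m := m)
    (Inv := fun j σ' => Same [d, i] σ σ' ∧ (∀ j' < j, σ' d (o + j') = v j') ∧
        ∀ x, x < o ∨ o + j ≤ x → σ' d x = σ d x) hm ?_ ?_ ?_ ?_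
  · rintro j τ ⟨h, -⟩
    rw [h b (by simp [hbi, hbd]), hbm]
  · rintro j τ x ⟨h1, h2, h3⟩
    rw [State.write_other _ _ _ hdi]
    exact ⟨h1.write (by simp) _ _, h2, h3⟩
  · exact ⟨Same.refl _ _, by simp, fun _ _ => rfl⟩
  · rintro j hj τ ⟨h1, h2, h3⟩ hij
    refine Tri.assign ?_
    simp only [Expr.eval, ho τ h1, he j hj τ h1 hij h3, hij]
    refine ⟨⟨h1.write (by simp) _ _, fun j' hj' => ?_, fun x hx => ?_⟩, ?_⟩
    · rw [State.write_cell]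
      split_ifs with h
      · rw [show j' = j by omega]
      · exact h2 j' (by omega)
    · rw [State.write_cell, if_neg (by omega)]
      exact h3 x (by omega)
    · rw [State.write_other _ _ _ hdi.symm, hij]

/-- Compute a sum into cell `0` of the array `d`. -/
def Prog.sum (d i b : ℕ) (e : Expr) : Prog :=
  .seq (.set d (.const 0)) (.count i b (.set d (.add (.var d) e)))

theorem Tri.sum {d i b m : ℕ} {e : Expr} {σ : State} (v : ℕ → ℕ) (hm : m ≤ M) (hbm : σ b 0 = m)
    (hd : d ≠ i ∧ b ≠ i ∧ b ≠ d)
    (he : ∀ j < m, ∀ τ, Same [d, i] σ τ → τ i 0 = j → e.eval τ = v j) :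
    Tri M (.sum d i b e) σ fun σ' =>
      Same [d, i] σ σ' ∧ σ' d 0 = ∑ j ∈ Finset.range m, v j := by
  obtain ⟨hdi, hbi, hbd⟩ := hd
  refine Tri.seq (Tri.assign (Q := fun σ' => Same [d, i] σ σ' ∧ σ' d 0 = 0) ?_) fun τ hτ =>
    Tri.count (m := m) (Inv := fun j σ' => Same [d, i] σ σ' ∧
      σ' d 0 = ∑ j' ∈ Finset.range j, v j') hm ?_ ?_ ?_ ?_
  · exact ⟨(Same.refl _ _).write (by simp) _ _, by simp [Expr.eval]⟩
  · rintro j τ ⟨h, -⟩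
    rw [h b (by simp [hbi, hbd]), hbm]
  · rintro j τ x ⟨h1, h2⟩
    rw [State.write_other _ _ _ hdi]
    exact ⟨h1.write (by simp) _ _, h2⟩
  · exact ⟨hτ.1, by simp [hτ.2]⟩
  · rintro j hj τ ⟨h1, h2⟩ hij
    refine Tri.assign ?_
    simp only [Expr.eval, he j hj τ h1 hij]
    refine ⟨⟨h1.write (by simp) _ _, ?_⟩, ?_⟩
    · rw [State.write_self, Finset.sum_range_succ, h2]
    · rw [State.write_other _ _ _ hdi.symm, hij]

/-- Fill the array `d`, after computing for each cell a sum into cell `0` of the array `c`. -/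
def Prog.fillSum (d i c s b : ℕ) (e g : Expr) : Prog :=
  .count i b (.seq (.sum c s b e) (.assign d (.var i) g))

/-- In contrast to `Tri.fill`, the expressions must have the required values whatever `d` contains,
so `d` cannot be updated from its old contents. -/
theorem Tri.fillSum {d i c s b m : ℕ} {e g : Expr} {σ : State} (w : ℕ → ℕ → ℕ) (v : ℕ → ℕ)
    (hm : m ≤ M) (hbm : σ b 0 = m)
    (hd : (d ≠ i ∧ b ≠ i ∧ b ≠ d) ∧ (c ≠ s ∧ b ≠ s ∧ b ≠ c) ∧ i ≠ c ∧ i ≠ s ∧ d ≠ c ∧ d ≠ s)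
    (he : ∀ x < m, ∀ j < m, ∀ τ, Same [d, i, c, s] σ τ → τ i 0 = x → τ s 0 = j →
      e.eval τ = w x j)
    (hg : ∀ x < m, ∀ τ, Same [d, i, c, s] σ τ → τ i 0 = x →
      τ c 0 = ∑ j ∈ Finset.range m, w x j → g.eval τ = v x) :
    Tri M (.fillSum d i c s b e g) σ fun σ' =>
      Same [d, i, c, s] σ σ' ∧ ∀ x < m, σ' d x = v x := by
  obtain ⟨⟨hdi, hbi, hbd⟩, hcs, hic, his, hdc, hds⟩ := hd
  refine Tri.count (m := m) (Inv := fun x σ' => Same [d, i, c, s] σ σ' ∧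
      ∀ x' < x, σ' d x' = v x') hm ?_ ?_ ?_ ?_
  · rintro j τ ⟨h, -⟩
    rw [h b (by simp [hbi, hbd, hcs.2]), hbm]
  · rintro j τ x ⟨h1, h2⟩
    rw [State.write_other _ _ _ hdi]
    exact ⟨h1.write (by simp) _ _, h2⟩
  · exact ⟨Same.refl _ _, by simp⟩
  · rintro x hx τ ⟨h1, h2⟩ hix
    have hbτ : τ b 0 = m := by rw [h1 b (by simp [hbi, hbd, hcs.2]), hbm]
    have hmono : ∀ τ', Same [c, s] τ τ' → Same [d, i, c, s] σ τ' := fun τ' h =>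
      h1.trans (h.mono (by simp))
    refine Tri.seq (Tri.sum (w x) hm hbτ hcs fun j hj τ' hτ' hsj =>
      he x hx j hj τ' (hmono τ' hτ') (by rw [hτ' i (by simp [hic, his]), hix]) hsj)
      fun τ' hτ' => Tri.assign ?_
    have hix' : τ' i 0 = x := by rw [hτ'.1 i (by simp [hic, his]), hix]
    simp only [Expr.eval, hix', hg x hx τ' (hmono τ' hτ'.1) hix' hτ'.2]
    refine ⟨⟨(hmono τ' hτ'.1).write (by simp) _ _, fun x' hx' => ?_⟩, ?_⟩
    · rw [State.write_cell]
      split_ifs with h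
      · rw [h]
      · rw [hτ'.1 d (by simp [hdc, hds]), h2 x' (by omega)]
    · rw [State.write_other _ _ _ hdi.symm, hix']

end RAM


/-! ### An auction finding an independent set of minimum surplus through a vertex -/

section AuctionGraph

variable {V : Type}

/-- `p` are the final prices of an auction in which the vertices `l` outside the closed
neighbourhood `N[v]` bid for their neighbours outside `N[v]`, and `own r l` means that `l` owns `r`.
If no price equals `J`, then `v` and the isolated vertices among those of price at most `J` form an
independent set of minimum surplus among the ones containing `v`. -/
theorem auction_surplus_min [Finite V] {G : SimpleGraph V} {v : V} {p : V → ℕ}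
    {own : V → V → Prop} {N J : ℕ} {H : Set V} (hH : ∀ x, x ∈ H ↔ x ≠ v ∧ ¬ G.Adj v x)
    (hown : ∀ r l, own r l → r ∈ H ∧ l ∈ H ∧ G.Adj l r)
    (hfun : ∀ r l l', own r l → own r l' → l = l')
    (hinj : ∀ r r' l, own r l → own r' l → r = r')
    (hprice : ∀ r ∈ H, p r ≠ 0 → ∃ l, own r l)
    (hnear : ∀ r l, own r l → ∀ r' ∈ H, G.Adj l r' → p r ≤ p r' + 1)
    (hdone : ∀ l ∈ H, (∀ r, ¬ own r l) → ∀ r ∈ H, G.Adj l r → N < p r)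
    (hJN : J ≤ N) (hJ : ∀ r ∈ H, p r ≠ J) {Z : Set V}
    (hZ : ∀ x, x ∈ Z ↔ x = v ∨ (x ∈ H ∧ p x ≤ J ∧ ∀ r ∈ H, p r ≤ J → ¬ G.Adj x r)) :
    G.IsIndepSet Z ∧ ∀ Y, v ∈ Y → G.IsIndepSet Y → surplus G Z ≤ surplus G Y := by
  classical
  set D : Set V := {l | l ∈ H ∧ ∀ r, ¬ own r l} with hD
  set R : Set V := {r | r ∈ H ∧ J < p r} with hR
  set X : Set V := {l | l ∈ H ∧ ∀ r ∈ H, p r ≤ J → ¬ G.Adj l r} with hX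
  have hvH : v ∉ H := fun h => ((hH v).1 h).1 rfl
  have hnbH : ∀ x, x ∉ H → x ≠ v → x ∈ nbhd G {v} := fun x h h' => by
    rw [mem_nbhd_singleton]
    by_contra hc
    exact h ((hH x).2 ⟨h', hc⟩)
  have hadj : ∀ u ∈ insert v X, ∀ w, G.Adj u w → w ∈ nbhd G {v} ∪ R := by
    rintro u (rfl | hu) w huw
    · exact .inl (mem_nbhd_singleton.2 huw)
    · by_cases hw : w ∈ H
      · exact .inr ⟨hw, not_le.1 fun h => hu.2 w hw h huw⟩
      · refine .inl (hnbH w hw ?_)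
        rintro rfl
        exact ((hH u).1 hu.1).2 huw.symm
  have hZeq : Z = insert v X \ (nbhd G {v} ∪ R) := by
    ext x
    rw [hZ x]
    constructor
    · rintro (rfl | ⟨h1, h2, h3⟩)
      · exact ⟨.inl rfl, fun h => h.elim (fun h => h.1 rfl) fun h => hvH h.1⟩
      · refine ⟨.inr ⟨h1, h3⟩, fun h => h.elim (fun h => ?_) fun h => absurd h.2 (not_lt.2 h2)⟩
        exact ((hH x).1 h1).2 (mem_nbhd_singleton.1 h)
    · rintro ⟨rfl | h1, h2⟩
      · exact .inl rfl
      · exact .inr ⟨h1.1, not_lt.1 fun h => h2 (.inr ⟨h1.1, h⟩), h1.2⟩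
  have hle : surplus G Z ≤ (nbhd G {v}).ncard - 1 - D.ncard := by
    have h1 := surplus_sdiff_le hadj
    rw [← hZeq, Set.ncard_insert_of_notMem fun h => hvH h.1] at h1
    have h2 := Set.ncard_union_le (nbhd G {v}) R
    have hRo : ∀ r ∈ R, ∃ l, own r l := fun r hr => hprice r hr.1 (by have := hr.2; omega)
    choose! g hg using hRo
    -- An unserved bidder sees only prices above `N`. The owner of an object dearer than `J` paid at
    -- most one more than its cheapest option, so all its options cost at least `J`, hence more than
    -- `J`, as `J` is not a price. Both kinds of bidders therefore lie in `X`.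
    have h3 : D.ncard + (g '' R).ncard ≤ X.ncard := by
      rw [← Set.ncard_union_eq]
      · refine Set.ncard_le_ncard ?_
        rintro _ (hl | ⟨r, hr, rfl⟩)
        · exact ⟨hl.1, fun r hr hrJ hlr => by have := hdone _ hl.1 hl.2 r hr hlr; omega⟩
        · refine ⟨(hown _ _ (hg r hr)).2.1, fun r' hr' hrJ hlr => ?_⟩
          have h4 := hnear _ _ (hg r hr) r' hr' hlr
          have h5 := hJ r' hr'
          have h6 := hr.2
          have h7 := hJ r hr.1
          omega
      · refine Set.disjoint_left.2 ?_
        rintro _ hl ⟨r, hr, rfl⟩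
        exact hl.2 r (hg r hr)
    rw [Set.InjOn.ncard_image] at h3
    · omega
    · intro r hr r' hr' h
      exact hinj r r' _ (hg r hr) (h ▸ hg r' hr')
  refine ⟨hZeq ▸ indep_sdiff hadj, fun Y hvY hY => hle.trans ?_⟩
  have hYH : ∀ x ∈ Y, x ≠ v → x ∈ H := fun x hx hne =>
    (hH x).2 ⟨hne, fun h => hY hvY hx hne.symm h⟩
  have hYo : ∀ l ∈ (Y \ {v}) \ D, ∃ r, own r l := fun l hl => by
    by_contra hc
    push Not at hc
    exact hl.2 ⟨hYH l hl.1.1 hl.1.2, hc⟩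
  choose! g hg using hYo
  -- The matching lower bound: served members of `Y` own distinct objects, which are neighbours of
  -- `Y` outside N(v).
  have h1 : (nbhd G {v}).ncard + (g '' ((Y \ {v}) \ D)).ncard ≤ (nbhd G Y).ncard := by
    rw [← Set.ncard_union_eq]
    · refine Set.ncard_le_ncard ?_
      rintro _ (hl | ⟨l, hl, rfl⟩)
      · exact mem_nbhd_of_adj hY hvY (mem_nbhd_singleton.1 hl)
      · exact mem_nbhd_of_adj hY hl.1.1 (hown _ _ (hg l hl)).2.2
    · refine Set.disjoint_left.2 ?_
      rintro _ hl ⟨l, hl', rfl⟩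
      exact ((hH _).1 (hown _ _ (hg l hl')).1).2 (mem_nbhd_singleton.1 hl)
  have hgi : Set.InjOn g ((Y \ {v}) \ D) := fun l hl l' hl' (h : g l = g l') =>
    hfun _ l l' (hg l hl) (h ▸ hg l' hl')
  rw [hgi.ncard_image] at h1
  have h2 := Set.ncard_sdiff_singleton_add_one hvY
  have h3 := Set.ncard_le_ncard_sdiff_add_ncard (Y \ {v}) D
  unfold surplus
  omega

end AuctionGraph

/-! ### The auction as a process: invariant, termination and a free price -/

/-- The state of an auction among the numbers below `l₀` satisfying `H`: `O r = l + 1` means that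
`l` owns `r`, `P r` is the price of `r`, and `cur = c + 1` means that `c` is about to bid. -/
structure Auction (n : ℕ) (H : ℕ → Prop) (E : ℕ → ℕ → Prop) (l₀ : ℕ) (O P : ℕ → ℕ)
    (cur : ℕ) : Prop where
  own : ∀ r < n, ∀ l, O r = l + 1 → H r ∧ H l ∧ E l r ∧ l < l₀
  inj : ∀ r < n, ∀ r' < n, O r ≠ 0 → O r = O r' → r = r'
  price : ∀ r < n, P r ≠ 0 → O r ≠ 0
  near : ∀ r < n, ∀ l, O r = l + 1 → ∀ r' < n, H r' → E l r' → P r ≤ P r' + 1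
  done : ∀ l < l₀, H l → l + 1 ≠ cur →
    (∃ r < n, O r = l + 1) ∨ ∀ r < n, H r → E l r → n + 2 ≤ P r
  bidder : ∀ c, cur = c + 1 → c < l₀ ∧ H c ∧ ∀ r < n, O r ≠ c + 1

namespace Auction

variable {n l₀ c : ℕ} {H : ℕ → Prop} {E : ℕ → ℕ → Prop} {O P O' P' : ℕ → ℕ}

theorem init (hO : ∀ r < n, O r = 0) (hP : ∀ r < n, P r = 0) : Auction n H E 0 O P 0 where
  own r hr l h := by rw [hO r hr] at h; omega
  inj r hr _ _ h := absurd (hO r hr) h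
  price r hr h := absurd (hP r hr) h
  near r hr l h := by rw [hO r hr] at h; omega
  done l hl := absurd hl (Nat.not_lt_zero l)
  bidder c h := by omega

theorem insert (h : Auction n H E l₀ O P 0) (hH : H l₀) :
    Auction n H E (l₀ + 1) O P (l₀ + 1) where
  own r hr l hl := by
    obtain ⟨h1, h2, h3, h4⟩ := h.own r hr l hl
    exact ⟨h1, h2, h3, by omega⟩
  inj := h.inj
  price := h.price
  near := h.near
  done l hl hHl hne := h.done l (by omega) hHl (by omega)
  bidder c hc := by
    obtain rfl : c = l₀ := by omega
    exact ⟨by omega, hH, fun r hr he => by have := (h.own r hr c he).2.2.2; omega⟩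

theorem skip (h : Auction n H E l₀ O P 0) (hH : ¬ H l₀) : Auction n H E (l₀ + 1) O P 0 where
  own r hr l hl := by
    obtain ⟨h1, h2, h3, h4⟩ := h.own r hr l hl
    exact ⟨h1, h2, h3, by omega⟩
  inj := h.inj
  price := h.price
  near := h.near
  done l hl hHl hne := by
    rcases Nat.lt_succ_iff_lt_or_eq.1 hl with hlt | rfl
    · exact h.done l hlt hHl hne
    · exact absurd hHl hH
  bidder c hc := by omega

theorem drop (h : Auction n H E l₀ O P (c + 1))
    (hc : ∀ r < n, H r → E c r → n + 2 ≤ P r) : Auction n H E l₀ O P 0 where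
  own := h.own
  inj := h.inj
  price := h.price
  near := h.near
  done l hl hHl hne := by
    by_cases hlc : l = c
    · subst hlc; exact .inr hc
    · exact h.done l hl hHl (by omega)
  bidder c hc := by omega

/-- The displaced owner bids next; owners and bidders share the encoding shifted by one, so `O r₀ =
0` correctly says that nobody has to bid. Approximate cheapness survives because the object bought
was a cheapest one and prices only rise. -/
theorem bid (h : Auction n H E l₀ O P (c + 1)) {r₀ : ℕ} (hr₀ : r₀ < n) (hHr : H r₀)
    (hE : E c r₀) (hmin : ∀ r < n, H r → E c r → P r₀ ≤ P r)
    (hO : ∀ r, O' r = if r = r₀ then c + 1 else O r)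
    (hP : ∀ r, P' r = if r = r₀ then P r₀ + 1 else P r) :
    Auction n H E l₀ O' P' (O r₀) := by
  obtain ⟨hc1, hc2, hc3⟩ := h.bidder c rfl
  have hPle : ∀ r, P r ≤ P' r := fun r => by
    rw [hP]; split_ifs with hr
    · rw [hr]; omega
    · exact le_rfl
  refine ⟨fun r hr l hl => ?_, fun r hr r' hr' hne heq => ?_, fun r hr hp => ?_,
    fun r hr l hl r' hr' hH' hE' => ?_, fun l hl hHl hne => ?_, fun c' hc' => ?_⟩
  · rw [hO] at hl
    split_ifs at hl with hrr
    · obtain rfl : c = l := by omega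
      subst hrr
      exact ⟨hHr, hc2, hE, hc1⟩
    · exact h.own r hr l hl
  · rw [hO, hO] at heq
    rw [hO] at hne
    split_ifs at heq hne with h1 h2 h2
    · rw [h1, h2]
    · exact absurd heq.symm (hc3 r' hr')
    · exact absurd heq (hc3 r hr)
    · exact h.inj r hr r' hr' hne heq
  · rw [hO]
    rw [hP] at hp
    split_ifs at hp ⊢ with h1
    · omega
    · exact h.price r hr hp
  · have hle := hPle r'
    rw [hO] at hl
    rw [hP r]
    split_ifs at hl ⊢ with h1
    · obtain rfl : c = l := by omega
      have := hmin r' hr' hH' hE'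
      omega
    · have := h.near r hr l hl r' hr' hH' hE'
      omega
  · by_cases hlc : l = c
    · exact .inl ⟨r₀, hr₀, by rw [hO, if_pos rfl, hlc]⟩
    · rcases h.done l hl hHl (by omega) with ⟨r, hr, he⟩ | hall
      · refine .inl ⟨r, hr, ?_⟩
        rw [hO, if_neg, he]
        rintro rfl
        exact hne he.symm
      · exact .inr fun r hr hHr hEr => (hall r hr hHr hEr).trans (hPle r)
  · obtain ⟨-, h2, -, h4⟩ := h.own r₀ hr₀ c' hc'
    refine ⟨h4, h2, fun r hr he => ?_⟩
    rw [hO] at he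
    split_ifs at he with h1
    · obtain rfl : c = c' := by omega
      exact hc3 r₀ hr₀ hc'
    · exact h1 (h.inj r₀ hr₀ r hr (by omega) (by omega)).symm

end Auction

/-- The number of bids that can still be made, plus one if someone is about to bid. -/
def bidsLeft (n : ℕ) (P : ℕ → ℕ) (cur : ℕ) : ℕ :=
  (∑ r ∈ Finset.range n, (n + 2 - P r)) + if cur = 0 then 0 else 1

/-- The bound equals (n + 1)², so taking (n + 2)² as bound for loop repetitions covers the bidding
loop as well as the loops over the adjacency matrix. -/
theorem bidsLeft_le (n : ℕ) (P : ℕ → ℕ) (cur : ℕ) : bidsLeft n P cur ≤ n * (n + 2) + 1 := by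
  unfold bidsLeft
  have : ∑ r ∈ Finset.range n, (n + 2 - P r) ≤ ∑ r ∈ Finset.range n, (n + 2) :=
    Finset.sum_le_sum fun r _ => Nat.sub_le _ _
  rw [Finset.sum_const, Finset.card_range, smul_eq_mul] at this
  split_ifs <;> omega

theorem bidsLeft_bid_lt {n r₀ c : ℕ} {P P' : ℕ → ℕ} (cur' : ℕ) (hr₀ : r₀ < n) (hlt : P r₀ < n + 2)
    (hP : ∀ r, P' r = if r = r₀ then P r₀ + 1 else P r) :
    bidsLeft n P' cur' < bidsLeft n P (c + 1) := by
  unfold bidsLeft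
  have : ∑ r ∈ Finset.range n, (n + 2 - P' r) < ∑ r ∈ Finset.range n, (n + 2 - P r) := by
    refine Finset.sum_lt_sum (fun r _ => ?_) ⟨r₀, Finset.mem_range.2 hr₀, ?_⟩
    · rw [hP]; split_ifs with h
      · subst h; omega
      · exact le_rfl
    · rw [hP, if_pos rfl]; omega
  rw [if_neg (Nat.succ_ne_zero c)]
  split_ifs <;> omega

/-- Among `n + 1` prices, one is not taken by any of `n` objects. -/
theorem exists_price_gap (n : ℕ) (P : ℕ → ℕ) : ∃ j < n + 1, ∀ r < n, P r ≠ j + 1 := by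
  by_contra hc
  push Not at hc
  have h1 : Finset.range (n + 1) ⊆ (Finset.range n).image fun r => P r - 1 := by
    intro j hj
    obtain ⟨r, hr, h⟩ := hc j (Finset.mem_range.1 hj)
    exact Finset.mem_image.2 ⟨r, Finset.mem_range.2 hr, by omega⟩
  have h2 := (Finset.card_le_card h1).trans Finset.card_image_le
  simp at h2


namespace RAM

/-! ### The memory layout -/

notation "aN" => (0 : ℕ)
notation "aK" => (1 : ℕ)
notation "aAdj" => (2 : ℕ)
notation "aRow" => (3 : ℕ)
notation "aSq" => (4 : ℕ)
notation "aAlive" => (5 : ℕ)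
notation "aUsed" => (6 : ℕ)
notation "aStack" => (7 : ℕ)
notation "aTop" => (8 : ℕ)
notation "aActive" => (9 : ℕ)
notation "aAnswer" => (10 : ℕ)
notation "aV" => (11 : ℕ)
notation "aH" => (12 : ℕ)
notation "aPrice" => (13 : ℕ)
notation "aOwner" => (14 : ℕ)
notation "aL" => (15 : ℕ)
notation "aCur" => (16 : ℕ)
notation "aBid" => (17 : ℕ)
notation "aArg" => (18 : ℕ)
notation "aR" => (19 : ℕ)
notation "aTmp" => (20 : ℕ)
notation "aI" => (21 : ℕ)
notation "aGap" => (22 : ℕ)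
notation "aJ" => (23 : ℕ)
notation "aCount" => (24 : ℕ)
notation "aBound" => (25 : ℕ)
notation "aLow" => (26 : ℕ)
notation "aCandZ" => (27 : ℕ)
notation "aCandN" => (28 : ℕ)
notation "aKey" => (29 : ℕ)
notation "aBest" => (30 : ℕ)
notation "aZ" => (31 : ℕ)
notation "aNbhd" => (32 : ℕ)
notation "aTouch" => (33 : ℕ)
notation "aNew" => (34 : ℕ)

/-- The working memory holds the alive vertices `A`, the adjacency matrix `E` and the used part `u`
of the budget `k₀`. -/
structure Mem (n k₀ : ℕ) (A : Set ℕ) (E : ℕ → ℕ → Prop) (u : ℕ) (σ : State) : Prop where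
  size : σ aN 0 = n
  budget : σ aK 0 = k₀
  row : ∀ i < n, σ aRow i = i * n
  sq : σ aSq 0 = n * n
  adj : ∀ i < n, ∀ j < n, σ aAdj (i * n + j) = b2n (E i j)
  alive : ∀ i < n, σ aAlive i = b2n (i ∈ A)
  used : σ aUsed 0 = u

/-- Arrays up to number 10 hold the input data, the current instance, the stack and the answer;
everything above is scratch space. A program that writes only there preserves the memory invariants.
-/
theorem Same.low {S : List ℕ} {σ σ' : State} (h : Same S σ σ') (hS : ∀ a ∈ S, 10 < a) :
    ∀ a ≤ 10, σ' a = σ a := fun a ha => h a fun h' => absurd (hS a h') (by omega)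

theorem Mem.congr {n k₀ u : ℕ} {A : Set ℕ} {E : ℕ → ℕ → Prop} {σ σ' : State}
    (h : Mem n k₀ A E u σ) (hs : ∀ a ≤ 10, σ' a = σ a) : Mem n k₀ A E u σ' := by
  obtain ⟨h1, h2, h3, h4, h5, h6, h7⟩ := h
  constructor
  · rwa [hs _ (by norm_num)]
  · rwa [hs _ (by norm_num)]
  · rwa [hs _ (by norm_num)]
  · rwa [hs _ (by norm_num)]
  · rwa [hs _ (by norm_num)]
  · rwa [hs _ (by norm_num)]
  · rwa [hs _ (by norm_num)]

/-- The entry of the adjacency matrix in row `x` and column `y`. -/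
abbrev adjE (x y : Expr) : Expr := .read aAdj (.add (.read aRow x) y)

theorem Mem.adj_row {n k₀ u : ℕ} {A : Set ℕ} {E : ℕ → ℕ → Prop} {σ : State}
    (h : Mem n k₀ A E u σ) {i j : ℕ} (hi : i < n) (hj : j < n) :
    σ aAdj (σ aRow i + j) = b2n (E i j) := by
  rw [h.row i hi, h.adj i hi j hj]

/-! ### The auction -/

/-- The participants of the auction for `v`: the alive vertices outside `N[v]`. -/
def Part (A : Set ℕ) (E : ℕ → ℕ → Prop) (v i : ℕ) : Prop := i ∈ A ∧ i ≠ v ∧ ¬ E v i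

/-- Set up the auction for `v`. -/
def prepare : Prog :=
  .seq (.fill aH aI aN (.const 0) (.and (.read aAlive (.var aI))
    (.and (.not (.eq (.var aI) (.var aV))) (.not (adjE (.var aV) (.var aI))))))
  (.seq (.fill aPrice aI aN (.const 0) (.const 0)) (.fill aOwner aI aN (.const 0) (.const 0)))

variable {M n k₀ u : ℕ} {A : Set ℕ} {E : ℕ → ℕ → Prop} {σ : State}

theorem prepare_spec (hM : n ≤ M) (h : Mem n k₀ A E u σ) {v : ℕ} (hv : σ aV 0 = v) (hvn : v < n) :
    Tri M prepare σ fun σ' => Same [aH, aPrice, aOwner, aI] σ σ' ∧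
      (∀ i < n, σ' aH i = b2n (Part A E v i)) ∧ (∀ i < n, σ' aPrice i = 0) ∧
      ∀ i < n, σ' aOwner i = 0 := by
  refine Tri.seq (Tri.fill 0 (fun i => b2n (Part A E v i)) hM h.size (by decide)
    (fun _ _ => rfl) ?_) fun σ₁ h₁ => ?_
  · intro i hi τ hτ hI _
    have hm := h.congr (hτ.low (by decide))
    have hv' : τ aV 0 = v := by rw [hτ aV (by decide), hv]
    simp only [Expr.eval, hI, hv', hm.alive i hi, hm.adj_row hvn hi, one_sub_b2n,
      one_sub_sub_eq_b2n, b2n_and]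
    exact b2n_congr (by unfold Part; rw [← le_antisymm_iff])
  have m₁ := h.congr (h₁.1.low (by decide))
  refine Tri.seq (Tri.fill 0 (fun _ => 0) hM m₁.size (by decide)
    (fun _ _ => rfl) fun _ _ _ _ _ _ => rfl) fun σ₂ h₂ => ?_
  have m₂ := m₁.congr (h₂.1.low (by decide))
  refine (Tri.fill 0 (fun _ => 0) hM m₂.size (by decide)
    (fun _ _ => rfl) fun _ _ _ _ _ _ => rfl).mono fun σ₃ h₃ => ⟨?_, ?_, ?_, ?_⟩
  · exact ((h₁.1.mono (by decide)).trans (h₂.1.mono (by decide))).trans (h₃.1.mono (by decide))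
  · intro i hi
    rw [h₃.1 aH (by decide), h₂.1 aH (by decide)]
    simpa using h₁.2.1 i hi
  · intro i hi
    rw [h₃.1 aPrice (by decide)]
    simpa using h₂.2.1 i hi
  · intro i hi
    simpa using h₃.2.1 i hi

/-- Find a cheapest participant adjacent to the bidder. -/
def cheapest : Prog :=
  .seq (.set aBid (.add (.var aN) (.const 2))) (.seq (.set aArg (.const 0))
  (.count aR aN (.ite (.and (.and (.read aH (.var aR))
      (adjE (.sub (.var aCur) (.const 1)) (.var aR)))
      (.not (.le (.var aBid) (.read aPrice (.var aR)))))
    (.seq (.set aBid (.read aPrice (.var aR))) (.set aArg (.var aR)))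
    -- The language has no empty statement; assigning a cell to itself replaces it.
    (.set aBid (.var aBid)))))

/-- The initial bid `n + 2` is also the price limit: if it survives the scan, every object open to
the bidder costs at least that much and the bidder drops out. The cell `aArg` is meaningful only if
the bid fell below the limit. -/
theorem cheapest_spec (hM : n ≤ M) (h : Mem n k₀ A E u σ) {c : ℕ} (hc : σ aCur 0 = c + 1)
    (hcn : c < n) {H : ℕ → Prop} (hH : ∀ i < n, σ aH i = b2n (H i)) :
    Tri M cheapest σ fun σ' => Same [aBid, aArg, aR] σ σ' ∧
      (∀ r < n, H r → E c r → σ' aBid 0 ≤ σ aPrice r) ∧ σ' aBid 0 ≤ n + 2 ∧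
      (σ' aBid 0 < n + 2 → ∃ r₀ < n, σ' aArg 0 = r₀ ∧ H r₀ ∧ E c r₀ ∧ σ aPrice r₀ = σ' aBid 0) := by
  refine Tri.seq (Tri.assign (Q := fun τ => Same [aBid, aArg, aR] σ τ ∧ τ aBid 0 = n + 2) ?_)
    fun σ₁ h₁ => Tri.seq (Tri.assign
      (Q := fun τ => Same [aBid, aArg, aR] σ τ ∧ τ aBid 0 = n + 2) ?_) fun σ₂ h₂ => ?_
  · refine ⟨(Same.refl _ _).write (by decide) _ _, ?_⟩
    simp [Expr.eval, h.size]
  · exact ⟨h₁.1.write (by decide) _ _, h₁.2⟩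
  refine (Tri.count (m := n) (Inv := fun j τ => Same [aBid, aArg, aR] σ τ ∧
      (∀ r < n, r < j → H r → E c r → τ aBid 0 ≤ σ aPrice r) ∧ τ aBid 0 ≤ n + 2 ∧
      (τ aBid 0 < n + 2 → ∃ r₀ < n, τ aArg 0 = r₀ ∧ H r₀ ∧ E c r₀ ∧ σ aPrice r₀ = τ aBid 0))
      hM ?_ ?_ ?_ ?_).mono fun σ' h' => ⟨h'.1, fun r hr => h'.2.1 r hr hr, h'.2.2⟩
  · rintro j τ ⟨hτ, -⟩
    rw [hτ aN (by decide), h.size]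
  · rintro j τ x ⟨h1, h2⟩
    rw [State.write_other _ _ _ (show aBid ≠ aR by decide),
      State.write_other _ _ _ (show aArg ≠ aR by decide)]
    exact ⟨h1.write (by decide) _ _, h2⟩
  · refine ⟨h₂.1, by simp, h₂.2.le, fun h => ?_⟩
    rw [h₂.2] at h; omega
  · rintro j hj τ ⟨h1, h2, h3, h4⟩ hjR
    have hm := h.congr (h1.low (by decide))
    have e1 : τ aH j = b2n (H j) := by rw [h1 aH (by decide), hH j hj]
    have e2 : τ aCur 0 - 1 = c := by rw [h1 aCur (by decide), hc]; rfl
    have e3 : τ aPrice = σ aPrice := h1 aPrice (by decide)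
    refine Tri.ite (fun he => ?_) fun he => ?_
    · simp only [Expr.eval, hjR, e1, e2, e3, hm.adj_row hcn hj, one_sub_b2n,
        one_sub_sub_eq_b2n, b2n_and, b2n_ne_zero] at he
      obtain ⟨⟨he1, he2⟩, he3⟩ := he
      refine Tri.seq (Tri.assign (Q := fun τ' => τ' = τ.write aBid 0 (σ aPrice j)) ?_)
        fun τ' hτ' => Tri.assign ?_
      · simp [Expr.eval, hjR, e3]
      · subst hτ'
        simp only [Expr.eval, State.write_other _ _ _ (show aBid ≠ aArg by decide),
          State.write_other _ _ _ (show aR ≠ aBid by decide),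
          State.write_other _ _ _ (show aR ≠ aArg by decide), State.write_self, hjR]
        refine ⟨⟨(h1.write (by decide) _ _).write (by decide) _ _, fun r hr hrj hHr hEr => ?_, ?_,
          fun _ => ⟨j, hj, rfl, he1, he2, rfl⟩⟩, trivial⟩
        · rcases Nat.lt_succ_iff_lt_or_eq.1 hrj with h | rfl
          · have := h2 r hr h hHr hEr
            omega
          · exact le_rfl
        · omega
    · simp only [Expr.eval, hjR, e1, e2, e3, hm.adj_row hcn hj, one_sub_b2n,
        one_sub_sub_eq_b2n, b2n_and, b2n_eq_zero] at he
      refine Tri.assign ?_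
      simp only [Expr.eval, State.write_other _ _ _ (show aArg ≠ aBid by decide),
        State.write_other _ _ _ (show aR ≠ aBid by decide), State.write_self, hjR]
      refine ⟨⟨h1.write (by decide) _ _, fun r hr hrj hHr hEr => ?_, h3, h4⟩, trivial⟩
      rcases Nat.lt_succ_iff_lt_or_eq.1 hrj with h | rfl
      · exact h2 r hr h hHr hEr
      · by_contra hc
        exact he ⟨⟨hHr, hEr⟩, hc⟩

/-- Let the current bidder make a bid. -/
def bid : Prog :=
  .seq cheapest (.ite (.not (.le (.add (.var aN) (.const 2)) (.var aBid)))
    -- The displaced owner is saved before being overwritten.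
    (.seq (.set aTmp (.read aOwner (.var aArg))) (.seq (.assign aOwner (.var aArg) (.var aCur))
      (.seq (.assign aPrice (.var aArg) (.add (.var aBid) (.const 1)))
        (.set aCur (.var aTmp)))))
    (.set aCur (.const 0)))

theorem bid_spec (hM : n ≤ M) (h : Mem n k₀ A E u σ) (hcur : σ aCur 0 ≠ 0) {l₀ : ℕ} (hl₀ : l₀ ≤ n)
    {H : ℕ → Prop} (hH : ∀ i < n, σ aH i = b2n (H i))
    (ha : Auction n H E l₀ (σ aOwner) (σ aPrice) (σ aCur 0)) :
    Tri M bid σ fun σ' => Same [aBid, aArg, aR, aTmp, aOwner, aPrice, aCur] σ σ' ∧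
      Auction n H E l₀ (σ' aOwner) (σ' aPrice) (σ' aCur 0) ∧
      bidsLeft n (σ' aPrice) (σ' aCur 0) < bidsLeft n (σ aPrice) (σ aCur 0) := by
  obtain ⟨c, hc⟩ := Nat.exists_eq_succ_of_ne_zero hcur
  rw [Nat.succ_eq_add_one] at hc
  rw [hc] at ha ⊢
  have hcn : c < n := ((ha.bidder c rfl).1).trans_le hl₀
  refine Tri.seq (cheapest_spec hM h hc hcn hH) fun σ₁ ⟨h1, h2, h3, h4⟩ => ?_
  have m₁ := h.congr (h1.low (by decide))
  have hO : σ₁ aOwner = σ aOwner := h1 aOwner (by decide)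
  have hP : σ₁ aPrice = σ aPrice := h1 aPrice (by decide)
  refine Tri.ite (fun he => ?_) fun he => ?_
  · simp only [Expr.eval, m₁.size, one_sub_sub_eq_b2n, one_sub_b2n, b2n_ne_zero, not_le] at he
    obtain ⟨r₀, hr₀, e1, e2, e3, e4⟩ := h4 he
    refine Tri.seq (Tri.assign (Q := (· = _)) rfl) fun τ hτ =>
      Tri.seq (Tri.assign (Q := (· = _)) rfl) fun τ' hτ' =>
      Tri.seq (Tri.assign (Q := (· = _)) rfl) fun τ'' hτ'' => Tri.assign ?_
    subst hτ'' hτ' hτ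
    simp only [Expr.eval, State.write_self,
      State.write_other _ _ _ (show aArg ≠ aTmp by decide),
      State.write_other _ _ _ (show aCur ≠ aTmp by decide),
      State.write_other _ _ _ (show aArg ≠ aOwner by decide),
      State.write_other _ _ _ (show aBid ≠ aOwner by decide),
      State.write_other _ _ _ (show aBid ≠ aTmp by decide),
      State.write_other _ _ _ (show aTmp ≠ aOwner by decide),
      State.write_other _ _ _ (show aTmp ≠ aPrice by decide),
      State.write_other _ _ _ (show aOwner ≠ aPrice by decide),
      State.write_other _ _ _ (show aOwner ≠ aCur by decide),
      State.write_other _ _ _ (show aPrice ≠ aCur by decide), hO, e1]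
    have hP' : ∀ r, ((((σ₁.write aTmp 0 (σ aOwner r₀)).write aOwner r₀ (σ₁ aCur 0)).write
        aPrice r₀ (σ₁ aBid 0 + 1)) aPrice r) = if r = r₀ then σ aPrice r₀ + 1 else σ aPrice r := by
      intro r
      rw [State.write_cell, e4, State.write_other _ _ _ (show aPrice ≠ aOwner by decide),
        State.write_other _ _ _ (show aPrice ≠ aTmp by decide), hP]
    refine ⟨?_, ha.bid hr₀ e2 e3 (fun r hr hHr hEr => ?_) (fun r => ?_) hP', ?_⟩
    · exact ((((h1.mono (by decide)).write (by decide) _ _).write (by decide) _ _).write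
        (by decide) _ _).write (by decide) _ _
    · rw [e4]; exact h2 r hr hHr hEr
    · rw [State.write_cell, State.write_other _ _ _ (show aOwner ≠ aTmp by decide), hO,
        h1 aCur (by decide), hc]
    · exact bidsLeft_bid_lt _ hr₀ (by omega) hP'
  · simp only [Expr.eval, m₁.size, one_sub_sub_eq_b2n, one_sub_b2n, b2n_eq_zero, not_not] at he
    refine Tri.assign ?_
    simp only [Expr.eval, State.write_self,
      State.write_other _ _ _ (show aOwner ≠ aCur by decide),
      State.write_other _ _ _ (show aPrice ≠ aCur by decide), hO, hP]
    refine ⟨(h1.mono (by decide)).write (by decide) _ _,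
      ha.drop fun r hr hHr hEr => he.trans (h2 r hr hHr hEr), ?_⟩
    simp [bidsLeft]

/-- Let all participants enter the auction one by one. -/
def auction : Prog :=
  .seq (.set aCur (.const 0)) (.count aL aN (.ite (.read aH (.var aL))
    (.seq (.set aCur (.add (.var aL) (.const 1))) (.loop (.var aCur) bid))
    (.set aCur (.const 0))))

/-- Between two entrants nobody is about to bid, so the outer invariant has current bidder 0;
`bidsLeft` bounds the chain of displacements started by each entrant. -/
theorem auction_spec (hM : (n + 2) ^ 2 ≤ M) (h : Mem n k₀ A E u σ)
    {H : ℕ → Prop} (hH : ∀ i < n, σ aH i = b2n (H i)) (hO : ∀ i < n, σ aOwner i = 0)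
    (hP : ∀ i < n, σ aPrice i = 0) :
    Tri M auction σ fun σ' => Same [aBid, aArg, aR, aTmp, aOwner, aPrice, aCur, aL] σ σ' ∧
      Auction n H E n (σ' aOwner) (σ' aPrice) 0 := by
  have hM' : n ≤ M := by nlinarith
  refine Tri.seq (Tri.assign (Q := fun τ =>
    Same [aBid, aArg, aR, aTmp, aOwner, aPrice, aCur, aL] σ τ ∧
      Auction n H E 0 (τ aOwner) (τ aPrice) 0 ∧ τ aCur 0 = 0) ?_) fun σ₁ h₁ =>
    (Tri.count (m := n) (Inv := fun j τ =>
      Same [aBid, aArg, aR, aTmp, aOwner, aPrice, aCur, aL] σ τ ∧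
      Auction n H E j (τ aOwner) (τ aPrice) 0 ∧ τ aCur 0 = 0) hM' ?_ ?_ h₁ ?_).mono
      fun σ' h' => ⟨h'.1, h'.2.1⟩
  · exact ⟨(Same.refl _ _).write (by decide) _ _, Auction.init hO hP, by simp [Expr.eval]⟩
  · rintro j τ ⟨hτ, -⟩
    rw [hτ aN (by decide), h.size]
  · rintro j τ x ⟨h1, h2⟩
    rw [State.write_other _ _ _ (show aOwner ≠ aL by decide),
      State.write_other _ _ _ (show aPrice ≠ aL by decide),
      State.write_other _ _ _ (show aCur ≠ aL by decide)]
    exact ⟨h1.write (by decide) _ _, h2⟩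
  · rintro j hj τ ⟨h1, h2, h3⟩ hjL
    have hm := h.congr (h1.low (by decide))
    have e1 : τ aH j = b2n (H j) := by rw [h1 aH (by decide), hH j hj]
    refine Tri.ite (fun he => ?_) fun he => ?_
    · simp only [Expr.eval, hjL, e1, b2n_ne_zero] at he
      refine Tri.seq (Tri.assign (Q := fun τ' => Same [aCur] τ τ' ∧ τ' aCur 0 = j + 1)
        ⟨(Same.refl _ _).write (by decide) _ _, by simp [Expr.eval, hjL]⟩) fun τ' ⟨h5, h6⟩ => ?_
      refine (Tri.loop (Inv := fun τ'' =>
        Same [aBid, aArg, aR, aTmp, aOwner, aPrice, aCur] τ τ'' ∧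
        Auction n H E (j + 1) (τ'' aOwner) (τ'' aPrice) (τ'' aCur 0))
        (m := fun τ'' => bidsLeft n (τ'' aPrice) (τ'' aCur 0)) ?_ ?_ ?_).mono ?_
      · rintro τ'' ⟨h7, h8⟩ hcur
        have hs := h1.trans (h7.mono (by decide))
        refine (bid_spec hM' (h.congr (hs.low (by decide))) hcur hj
          (fun i hi => ?_) h8).mono fun σ' h' => ⟨⟨h7.trans h'.1, h'.2.1⟩, h'.2.2⟩
        rw [hs aH (by decide), hH i hi]
      · refine ⟨h5.mono (by decide), ?_⟩
        rw [h5 aOwner (by decide), h5 aPrice (by decide), h6]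
        exact h2.insert he
      · refine (bidsLeft_le _ _ _).trans (le_trans ?_ hM)
        nlinarith
      · rintro σ' ⟨⟨h7, h8⟩, h9⟩
        simp only [Expr.eval] at h9
        rw [h9] at h8
        exact ⟨⟨h1.trans (h7.mono (by decide)), h8, h9⟩, by rw [h7 aL (by decide), hjL]⟩
    · simp only [Expr.eval, hjL, e1, b2n_eq_zero] at he
      refine Tri.assign ?_
      rw [State.write_other _ _ _ (show aOwner ≠ aCur by decide),
        State.write_other _ _ _ (show aPrice ≠ aCur by decide),
        State.write_other _ _ _ (show aL ≠ aCur by decide)]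
      exact ⟨⟨h1.write (by decide) _ _, h2.skip he, by simp [Expr.eval]⟩, hjL⟩

/-- Find a price that is not taken. -/
def gap : Prog :=
  .seq (.set aBound (.add (.var aN) (.const 1))) (.count aJ aBound
    (.seq (.sum aCount aI aN (.eq (.read aPrice (.var aI)) (.add (.var aJ) (.const 1))))
      (.ite (.var aCount) (.set aGap (.var aGap)) (.set aGap (.add (.var aJ) (.const 1))))))

theorem gap_spec (hM : n + 1 ≤ M) (h : Mem n k₀ A E u σ) :
    Tri M gap σ fun σ' => Same [aBound, aJ, aCount, aI, aGap] σ σ' ∧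
      σ' aGap 0 ≤ n + 1 ∧ ∀ r < n, σ aPrice r ≠ σ' aGap 0 := by
  refine Tri.seq (Tri.assign (Q := fun τ => Same [aBound, aJ, aCount, aI, aGap] σ τ ∧
    τ aBound 0 = n + 1) ⟨(Same.refl _ _).write (by decide) _ _, by simp [Expr.eval, h.size]⟩)
    -- The invariant is conditional because `aGap` holds an arbitrary value until a free price has
    -- been met; `exists_price_gap` discharges the condition at the end.
    fun σ₁ h₁ => (Tri.count (m := n + 1) (Inv := fun j τ =>
      Same [aBound, aJ, aCount, aI, aGap] σ τ ∧ τ aBound 0 = n + 1 ∧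
      ((∃ j' < j, ∀ r < n, σ aPrice r ≠ j' + 1) →
        τ aGap 0 ≤ n + 1 ∧ ∀ r < n, σ aPrice r ≠ τ aGap 0)) hM ?_ ?_ ?_ ?_).mono
      fun σ' h' => ⟨h'.1, h'.2.2 (exists_price_gap n _)⟩
  · rintro j τ ⟨-, hτ, -⟩
    exact hτ
  · rintro j τ x ⟨h1, h2⟩
    rw [State.write_other _ _ _ (show aBound ≠ aJ by decide),
      State.write_other _ _ _ (show aGap ≠ aJ by decide)]
    exact ⟨h1.write (by decide) _ _, h2⟩
  · exact ⟨h₁.1, h₁.2, by simp⟩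
  · rintro j hj τ ⟨h1, h2, h3⟩ hjJ
    have hm := h.congr (h1.low (by decide))
    refine Tri.seq (Tri.sum (fun i => b2n (σ aPrice i = j + 1)) (by omega) hm.size (by decide)
      fun i hi τ' hτ' hI => ?_) fun τ' ⟨h4, h5⟩ => ?_
    · have e1 : τ' aPrice = σ aPrice := by rw [hτ' aPrice (by decide), h1 aPrice (by decide)]
      have e2 : τ' aJ 0 = j := by rw [hτ' aJ (by decide), hjJ]
      simp only [Expr.eval, hI, e1, e2, one_sub_sub_eq_b2n, b2n_and]
      exact b2n_congr le_antisymm_iff.symm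
    · have e1 : τ' aJ 0 = j := by rw [h4 aJ (by decide), hjJ]
      have e2 : τ' aBound 0 = n + 1 := by rw [h4 aBound (by decide), h2]
      have e3 : τ' aGap = τ aGap := h4 aGap (by decide)
      have hs : Same [aBound, aJ, aCount, aI, aGap] σ τ' := h1.trans (h4.mono (by decide))
      have e4 : τ' aCount 0 = 0 ↔ ∀ r < n, σ aPrice r ≠ j + 1 := by
        rw [h5, Finset.sum_eq_zero_iff]
        simp
      refine Tri.ite (fun he => Tri.assign ?_) fun he => Tri.assign ?_
      · simp only [Expr.eval] at he
        simp only [Expr.eval, State.write_self,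
          State.write_other _ _ _ (show aBound ≠ aGap by decide),
          State.write_other _ _ _ (show aJ ≠ aGap by decide), e1, e2, e3]
        refine ⟨⟨hs.write (by decide) _ _, trivial, ?_⟩, trivial⟩
        rintro ⟨j', hj', hg⟩
        refine h3 ⟨j', ?_, hg⟩
        rcases Nat.lt_succ_iff_lt_or_eq.1 hj' with h | rfl
        · exact h
        · exact absurd (e4.2 hg) he
      · simp only [Expr.eval] at he
        simp only [Expr.eval, State.write_self,
          State.write_other _ _ _ (show aBound ≠ aGap by decide),
          State.write_other _ _ _ (show aJ ≠ aGap by decide), e1, e2]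
        exact ⟨⟨hs.write (by decide) _ _, trivial, fun _ => ⟨by omega, e4.1 he⟩⟩, trivial⟩

end RAM


namespace RAM

/-! ### Independent sets of minimum surplus -/

/-- The graph with vertices `A` and adjacency relation `E` is a copy of the instance `I`. -/
structure Models (n : ℕ) (I : Inst) (f : I.V → ℕ) (A : Set ℕ) (E : ℕ → ℕ → Prop) : Prop where
  inj : Function.Injective f
  lt : ∀ x, f x < n
  mem : ∀ i, i ∈ A ↔ ∃ x, f x = i
  adj : ∀ x y, E (f x) (f y) ↔ I.G.Adj x y

/-- The array `a` holds the indicator function of the set `S`. -/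
def Enc (n : ℕ) {V : Type} (f : V → ℕ) (a : ℕ) (S : Set V) (σ : State) : Prop :=
  ∀ i < n, σ a i = b2n (i ∈ f '' S)

theorem sum_b2n (n : ℕ) (p : ℕ → Prop) :
    ∑ i ∈ Finset.range n, b2n (p i) = {i | i < n ∧ p i}.ncard := by
  classical
  have : ∀ i, b2n (p i) = if p i then 1 else 0 := fun i => by
    by_cases h : p i
    · rw [b2n_true h, if_pos h]
    · rw [b2n_false h, if_neg h]
  simp only [this]
  rw [← Finset.card_filter, ← Set.ncard_coe_finset]
  congr 1
  ext i
  simp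

theorem sum_b2n_image {n : ℕ} {V : Type} {f : V → ℕ} (hf : Function.Injective f)
    (hlt : ∀ x, f x < n) (S : Set V) :
    ∑ i ∈ Finset.range n, b2n (i ∈ f '' S) = S.ncard := by
  rw [sum_b2n, ← Set.ncard_image_of_injective S hf]
  congr 1
  ext i
  refine ⟨fun h => h.2, fun h => ⟨?_, h⟩⟩
  obtain ⟨x, -, rfl⟩ := h
  exact hlt x

theorem sum_b2n_eq_zero (n : ℕ) (p : ℕ → Prop) :
    ∑ i ∈ Finset.range n, b2n (p i) ≤ 0 ↔ ∀ i < n, ¬ p i := by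
  rw [Nat.le_zero, Finset.sum_eq_zero_iff]
  simp

variable {M n k₀ u : ℕ} {A : Set ℕ} {E : ℕ → ℕ → Prop} {σ : State} {I : Inst} {f : I.V → ℕ}

theorem Models.part_iff (h : Models n I f A E) (x y : I.V) :
    Part A E (f x) (f y) ↔ y ≠ x ∧ ¬ I.G.Adj x y := by
  unfold Part
  rw [h.adj, h.mem]
  exact ⟨fun h' => ⟨fun e => h'.2.1 (by rw [e]), h'.2.2⟩,
    fun h' => ⟨⟨y, rfl⟩, fun e => h'.1 (h.inj e), h'.2⟩⟩

theorem Models.image_iff (h : Models n I f A E) {S : Set I.V} {x : I.V} : f x ∈ f '' S ↔ x ∈ S :=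
  h.inj.mem_set_image

/-- The outcome of the auction is an independent set of minimum surplus. -/
theorem Models.surplus_min (h : Models n I f A E) (x : I.V) {O P : ℕ → ℕ} {J : ℕ}
    (ha : Auction n (Part A E (f x)) E n O P 0) (hJn : J ≤ n + 1) (hJ : ∀ r < n, P r ≠ J)
    {Z : Set I.V} (hZ : ∀ y, y ∈ Z ↔ y = x ∨ (y ≠ x ∧ ¬ I.G.Adj x y) ∧ P (f y) ≤ J ∧
      ∀ r, r ≠ x ∧ ¬ I.G.Adj x r → P (f r) ≤ J → ¬ I.G.Adj y r) :
    I.G.IsIndepSet Z ∧ ∀ Y, x ∈ Y → I.G.IsIndepSet Y → surplus I.G Z ≤ surplus I.G Y := by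
  refine auction_surplus_min (p := fun y => P (f y)) (own := fun r l => O (f r) = f l + 1)
    (N := n + 1) (J := J) (H := {y | y ≠ x ∧ ¬ I.G.Adj x y}) (fun y => Iff.rfl)
    (fun r l hl => ?_) (fun r l l' hl hl' => h.inj (by omega)) (fun r r' l hr hr' => ?_)
    (fun r hr hp => ?_) (fun r l hl r' hr' hadj => ?_) (fun l hl hno r hr hadj => ?_) hJn
    (fun r _ => hJ _ (h.lt r)) hZ
  · obtain ⟨h1, h2, h3, -⟩ := ha.own _ (h.lt r) _ hl
    exact ⟨(h.part_iff x r).1 h1, (h.part_iff x l).1 h2, (h.adj l r).1 h3⟩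
  · exact h.inj (ha.inj _ (h.lt r) _ (h.lt r') (by omega) (by omega))
  · obtain ⟨l, hl⟩ := Nat.exists_eq_succ_of_ne_zero (ha.price _ (h.lt r) hp)
    obtain ⟨-, h2, -, -⟩ := ha.own _ (h.lt r) _ hl
    obtain ⟨y, rfl⟩ := (h.mem l).1 h2.1
    exact ⟨y, hl⟩
  · exact ha.near _ (h.lt r) _ hl _ (h.lt r') ((h.part_iff x r').2 hr') ((h.adj l r').2 hadj)
  · rcases ha.done _ (h.lt l) ((h.part_iff x l).2 hl) (by omega) with ⟨r', hr', ho⟩ | hall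
    · obtain ⟨h1, -, -, -⟩ := ha.own _ hr' _ ho
      obtain ⟨y, rfl⟩ := (h.mem r').1 h1.1
      exact absurd ho (hno y)
    · exact hall _ (h.lt r) ((h.part_iff x r).2 hr) ((h.adj l r).2 hadj)

/-- Compute, from the outcome of the auction, an independent set and its neighbourhood. -/
def extract : Prog :=
  .seq (.fill aLow aI aN (.const 0)
    (.and (.read aH (.var aI)) (.le (.read aPrice (.var aI)) (.var aGap))))
  (.seq (.fillSum aCandZ aI aCount aR aN
    (.and (.read aLow (.var aR)) (adjE (.var aI) (.var aR)))
    (.or (.eq (.var aI) (.var aV)) (.and (.read aLow (.var aI)) (.le (.var aCount) (.const 0)))))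
  (.seq (.fillSum aCandN aI aCount aR aN
    (.and (.read aCandZ (.var aR)) (adjE (.var aI) (.var aR)))
    (.and (.read aAlive (.var aI)) (.and (.not (.read aCandZ (.var aI)))
      (.not (.le (.var aCount) (.const 0))))))
  (.seq (.sum aCount aI aN (.read aCandN (.var aI)))
  (.seq (.sum aTmp aI aN (.read aCandZ (.var aI)))
    (.set aKey (.sub (.add (.var aN) (.var aCount)) (.var aTmp)))))))

theorem extract_spec (hM : n ≤ M) (h : Mem n k₀ A E u σ) (hmod : Models n I f A E) {x : I.V}
    (hx : σ aV 0 = f x) (hH : ∀ i < n, σ aH i = b2n (Part A E (f x) i))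
    (ha : Auction n (Part A E (f x)) E n (σ aOwner) (σ aPrice) 0) (hJn : σ aGap 0 ≤ n + 1)
    (hJ : ∀ r < n, σ aPrice r ≠ σ aGap 0) :
    Tri M extract σ fun σ' =>
      Same [aLow, aI, aCandZ, aCount, aR, aCandN, aTmp, aKey] σ σ' ∧
      ∃ Z : Set I.V, x ∈ Z ∧ I.G.IsIndepSet Z ∧
        (∀ Y, x ∈ Y → I.G.IsIndepSet Y → surplus I.G Z ≤ surplus I.G Y) ∧
        Enc n f aCandZ Z σ' ∧ Enc n f aCandN (nbhd I.G Z) σ' ∧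
        (σ' aKey 0 : ℤ) = n + surplus I.G Z := by
  set J := σ aGap 0 with hJdef
  let Z : Set I.V := {y | y = x ∨ (y ≠ x ∧ ¬ I.G.Adj x y) ∧ σ aPrice (f y) ≤ J ∧
    ∀ r, r ≠ x ∧ ¬ I.G.Adj x r → σ aPrice (f r) ≤ J → ¬ I.G.Adj y r}
  obtain ⟨hZ1, hZ2⟩ := hmod.surplus_min x ha hJn hJ (Z := Z) fun y => Iff.rfl
  refine Tri.seq (Tri.fill 0 (fun i => b2n (Part A E (f x) i ∧ σ aPrice i ≤ J)) hM h.size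
    (by decide) (fun _ _ => rfl) fun i hi τ hτ hI _ => ?_) fun σ₁ h₁ => ?_
  · have e1 : τ aH = σ aH := hτ aH (by decide)
    have e2 : τ aPrice = σ aPrice := hτ aPrice (by decide)
    have e3 : τ aGap 0 = J := by rw [hτ aGap (by decide)]
    simp only [Expr.eval, hI, e1, e2, e3, hH i hi, one_sub_sub_eq_b2n, b2n_and]
  have m₁ := h.congr (h₁.1.low (by decide))
  refine Tri.seq (Tri.fillSum
    (fun i j => b2n ((Part A E (f x) j ∧ σ aPrice j ≤ J) ∧ E i j))
    (fun i => b2n (i ∈ f '' Z)) hM m₁.size (by decide) (fun i hi j hj τ hτ hI hR => ?_)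
    fun i hi τ hτ hI hC => ?_) fun σ₂ h₂ => ?_
  · have hm := m₁.congr (hτ.low (by decide))
    have e1 : τ aLow = σ₁ aLow := hτ aLow (by decide)
    have e2 := h₁.2.1 j hj
    rw [zero_add] at e2
    simp only [Expr.eval, hI, hR, e1, e2, hm.adj_row hi hj, b2n_and]
  · have e1 : τ aLow = σ₁ aLow := hτ aLow (by decide)
    have e2 := h₁.2.1 i hi
    rw [zero_add] at e2
    have e3 : τ aV 0 = f x := by rw [hτ aV (by decide), h₁.1 aV (by decide), hx]
    simp only [Expr.eval, hI, e1, e2, e3, hC, one_sub_sub_eq_b2n, b2n_and, one_sub_b2n]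
    refine b2n_congr ?_
    rw [sum_b2n_eq_zero, ← le_antisymm_iff, ← not_or, not_not]
    constructor
    · rintro (rfl | ⟨⟨h1, h2⟩, h3⟩)
      · exact ⟨x, .inl rfl, rfl⟩
      · obtain ⟨y, rfl⟩ := (hmod.mem i).1 h1.1
        refine ⟨y, .inr ⟨(hmod.part_iff x y).1 h1, h2, fun r hr hrJ hyr => ?_⟩, rfl⟩
        exact h3 (f r) (hmod.lt r) ⟨⟨(hmod.part_iff x r).2 hr, hrJ⟩, (hmod.adj y r).2 hyr⟩
    · rintro ⟨y, rfl | ⟨h1, h2, h3⟩, rfl⟩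
      · exact .inl rfl
      · refine .inr ⟨⟨(hmod.part_iff x y).2 h1, h2⟩, fun j hj h4 => ?_⟩
        obtain ⟨r, rfl⟩ := (hmod.mem j).1 h4.1.1.1
        exact h3 r ((hmod.part_iff x r).1 h4.1.1) h4.1.2 ((hmod.adj y r).1 h4.2)
  have m₂ := m₁.congr (h₂.1.low (by decide))
  refine Tri.seq (Tri.fillSum (fun i j => b2n (j ∈ f '' Z ∧ E i j))
    (fun i => b2n (i ∈ f '' nbhd I.G Z)) hM m₂.size (by decide) (fun i hi j hj τ hτ hI hR => ?_)
    fun i hi τ hτ hI hC => ?_) fun σ₃ h₃ => ?_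
  · have hm := m₂.congr (hτ.low (by decide))
    have e1 : τ aCandZ = σ₂ aCandZ := hτ aCandZ (by decide)
    simp only [Expr.eval, hI, hR, e1, h₂.2 j hj, hm.adj_row hi hj, b2n_and]
  · have hm := m₂.congr (hτ.low (by decide))
    have e1 : τ aCandZ = σ₂ aCandZ := hτ aCandZ (by decide)
    simp only [Expr.eval, hI, e1, h₂.2 i hi, hm.alive i hi, hC, one_sub_sub_eq_b2n, b2n_and,
      one_sub_b2n]
    refine b2n_congr ?_
    rw [sum_b2n_eq_zero]
    constructor
    · rintro ⟨h1, h2, h3⟩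
      obtain ⟨y, rfl⟩ := (hmod.mem i).1 h1
      push Not at h3
      obtain ⟨_, -, ⟨z, hz, rfl⟩, hE⟩ := h3
      exact ⟨y, ⟨fun hy => h2 ⟨y, hy, rfl⟩, z, hz, ((hmod.adj y z).1 hE).symm⟩, rfl⟩
    · rintro ⟨y, ⟨hy, z, hz, hzy⟩, rfl⟩
      refine ⟨(hmod.mem _).2 ⟨y, rfl⟩, fun h => hy (hmod.image_iff.1 h), fun h => ?_⟩
      exact h (f z) (hmod.lt z) ⟨⟨z, hz, rfl⟩, (hmod.adj y z).2 hzy.symm⟩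
  have m₃ := m₂.congr (h₃.1.low (by decide))
  refine Tri.seq (Tri.sum (fun i => b2n (i ∈ f '' nbhd I.G Z)) hM m₃.size (by decide)
    fun i hi τ hτ hI => ?_) fun σ₄ h₄ => ?_
  · simp only [Expr.eval, hI, hτ aCandN (by decide), h₃.2 i hi]
  have m₄ := m₃.congr (h₄.1.low (by decide))
  have z₄ : ∀ i < n, σ₄ aCandZ i = b2n (i ∈ f '' Z) := fun i hi => by
    rw [h₄.1 aCandZ (by decide), h₃.1 aCandZ (by decide), h₂.2 i hi]
  refine Tri.seq (Tri.sum (fun i => b2n (i ∈ f '' Z)) hM m₄.size (by decide)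
    fun i hi τ hτ hI => ?_) fun σ₅ h₅ => ?_
  · simp only [Expr.eval, hI, hτ aCandZ (by decide), z₄ i hi]
  have hs : Same [aLow, aI, aCandZ, aCount, aR, aCandN, aTmp, aKey] σ σ₅ :=
    ((((h₁.1.mono (by decide)).trans (h₂.1.mono (by decide))).trans (h₃.1.mono (by decide))).trans
      (h₄.1.mono (by decide))).trans (h₅.1.mono (by decide))
  refine Tri.assign ⟨hs.write (by decide) _ _, Z, .inl rfl, hZ1, hZ2, fun i hi => ?_,
    fun i hi => ?_, ?_⟩
  · rw [State.write_other _ _ _ (by decide), h₅.1 aCandZ (by decide), z₄ i hi]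
  · rw [State.write_other _ _ _ (by decide), h₅.1 aCandN (by decide), h₄.1 aCandN (by decide),
      h₃.2 i hi]
  -- The key is the surplus shifted by `n`. Since |Z| ≤ n, the truncated subtraction computing it
  -- loses nothing.
  · have hle : Z.ncard ≤ n := by
      rw [← sum_b2n_image hmod.inj hmod.lt, sum_b2n]
      calc {i | i < n ∧ i ∈ f '' Z}.ncard ≤ (Finset.range n : Set ℕ).ncard :=
            Set.ncard_le_ncard (fun i hi => by simpa using hi.1) (Finset.finite_toSet _)
        _ = n := by rw [Set.ncard_coe_finset, Finset.card_range]
    simp only [Expr.eval, State.write_self, h₅.1 aN (by decide), m₄.size, h₅.2,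
      h₅.1 aCount (by decide), h₄.2, sum_b2n_image hmod.inj hmod.lt]
    unfold surplus
    omega

/-- Find an independent set of minimum surplus through a vertex. -/
def candidate : Prog := .seq prepare (.seq auction (.seq gap extract))

/-- The arrays used in the search for a set of minimum surplus. -/
abbrev scratch : List ℕ := [aV, aH, aPrice, aOwner, aL, aCur, aBid, aArg, aR, aTmp, aI, aGap, aJ,
  aCount, aBound, aLow, aCandZ, aCandN, aKey, aBest, aZ, aNbhd]

/-- The arrays used in the search for a set of minimum surplus through a vertex. -/
abbrev scratch' : List ℕ := [aH, aPrice, aOwner, aL, aCur, aBid, aArg, aR, aTmp, aI, aGap, aJ,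
  aCount, aBound, aLow, aCandZ, aCandN, aKey]

theorem candidate_spec (hM : (n + 2) ^ 2 ≤ M) (h : Mem n k₀ A E u σ) (hmod : Models n I f A E)
    {x : I.V} (hx : σ aV 0 = f x) :
    Tri M candidate σ fun σ' => Same scratch' σ σ' ∧
      ∃ Z : Set I.V, x ∈ Z ∧ I.G.IsIndepSet Z ∧
        (∀ Y, x ∈ Y → I.G.IsIndepSet Y → surplus I.G Z ≤ surplus I.G Y) ∧
        Enc n f aCandZ Z σ' ∧ Enc n f aCandN (nbhd I.G Z) σ' ∧
        (σ' aKey 0 : ℤ) = n + surplus I.G Z := by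
  have hM' : n + 1 ≤ M := by nlinarith
  refine Tri.seq (prepare_spec (by omega) h hx (hmod.lt x)) fun σ₁ ⟨s₁, h1, h2, h3⟩ => ?_
  have m₁ := h.congr (s₁.low (by decide))
  refine Tri.seq (auction_spec hM m₁ h1 h3 h2) fun σ₂ ⟨s₂, h4⟩ => ?_
  have m₂ := m₁.congr (s₂.low (by decide))
  refine Tri.seq (gap_spec hM' m₂) fun σ₃ ⟨s₃, h5, h6⟩ => ?_
  have m₃ := m₂.congr (s₃.low (by decide))
  refine (extract_spec (by omega) m₃ hmod ?_ (fun i hi => ?_) ?_ h5 ?_).mono fun σ' ⟨s₄, h7⟩ =>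
    ⟨(((s₁.mono (by decide)).trans (s₂.mono (by decide))).trans (s₃.mono (by decide))).trans
      (s₄.mono (by decide)), h7⟩
  · rw [s₃ aV (by decide), s₂ aV (by decide), s₁ aV (by decide), hx]
  · rw [s₃ aH (by decide), s₂ aH (by decide), h1 i hi]
  · rw [s₃ aOwner (by decide), s₃ aPrice (by decide)]
    exact h4
  · rwa [s₃ aPrice (by decide)]

/-- Find an independent set of minimum surplus, provided that this surplus is at most one. -/
def search : Prog :=
  -- Keys are surpluses shifted by `n`, so this start value stands for surplus 2: only sets of
  -- surplus at most 1 are recorded, and an unchanged value certifies a reduced instance.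
  .seq (.set aBest (.add (.var aN) (.const 2))) (.count aV aN (.ite (.read aAlive (.var aV))
    (.seq candidate (.ite (.le (.var aBest) (.var aKey)) (.set aTmp (.const 0))
      (.seq (.set aBest (.var aKey))
        (.seq (.fill aZ aI aN (.const 0) (.read aCandZ (.var aI)))
          (.fill aNbhd aI aN (.const 0) (.read aCandN (.var aI)))))))
    (.set aTmp (.const 0))))

/-- The outcome of the search for a set of minimum surplus among the ones containing a vertex
below `j`. -/
def Found (n : ℕ) (I : Inst) (f : I.V → ℕ) (j : ℕ) (σ : State) : Prop :=
  (σ aBest 0 = n + 2 ∧ ∀ x, f x < j → ∀ Y, x ∈ Y → I.G.IsIndepSet Y → 2 ≤ surplus I.G Y) ∨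
  ∃ Z : Set I.V, Z.Nonempty ∧ I.G.IsIndepSet Z ∧ (σ aBest 0 : ℤ) = n + surplus I.G Z ∧
    surplus I.G Z ≤ 1 ∧ Enc n f aZ Z σ ∧ Enc n f aNbhd (nbhd I.G Z) σ ∧
    ∀ x, f x < j → ∀ Y, x ∈ Y → I.G.IsIndepSet Y → surplus I.G Z ≤ surplus I.G Y

theorem Found.congr {j : ℕ} {σ' : State} (h : Found n I f j σ)
    (h1 : σ' aBest 0 = σ aBest 0) (h2 : σ' aZ = σ aZ) (h3 : σ' aNbhd = σ aNbhd) :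
    Found n I f j σ' := by
  unfold Found Enc at *
  rwa [h1, h2, h3]

theorem search_spec (hM : (n + 2) ^ 2 ≤ M) (h : Mem n k₀ A E u σ) (hmod : Models n I f A E) :
    Tri M search σ fun σ' => Same scratch σ σ' ∧ Found n I f n σ' := by
  have hM' : n ≤ M := by nlinarith
  refine Tri.seq (Tri.assign (Q := fun τ => Same scratch σ τ ∧ τ aBest 0 = n + 2)
    ⟨(Same.refl _ _).write (by decide) _ _, by simp [Expr.eval, h.size]⟩) fun σ₁ h₁ =>
    (Tri.count (m := n) (Inv := fun j τ => Same scratch σ τ ∧ Found n I f j τ) hM' ?_ ?_ ?_ ?_)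
  · rintro j τ ⟨hτ, -⟩
    rw [hτ aN (by decide), h.size]
  · rintro j τ x ⟨h1, h2⟩
    refine ⟨h1.write (by decide) _ _, h2.congr ?_ ?_ ?_⟩ <;>
      rw [State.write_other _ _ _ (by decide)]
  · exact ⟨h₁.1, .inl ⟨h₁.2, by simp⟩⟩
  · rintro j hj τ ⟨h1, h2⟩ hjV
    have hm := h.congr (h1.low (by decide))
    refine Tri.ite (fun he => ?_) fun he => Tri.assign ?_
    · simp only [Expr.eval, hjV, hm.alive j hj, b2n_ne_zero] at he
      obtain ⟨x, rfl⟩ := (hmod.mem j).1 he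
      refine Tri.seq (candidate_spec hM hm hmod hjV) fun σ₂ ⟨s₂, Z, hxZ, hZ, hmin, hcZ, hcN, hk⟩ => ?_
      have m₂ := hm.congr (s₂.low (by decide))
      have f₂ : Found n I f (f x) σ₂ := h2.congr (by rw [s₂ aBest (by decide)])
        (by rw [s₂ aZ (by decide)]) (by rw [s₂ aNbhd (by decide)])
      have v₂ : σ₂ aV 0 = f x := by rw [s₂ aV (by decide), hjV]
      have hs : Same scratch σ σ₂ := h1.trans (s₂.mono (by decide))
      have hlt : ∀ y, f y < f x + 1 → f y < f x ∨ y = x := fun y hy => by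
        rcases Nat.lt_succ_iff_lt_or_eq.1 hy with h | h
        · exact .inl h
        · exact .inr (hmod.inj h)
      refine Tri.ite (fun hb => Tri.assign ?_) fun hb => ?_
      · simp only [Expr.eval, one_sub_sub_eq_b2n, b2n_ne_zero] at hb
        refine ⟨⟨hs.write (by decide) _ _, ?_⟩, by
          rw [State.write_other _ _ _ (by decide), v₂]⟩
        suffices Found n I f (f x + 1) σ₂ by
          refine this.congr ?_ ?_ ?_ <;> rw [State.write_other _ _ _ (by decide)]
        rcases f₂ with ⟨h3, h4⟩ | ⟨Z', h3, h4, h5, h6, h7, h8, h9⟩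
        · refine .inl ⟨h3, fun y hy Y hyY hY => ?_⟩
          rcases hlt y hy with h | rfl
          · exact h4 y h Y hyY hY
          · have := hmin Y hyY hY
            omega
        · refine .inr ⟨Z', h3, h4, h5, h6, h7, h8, fun y hy Y hyY hY => ?_⟩
          rcases hlt y hy with h | rfl
          · exact h9 y h Y hyY hY
          · have := hmin Y hyY hY
            omega
      · simp only [Expr.eval, one_sub_sub_eq_b2n, b2n_eq_zero, not_le] at hb
        refine Tri.seq (Tri.assign (Q := fun τ' => Same [aBest] σ₂ τ' ∧ τ' aBest 0 = σ₂ aKey 0)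
          ⟨(Same.refl _ _).write (by decide) _ _, by simp [Expr.eval]⟩) fun σ₃ ⟨s₃, k₃⟩ => ?_
        have m₃ := m₂.congr (s₃.low (by decide))
        refine Tri.seq (Tri.fill 0 (σ₃ aCandZ) hM' m₃.size (by decide) (fun _ _ => rfl)
          fun i hi τ' hτ' hI _ => ?_) fun σ₄ ⟨s₄, h₄, _⟩ => ?_
        · simp only [Expr.eval, hI, hτ' aCandZ (by decide)]
        have m₄ := m₃.congr (s₄.low (by decide))
        refine (Tri.fill 0 (σ₄ aCandN) hM' m₄.size (by decide) (fun _ _ => rfl)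
          fun i hi τ' hτ' hI _ => ?_).mono fun σ₅ ⟨s₅, h₅, _⟩ => ?_
        · simp only [Expr.eval, hI, hτ' aCandN (by decide)]
        refine ⟨⟨((hs.trans (s₃.mono (by decide))).trans (s₄.mono (by decide))).trans
          (s₅.mono (by decide)), .inr ⟨Z, ⟨x, hxZ⟩, hZ, ?_, ?_, fun i hi => ?_, fun i hi => ?_,
          fun y hy Y hyY hY => ?_⟩⟩, ?_⟩
        · rw [s₅ aBest (by decide), s₄ aBest (by decide), k₃, hk]
        · rcases f₂ with ⟨h3, h4⟩ | ⟨Z', h3, h4, h5, h6, -⟩ <;> omega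
        · have := h₄ i hi
          rw [zero_add] at this
          rw [s₅ aZ (by decide), this, s₃ aCandZ (by decide), hcZ i hi]
        · have := h₅ i hi
          rw [zero_add] at this
          rw [this, s₄ aCandN (by decide), s₃ aCandN (by decide), hcN i hi]
        · rcases hlt y hy with h | rfl
          · rcases f₂ with ⟨h3, h4⟩ | ⟨Z', h3, h4, h5, h6, -, -, h9⟩
            · have := h4 y h Y hyY hY
              omega
            · have := h9 y h Y hyY hY
              omega
          · exact hmin Y hyY hY
        · rw [s₅ aV (by decide), s₄ aV (by decide), s₃ aV (by decide), v₂]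
    · simp only [Expr.eval, hjV, hm.alive j hj, b2n_eq_zero] at he
      refine ⟨⟨h1.write (by decide) _ _, ?_⟩, by rw [State.write_other _ _ _ (by decide), hjV]⟩
      suffices Found n I f (j + 1) τ by
        refine this.congr ?_ ?_ ?_ <;> rw [State.write_other _ _ _ (by decide)]
      have hlt : ∀ y, f y < j + 1 → f y < j := fun y hy => by
        rcases Nat.lt_succ_iff_lt_or_eq.1 hy with h | h
        · exact h
        · exact absurd ((hmod.mem j).2 ⟨y, h⟩) he
      rcases h2 with ⟨h3, h4⟩ | ⟨Z, h3, h4, h5, h6, h7, h8, h9⟩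
      · exact .inl ⟨h3, fun y hy => h4 y (hlt y hy)⟩
      · exact .inr ⟨Z, h3, h4, h5, h6, h7, h8, fun y hy => h9 y (hlt y hy)⟩

end RAM


namespace RAM

/-! ### The stack of pending instances -/

/-- A pending instance: the alive vertices, the adjacency matrix and the used budget. -/
abbrev Pending : Type := Set ℕ × (ℕ → ℕ → Prop) × ℕ

/-- The array `s` holds a stack of pending instances below the position `top`. -/
def Stk (n : ℕ) (s : ℕ → ℕ) : List Pending → ℕ → Prop
  | [], top => top = 0
  | (A, E, u) :: St, top => ∃ b, top = b + (n * n + n + 1) ∧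
      (∀ i < n, ∀ j < n, s (b + (i * n + j)) = b2n (E i j)) ∧
      (∀ i < n, s (b + n * n + i) = b2n (i ∈ A)) ∧ s (b + n * n + n) = u ∧ Stk n s St b

theorem index_lt {n i j : ℕ} (hi : i < n) (hj : j < n) : i * n + j < n * n := by
  have : (i + 1) * n ≤ n * n := Nat.mul_le_mul_right n hi
  rw [Nat.succ_mul] at this
  omega

theorem index_inj {n i j i' j' : ℕ} (hj : j < n) (hj' : j' < n) :
    i * n + j = i' * n + j' ↔ i = i' ∧ j = j' := by
  refine ⟨fun h => ?_, fun ⟨h, h'⟩ => by rw [h, h']⟩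
  have hn : 0 < n := by omega
  have h1 : (i * n + j) / n = i := by
    rw [mul_comm, Nat.mul_add_div hn, Nat.div_eq_of_lt hj, add_zero]
  have h2 : (i' * n + j') / n = i' := by
    rw [mul_comm, Nat.mul_add_div hn, Nat.div_eq_of_lt hj', add_zero]
  have h3 : i = i' := by rw [← h1, h, h2]
  subst h3
  exact ⟨rfl, by omega⟩

theorem Stk.congr {n : ℕ} {s s' : ℕ → ℕ} : ∀ {St : List Pending} {top : ℕ}, Stk n s St top →
    (∀ x < top, s' x = s x) → Stk n s' St top
  | [], _, h, _ => h
  | (A, E, u) :: St, top, ⟨b, h1, h2, h3, h4, h5⟩, hs => by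
    refine ⟨b, h1, fun i hi j hj => ?_, fun i hi => ?_, ?_, h5.congr fun x hx => hs x (by omega)⟩
    · have := index_lt hi hj
      rw [hs _ (by omega), h2 i hi j hj]
    · rw [hs _ (by omega), h3 i hi]
    · rw [hs _ (by omega), h4]

/-- The working memory holds an instance, the stack is `St`, and the search goes on. -/
structure Conf (n k₀ : ℕ) (A : Set ℕ) (E : ℕ → ℕ → Prop) (u : ℕ) (St : List Pending)
    (σ : State) : Prop extends Mem n k₀ A E u σ where
  stk : Stk n (σ aStack) St (σ aTop 0)
  active : σ aActive 0 = 1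
  answer : σ aAnswer 0 = 0

/-- The state after giving up the current instance. -/
def Popped (n k₀ : ℕ) : List Pending → State → Prop
  | [], σ => σ aActive 0 = 0 ∧ σ aAnswer 0 = 0
  | (A, E, u) :: St, σ => Conf n k₀ A E u St σ

variable {M n k₀ u : ℕ} {A : Set ℕ} {E : ℕ → ℕ → Prop} {σ : State} {I : Inst} {f : I.V → ℕ}
  {St : List Pending}

theorem Conf.congr {σ' : State} (h : Conf n k₀ A E u St σ) (hs : ∀ a ≤ 10, σ' a = σ a) :
    Conf n k₀ A E u St σ' := by
  refine ⟨h.toMem.congr hs, ?_, ?_, ?_⟩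
  · rw [hs aStack (by decide), hs aTop (by decide)]; exact h.stk
  · rw [hs aActive (by decide)]; exact h.active
  · rw [hs aAnswer (by decide)]; exact h.answer

/-- Of the protected arrays, the list omits just the adjacency matrix, the alive flags and the used
budget, which are what a reduction or a branching changes in place. -/
theorem Conf.update {A' : Set ℕ} {E' : ℕ → ℕ → Prop} {u' : ℕ} {σ' : State}
    (h : Conf n k₀ A E u St σ) (hs : ∀ a ∈ [0, 1, 3, 4, 7, 8, 9, 10], σ' a = σ a)
    (hadj : ∀ i < n, ∀ j < n, σ' aAdj (i * n + j) = b2n (E' i j))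
    (halive : ∀ i < n, σ' aAlive i = b2n (i ∈ A')) (hused : σ' aUsed 0 = u') :
    Conf n k₀ A' E' u' St σ' := by
  refine ⟨⟨?_, ?_, ?_, ?_, hadj, halive, hused⟩, ?_, ?_, ?_⟩
  · rw [hs aN (by decide)]; exact h.size
  · rw [hs aK (by decide)]; exact h.budget
  · rw [hs aRow (by decide)]; exact h.row
  · rw [hs aSq (by decide)]; exact h.sq
  · rw [hs aStack (by decide), hs aTop (by decide)]; exact h.stk
  · rw [hs aActive (by decide)]; exact h.active
  · rw [hs aAnswer (by decide)]; exact h.answer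

theorem Same.eqOn {S : List ℕ} {σ σ' : State} (h : Same S σ σ') (L : List ℕ)
    (hS : ∀ a ∈ L, a ∉ S) : ∀ a ∈ L, σ' a = σ a := fun a ha => h a (hS a ha)

/-- Give up the current instance and continue with the next one. -/
def pop : Prog :=
  .ite (.le (.var aTop) (.const 0)) (.set aActive (.const 0))
    (.seq (.set aTop (.sub (.var aTop) (.add (.add (.var aSq) (.var aN)) (.const 1))))
    (.seq (.fill aAdj aI aSq (.const 0) (.read aStack (.add (.var aTop) (.var aI))))
    (.seq (.fill aAlive aI aN (.const 0)
      (.read aStack (.add (.add (.var aTop) (.var aSq)) (.var aI))))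
    (.set aUsed (.read aStack (.add (.add (.var aTop) (.var aSq)) (.var aN)))))))

theorem pop_spec (hM : (n + 2) ^ 2 ≤ M) (h : Conf n k₀ A E u St σ) :
    Tri M pop σ (Popped n k₀ St) := by
  have hM1 : n ≤ M := by nlinarith
  have hM2 : n * n ≤ M := by nlinarith
  refine Tri.ite (fun he => Tri.assign ?_) fun he => ?_
  · simp only [Expr.eval, one_sub_sub_eq_b2n, b2n_ne_zero] at he
    have hst := h.stk
    rcases St with _ | ⟨⟨A', E', u'⟩, St⟩
    · exact ⟨by simp [Expr.eval], by
        rw [State.write_other _ _ _ (by decide)]; exact h.answer⟩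
    · obtain ⟨b, hb, -⟩ := hst
      omega
  · simp only [Expr.eval, one_sub_sub_eq_b2n, b2n_eq_zero] at he
    have hst := h.stk
    rcases St with _ | ⟨⟨A', E', u'⟩, St⟩
    · exact absurd (le_of_eq hst) he
    · obtain ⟨b, hb, h1, h2, h3, h4⟩ := hst
      refine Tri.seq (Tri.assign (Q := fun τ => Same [aTop] σ τ ∧ τ aTop 0 = b)
        ⟨(Same.refl _ _).write (by decide) _ _, ?_⟩) fun σ₁ ⟨s₁, t₁⟩ => ?_
      · simp only [Expr.eval, State.write_self, h.sq, h.size, hb]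
        omega
      have n₁ : σ₁ aN 0 = n := by rw [s₁ aN (by decide), h.size]
      have q₁ : σ₁ aSq 0 = n * n := by rw [s₁ aSq (by decide), h.sq]
      have st₁ : σ₁ aStack = σ aStack := s₁ aStack (by decide)
      refine Tri.seq (Tri.fill 0 (fun j => σ aStack (b + j)) hM2 q₁ (by decide) (fun _ _ => rfl)
        fun j hj τ hτ hI _ => ?_) fun σ₂ ⟨s₂, a₂, _⟩ => ?_
      · simp only [Expr.eval, hI, hτ aTop (by decide), t₁, hτ aStack (by decide), st₁]
      have n₂ : σ₂ aN 0 = n := by rw [s₂ aN (by decide), n₁]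
      refine Tri.seq (Tri.fill 0 (fun j => σ aStack (b + n * n + j)) hM1 n₂ (by decide)
        (fun _ _ => rfl) fun j hj τ hτ hI _ => ?_) fun σ₃ ⟨s₃, a₃, _⟩ => Tri.assign ?_
      · simp only [Expr.eval, hI, hτ aTop (by decide), hτ aStack (by decide), s₂ aTop (by decide),
          s₂ aStack (by decide), hτ aSq (by decide), s₂ aSq (by decide), t₁, st₁, q₁]
      have hs : Same [aTop, aAdj, aI, aAlive, aUsed] σ σ₃ :=
        ((s₁.mono (by decide)).trans (s₂.mono (by decide))).trans (s₃.mono (by decide))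
      have t₃ : σ₃ aTop 0 = b := by rw [s₃ aTop (by decide), s₂ aTop (by decide), t₁]
      have st₃ : σ₃ aStack = σ aStack := hs aStack (by decide)
      refine ⟨⟨?_, ?_, ?_, ?_, fun i hi j hj => ?_, fun i hi => ?_, ?_⟩, ?_, ?_, ?_⟩
      · rw [State.write_other _ _ _ (by decide), hs aN (by decide), h.size]
      · rw [State.write_other _ _ _ (by decide), hs aK (by decide), h.budget]
      · rw [State.write_other _ _ _ (by decide), hs aRow (by decide)]; exact h.row
      · rw [State.write_other _ _ _ (by decide), hs aSq (by decide), h.sq]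
      · have := a₂ _ (index_lt hi hj)
        rw [zero_add] at this
        rw [State.write_other _ _ _ (by decide), s₃ aAdj (by decide), this, h1 i hi j hj]
      · have := a₃ i hi
        rw [zero_add] at this
        rw [State.write_other _ _ _ (by decide), this, h2 i hi]
      · simp only [Expr.eval, State.write_self, t₃, st₃, hs aSq (by decide), hs aN (by decide),
          h.sq, h.size, h3]
      · rw [State.write_other _ _ _ (by decide), State.write_other _ _ _ (by decide), t₃, st₃]
        exact h4
      · rw [State.write_other _ _ _ (by decide), hs aActive (by decide), h.active]
      · rw [State.write_other _ _ _ (by decide), hs aAnswer (by decide), h.answer]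

/-- Put a copy of the current instance on the stack. -/
def push : Prog :=
  .seq (.fill aStack aI aSq (.var aTop) (.read aAdj (.var aI)))
  (.seq (.fill aStack aI aN (.add (.var aTop) (.var aSq)) (.read aAlive (.var aI)))
  (.seq (.assign aStack (.add (.add (.var aTop) (.var aSq)) (.var aN)) (.var aUsed))
    (.set aTop (.add (.var aTop) (.add (.add (.var aSq) (.var aN)) (.const 1))))))

/-- The whole matrix is saved, and not only the alive flags, because folds in the other branch
overwrite it. -/
theorem push_spec (hM : (n + 2) ^ 2 ≤ M) (h : Conf n k₀ A E u St σ) :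
    Tri M push σ fun σ' => Same [aStack, aTop, aI] σ σ' ∧
      Conf n k₀ A E u ((A, E, u) :: St) σ' := by
  have hM1 : n ≤ M := by nlinarith
  have hM2 : n * n ≤ M := by nlinarith
  set b := σ aTop 0 with hb
  refine Tri.seq (Tri.fill b (σ aAdj) hM2 h.sq (by decide) (fun τ hτ => ?_)
    fun j hj τ hτ hI _ => ?_) fun σ₁ ⟨s₁, a₁, o₁⟩ => ?_
  · simp only [Expr.eval, hτ aTop (by decide), hb]
  · simp only [Expr.eval, hI, hτ aAdj (by decide)]
  have n₁ : σ₁ aN 0 = n := by rw [s₁ aN (by decide), h.size]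
  have q₁ : σ₁ aSq 0 = n * n := by rw [s₁ aSq (by decide), h.sq]
  refine Tri.seq (Tri.fill (b + n * n) (σ aAlive) hM1 n₁ (by decide) (fun τ hτ => ?_)
    fun j hj τ hτ hI _ => ?_) fun σ₂ ⟨s₂, a₂, o₂⟩ => ?_
  · simp only [Expr.eval, hτ aTop (by decide), hτ aSq (by decide), s₁ aTop (by decide), q₁, hb]
  · simp only [Expr.eval, hI, hτ aAlive (by decide), s₁ aAlive (by decide)]
  have hs : Same [aStack, aTop, aI] σ σ₂ := (s₁.mono (by decide)).trans (s₂.mono (by decide))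
  have t₂ : σ₂ aTop 0 = b := by rw [s₂ aTop (by decide), s₁ aTop (by decide), hb]
  have q₂ : σ₂ aSq 0 = n * n := by rw [s₂ aSq (by decide), q₁]
  have n₂ : σ₂ aN 0 = n := by rw [s₂ aN (by decide), n₁]
  have u₂ : σ₂ aUsed 0 = u := by rw [hs aUsed (by decide), h.used]
  refine Tri.seq (Tri.assign (Q := (· = _)) rfl) fun σ₃ e₃ => Tri.assign ?_
  simp only [Expr.eval, t₂, q₂, n₂, u₂] at e₃
  have hs₃ : Same [aStack, aTop, aI] σ σ₃ := by
    rw [e₃]; exact hs.write (by decide) _ _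
  have t₃ : σ₃ aTop 0 = b := by rw [e₃, State.write_other _ _ _ (by decide), t₂]
  have q₃ : σ₃ aSq 0 = n * n := by rw [e₃, State.write_other _ _ _ (by decide), q₂]
  have n₃ : σ₃ aN 0 = n := by rw [e₃, State.write_other _ _ _ (by decide), n₂]
  simp only [Expr.eval, t₃, q₃, n₃]
  have c₃ : ∀ x, σ₃ aStack x = if x = b + n * n + n then u else σ₂ aStack x := fun x => by
    rw [e₃, State.write_cell]
  have hs₄ := hs₃.write (σ' := σ₃) (a := aTop) (by decide) 0 (b + (n * n + n + 1))
  refine ⟨hs₄, ⟨?_, ?_, ?_, ?_, ?_, ?_, ?_⟩, ?_, ?_, ?_⟩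
  · rw [hs₄ aN (by decide)]; exact h.size
  · rw [hs₄ aK (by decide)]; exact h.budget
  · rw [hs₄ aRow (by decide)]; exact h.row
  · rw [hs₄ aSq (by decide)]; exact h.sq
  · rw [hs₄ aAdj (by decide)]; exact h.adj
  · rw [hs₄ aAlive (by decide)]; exact h.alive
  · rw [hs₄ aUsed (by decide)]; exact h.used
  · rw [State.write_other _ _ _ (show aStack ≠ aTop by decide), State.write_self]
    refine ⟨b, rfl, fun i hi j hj => ?_, fun i hi => ?_, ?_, h.stk.congr fun x hx => ?_⟩
    · have hlt := index_lt hi hj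
      rw [c₃, if_neg (by omega), o₂ _ (by omega), a₁ _ hlt, h.adj i hi j hj]
    · rw [c₃, if_neg (by omega), a₂ i hi, h.alive i hi]
    · rw [c₃, if_pos rfl]
    · rw [c₃, if_neg (by omega), o₂ _ (by omega), o₁ _ (by omega)]
  · rw [hs₄ aActive (by decide)]; exact h.active
  · rw [hs₄ aAnswer (by decide)]; exact h.answer

/-- Find a number below the value of cell `0` of `b` for which the expression is nonzero. -/
def Prog.pick (d i b : ℕ) (e : Expr) : Prog :=
  .count i b (.ite e (.set d (.var i)) (.set d (.var d)))

/-- The scan keeps the last hit, so nothing is claimed about `d` before the first one. -/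
theorem Tri.pick {d i b m : ℕ} {e : Expr} {σ : State} (p : ℕ → Prop) (hm : m ≤ M)
    (hbm : σ b 0 = m) (hd : d ≠ i ∧ b ≠ i ∧ b ≠ d) (hex : ∃ j < m, p j)
    (he : ∀ j < m, ∀ τ, Same [d, i] σ τ → τ i 0 = j → e.eval τ = b2n (p j)) :
    Tri M (.pick d i b e) σ fun σ' => Same [d, i] σ σ' ∧ σ' d 0 < m ∧ p (σ' d 0) := by
  obtain ⟨hdi, hbi, hbd⟩ := hd
  refine (Tri.count (m := m) (Inv := fun j τ => Same [d, i] σ τ ∧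
    ((∃ j' < j, p j') → τ d 0 < m ∧ p (τ d 0))) hm ?_ ?_ ?_ ?_).mono
    fun σ' h' => ⟨h'.1, h'.2 hex⟩
  · rintro j τ ⟨h, -⟩
    rw [h b (by simp [hbi, hbd]), hbm]
  · rintro j τ x ⟨h1, h2⟩
    rw [State.write_other _ _ _ hdi]
    exact ⟨h1.write (by simp) _ _, h2⟩
  · exact ⟨Same.refl _ _, by simp⟩
  · rintro j hj τ ⟨h1, h2⟩ hij
    have hev := he j hj τ h1 hij
    refine Tri.ite (fun hne => Tri.assign ?_) fun hz => Tri.assign ?_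
    · rw [hev, b2n_ne_zero] at hne
      simp only [Expr.eval, hij, State.write_self, State.write_other _ _ _ hdi.symm]
      exact ⟨⟨h1.write (by simp) _ _, fun _ => ⟨hj, hne⟩⟩, trivial⟩
    · rw [hev, b2n_eq_zero] at hz
      simp only [Expr.eval, hij, State.write_self, State.write_other _ _ _ hdi.symm]
      refine ⟨⟨h1.write (by simp) _ _, ?_⟩, trivial⟩
      rintro ⟨j', hj', hp⟩
      refine h2 ⟨j', ?_, hp⟩
      rcases Nat.lt_succ_iff_lt_or_eq.1 hj' with h | rfl
      · exact h
      · exact absurd hp hz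

end RAM


namespace RAM

variable {M n k₀ u : ℕ} {A : Set ℕ} {E : ℕ → ℕ → Prop} {σ : State} {I : Inst} {f : I.V → ℕ}
  {St : List Pending}

/-! ### Deleting, folding and branching -/

/-- Deletion touches only the alive set; stale entries of the matrix do no harm, since adjacency is
required only between alive vertices. -/
theorem Models.keep (h : Models n I f A E) (S : Set I.V) (d : ℕ) :
    Models n (I.keep S d) (fun x => f x.1) (f '' S) E where
  inj _ _ hxy := Subtype.ext (h.inj hxy)
  lt x := h.lt x.1
  mem _ := ⟨fun ⟨x, hx, hi⟩ => ⟨⟨x, hx⟩, hi⟩, fun ⟨x, hi⟩ => ⟨x.1, x.2, hi⟩⟩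
  adj x y := h.adj x.1 y.1

/-- The adjacency relation after making `w` adjacent to the numbers satisfying `T` only. -/
def rewireAdj (w : ℕ) (T : ℕ → Prop) (E : ℕ → ℕ → Prop) (a b : ℕ) : Prop :=
  (a = w ∧ T b) ∨ (a ≠ w ∧ b = w ∧ T a) ∨ (a ≠ w ∧ b ≠ w ∧ E a b)

/-- The remaining vertices with a neighbour in `N(Z)`. -/
def touched (I : Inst) (Z : Set I.V) : Set I.V :=
  {y | y ∈ (Z ∪ nbhd I.G Z)ᶜ ∧ ∃ w ∈ nbhd I.G Z, I.G.Adj w y}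

/-- The number of some deleted vertex `w` of N(Z) is reused for the new vertex, so the matrix never
outgrows its original size. -/
theorem Models.fold (h : Models n I f A E) (Z : Set I.V) {w : I.V} (hw : w ∈ nbhd I.G Z) :
    Models n (I.fold Z)
      (fun o : Option ↑(Z ∪ nbhd I.G Z)ᶜ => o.elim (f w) fun x => f x.1)
      (insert (f w) (f '' (Z ∪ nbhd I.G Z)ᶜ))
      (rewireAdj (f w) (· ∈ f '' touched I Z) E) := by
  have hne : ∀ x : ↑(Z ∪ nbhd I.G Z)ᶜ, f x.1 ≠ f w := fun x hx =>
    x.2 (.inr (h.inj hx ▸ hw))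
  have hT : ∀ x : ↑(Z ∪ nbhd I.G Z)ᶜ, f x.1 ∈ f '' touched I Z ↔
      ∃ w ∈ nbhd I.G Z, I.G.Adj w x.1 := fun x => by
    rw [h.image_iff]; exact ⟨fun h => h.2, fun h => ⟨x.2, h⟩⟩
  refine ⟨?_, ?_, fun i => ⟨?_, ?_⟩, ?_⟩
  · rintro (_ | x) (_ | y) hxy
    · rfl
    · exact absurd hxy.symm (hne y)
    · exact absurd hxy (hne x)
    · exact congrArg some (Subtype.ext (h.inj hxy))
  · rintro (_ | x)
    · exact h.lt w
    · exact h.lt x.1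
  · rintro (hi | ⟨x, hx, hi⟩)
    · exact ⟨none, hi.symm⟩
    · exact ⟨some ⟨x, hx⟩, hi⟩
  · rintro ⟨_ | x, hi⟩
    · exact .inl hi.symm
    · exact .inr ⟨x.1, x.2, hi⟩
  · rintro (_ | x) (_ | y)
    · refine ⟨fun h' => ?_, fun h' => absurd h' ((I.fold Z).G.irrefl)⟩
      rcases h' with ⟨-, h'⟩ | ⟨h', -⟩ | ⟨h', -⟩
      · exact absurd (Or.inr hw) (h.image_iff.1 h').1
      · exact absurd rfl h'
      · exact absurd rfl h'
    · refine Iff.trans ?_ (hT y)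
      refine ⟨fun h' => ?_, fun h' => .inl ⟨rfl, h'⟩⟩
      rcases h' with ⟨-, h'⟩ | ⟨h', -⟩ | ⟨h', -⟩
      · exact h'
      · exact absurd rfl h'
      · exact absurd rfl h'
    · refine Iff.trans ?_ (hT x)
      refine ⟨fun h' => ?_, fun h' => .inr (.inl ⟨hne x, rfl, h'⟩)⟩
      rcases h' with ⟨h', -⟩ | ⟨-, -, h'⟩ | ⟨-, h', -⟩
      · exact absurd h' (hne x)
      · exact h'
      · exact absurd rfl h'
    · change rewireAdj (f w) _ E (f x.1) (f y.1) ↔ I.G.Adj x.1 y.1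
      unfold rewireAdj
      rw [h.adj]
      refine ⟨fun h' => ?_, fun h' => .inr (.inr ⟨hne x, hne y, h'⟩)⟩
      rcases h' with ⟨h', -⟩ | ⟨-, h', -⟩ | ⟨-, -, h'⟩
      · exact absurd h' (hne x)
      · exact absurd h' (hne y)
      · exact h'

/-- Make vertex `aNew` adjacent to the vertices marked in `aTouch` only. -/
def rewire : Prog :=
  .count aI aN (.seq (.assign aAdj (.add (.read aRow (.var aNew)) (.var aI)) (.read aTouch (.var aI)))
    (.assign aAdj (.add (.read aRow (.var aI)) (.var aNew)) (.read aTouch (.var aI))))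

theorem rewire_spec (hM : n ≤ M) (hn : σ aN 0 = n) (hrow : ∀ i < n, σ aRow i = i * n)
    (hadj : ∀ i < n, ∀ j < n, σ aAdj (i * n + j) = b2n (E i j)) {w : ℕ} (hw : σ aNew 0 = w)
    (hwn : w < n) {T : ℕ → Prop} (hT : ∀ i < n, σ aTouch i = b2n (T i)) :
    Tri M rewire σ fun σ' => Same [aAdj, aI] σ σ' ∧
      ∀ i < n, ∀ j < n, σ' aAdj (i * n + j) = b2n (rewireAdj w T E i j) := by
  classical
  -- After `j` rounds the entries of row and column `w` whose other index is below `j` are final.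
  refine (Tri.count (m := n) (Inv := fun j τ => Same [aAdj, aI] σ τ ∧
      ∀ a < n, ∀ b < n, τ aAdj (a * n + b) = if a = w ∧ b < j then b2n (T b) else
        if b = w ∧ a < j then b2n (T a) else b2n (E a b)) hM ?_ ?_ ?_ ?_).mono
      fun σ' h' => ⟨h'.1, fun a ha b hb => ?_⟩
  · rintro j τ ⟨h, -⟩
    rw [h aN (by decide), hn]
  · rintro j τ x ⟨h1, h2⟩
    rw [State.write_other _ _ _ (show aAdj ≠ aI by decide)]
    exact ⟨h1.write (by decide) _ _, h2⟩
  · exact ⟨Same.refl _ _, fun a ha b hb => by simp [hadj a ha b hb]⟩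
  · rintro j hj τ ⟨h1, h2⟩ hjI
    refine Tri.seq (Tri.assign (Q := (· = _)) rfl) fun τ' hτ' => Tri.assign ?_
    have e1 : τ aNew 0 = w := by rw [h1 aNew (by decide), hw]
    have e2 : τ aTouch j = b2n (T j) := by rw [h1 aTouch (by decide), hT j hj]
    have e3 : ∀ i < n, τ aRow i = i * n := fun i hi => by rw [h1 aRow (by decide), hrow i hi]
    subst hτ'
    simp only [Expr.eval, State.write_other _ _ _ (show aRow ≠ aAdj by decide),
      State.write_other _ _ _ (show aI ≠ aAdj by decide),
      State.write_other _ _ _ (show aNew ≠ aAdj by decide),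
      State.write_other _ _ _ (show aTouch ≠ aAdj by decide), hjI, e1, e2, e3 w hwn, e3 j hj,
      State.write_cell]
    refine ⟨⟨(h1.write (by decide) _ _).write (by decide) _ _, fun a ha b hb => ?_⟩, trivial⟩
    simp only [index_inj hb hwn, index_inj hb hj, h2 a ha b hb]
    by_cases haw : a = w
    · subst haw
      by_cases hbj : b = j
      · subst hbj
        by_cases hba : b = a
        · subst hba; simp
        · simp
      · by_cases hlt : b < j
        · have hlt' : b < j + 1 := by omega
          simp only [hbj, hlt, hlt', and_false, if_false, and_true, if_true]
          split_ifs with h3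
          · rw [h3.2, ← h3.1]
          · rfl
        · have hlt' : ¬ b < j + 1 := by omega
          simp only [hbj, hlt, hlt', and_false, if_false]
          by_cases hba : b = a
          · subst hba
            have h3 : b ≠ j := hbj
            simp [h3, hlt, hlt']
          · simp [hba]
    · by_cases hbw : b = w
      · subst hbw
        by_cases haj : a = j
        · subst haj; simp [haw]
        · have : a < j + 1 ↔ a < j := by omega
          simp [haw, haj, this]
      · simp [haw, hbw]
  · rw [h'.2 a ha b hb]
    unfold rewireAdj
    by_cases haw : a = w
    · simp [haw, hb]
    · by_cases hbw : b = w
      · simp [haw, hbw, ha]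
      · simp [haw, hbw]

/-- Fold the set `aZ` after its closed neighbourhood has been deleted. -/
def foldStep : Prog :=
  -- `aTouch` was filled before the deletion; restricted to the vertices still alive, it marks the
  -- neighbours of the new vertex.
  .seq (.fill aTouch aI aN (.const 0) (.and (.read aTouch (.var aI)) (.read aAlive (.var aI))))
  (.seq (.pick aNew aI aN (.read aNbhd (.var aI)))
  (.seq rewire
  (.seq (.assign aAlive (.var aNew) (.const 1))
    (.set aUsed (.add (.var aUsed) (.var aTmp))))))

theorem foldStep_spec (hM : n ≤ M) (hmod : Models n I f A E) {Z : Set I.V}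
    (h : Conf n k₀ (f '' (Z ∪ nbhd I.G Z)ᶜ) E u St σ) (hN : Enc n f aNbhd (nbhd I.G Z) σ)
    (hne : (nbhd I.G Z).Nonempty) (hT : Enc n f aTouch {y | ∃ w ∈ nbhd I.G Z, I.G.Adj w y} σ)
    (hZ : σ aTmp 0 = Z.ncard) :
    Tri M foldStep σ fun σ' => ∃ w ∈ nbhd I.G Z,
      Conf n k₀ (insert (f w) (f '' (Z ∪ nbhd I.G Z)ᶜ))
        (rewireAdj (f w) (· ∈ f '' touched I Z) E) (u + Z.ncard) St σ' := by
  refine Tri.seq (Tri.fill 0 (fun i => b2n (i ∈ f '' touched I Z)) hM h.size (by decide)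
    (fun _ _ => rfl) fun i hi τ hτ hI ho => ?_) fun σ₁ ⟨s₁, t₁, _⟩ => ?_
  · simp only [Expr.eval, hI, ho i (.inr (by omega)), hτ aAlive (by decide), h.alive i hi, hT i hi,
      b2n_and]
    refine b2n_congr ?_
    rw [← Set.mem_inter_iff, ← Set.image_inter hmod.inj, Set.inter_comm]
    rfl
  have c₁ := h.congr (s₁.low (by decide))
  obtain ⟨w₀, hw₀⟩ := hne
  refine Tri.seq (Tri.pick (fun i => i ∈ f '' nbhd I.G Z) hM c₁.size (by decide)
    ⟨f w₀, hmod.lt w₀, w₀, hw₀, rfl⟩ fun i hi τ hτ hI => ?_) fun σ₂ ⟨s₂, hlt, hw⟩ => ?_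
  · simp only [Expr.eval, hI, hτ aNbhd (by decide), s₁ aNbhd (by decide), hN i hi]
  obtain ⟨w, hwN, hw⟩ := hw
  have c₂ := c₁.congr (s₂.low (by decide))
  refine Tri.seq (rewire_spec hM c₂.size c₂.row c₂.adj hw.symm (hmod.lt w)
    (T := (· ∈ f '' touched I Z)) fun i hi => ?_) fun σ₃ ⟨s₃, a₃⟩ => ?_
  · have := t₁ i hi
    rw [zero_add] at this
    rw [s₂ aTouch (by decide), this]
  have w₃ : σ₃ aNew 0 = f w := by rw [s₃ aNew (by decide), hw]
  refine Tri.seq (Tri.assign (Q := (· = _)) rfl) fun σ₄ e₄ => Tri.assign ⟨w, hwN, ?_⟩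
  simp only [Expr.eval, w₃] at e₄
  have s₄ : Same [aAlive] σ₃ σ₄ := by rw [e₄]; exact (Same.refl _ _).write (by decide) _ _
  have hs : Same [aTouch, aI, aNew, aAdj, aAlive] σ σ₄ :=
    (((s₁.mono (by decide)).trans (s₂.mono (by decide))).trans (s₃.mono (by decide))).trans
      (s₄.mono (by decide))
  have hs' := (hs.mono (S' := [aTouch, aI, aNew, aAdj, aAlive, aUsed]) (by decide)).write
    (a := aUsed) (by decide) 0 (σ₄ aUsed 0 + σ₄ aTmp 0)
  refine h.update (hs'.eqOn _ (by decide)) (fun i hi j hj => ?_) (fun i hi => ?_) ?_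
  · rw [State.write_other _ _ _ (by decide), s₄ aAdj (by decide), a₃ i hi j hj]
  · rw [State.write_other _ _ _ (by decide), e₄, State.write_cell, s₃ aAlive (by decide),
      c₂.alive i hi]
    split_ifs with hi'
    · exact (b2n_true (.inl hi')).symm
    · exact b2n_congr ⟨.inr, fun h => h.resolve_left hi'⟩
  · simp only [Expr.eval, State.write_self, hs aUsed (by decide), hs aTmp (by decide), h.used, hZ]

/-- Apply a preprocessing rule to the set found by the search. -/
def reduce : Prog :=
  .seq (.fillSum aTouch aI aCount aR aN
    (.and (.read aNbhd (.var aR)) (adjE (.var aI) (.var aR)))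
    (.and (.read aAlive (.var aI)) (.not (.le (.var aCount) (.const 0)))))
  (.seq (.sum aCount aI aN (.and (.read aNbhd (.var aI)) (.read aTouch (.var aI))))
  (.seq (.sum aKey aI aN (.read aNbhd (.var aI)))
  (.seq (.sum aTmp aI aN (.read aZ (.var aI)))
  (.seq (.fill aAlive aI aN (.const 0) (.and (.read aAlive (.var aI))
    (.and (.not (.read aZ (.var aI))) (.not (.read aNbhd (.var aI))))))
  -- The test says that the surplus is 1 and that no vertex of N(Z) has a neighbour in N(Z). In all
  -- other cases deleting the closed neighbourhood is sound.
  (.ite (.and (.le (.add (.var aN) (.const 1)) (.var aBest)) (.le (.var aCount) (.const 0)))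
    foldStep (.set aUsed (.add (.var aUsed) (.var aKey))))))))

/-- A state obtained by replacing the current instance by a smaller equivalent one. -/
def Progress (n k₀ : ℕ) (I : Inst) (St : List Pending) (σ : State) : Prop :=
  ∃ (J : Inst) (f : J.V → ℕ) (A : Set ℕ) (E : ℕ → ℕ → Prop) (u : ℕ), Models n J f A E ∧
    J.k = (k₀ : ℤ) - u ∧ Fintype.card J.V < Fintype.card I.V ∧ J.measure ≤ I.measure ∧
    (HasVertexCover J.G J.k ↔ HasVertexCover I.G I.k) ∧ Conf n k₀ A E u St σ

/-- Global minimality of the surplus takes the place of uniqueness of the all-1/2 optimum in the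
exchange argument, so no order of rules has to be respected. -/
theorem reduce_spec (hM : n ≤ M) (h : Conf n k₀ A E u St σ) (hmod : Models n I f A E)
    (hk : I.k = (k₀ : ℤ) - u) {Z : Set I.V} (hne : Z.Nonempty) (hZ : I.G.IsIndepSet Z)
    (hbest : (σ aBest 0 : ℤ) = n + surplus I.G Z) (hs1 : surplus I.G Z ≤ 1) (hZe : Enc n f aZ Z σ)
    (hNe : Enc n f aNbhd (nbhd I.G Z) σ)
    (hmin : ∀ Y : Set I.V, Y.Nonempty → I.G.IsIndepSet Y → surplus I.G Z ≤ surplus I.G Y) :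
    Tri M reduce σ (Progress n k₀ I St) := by
  have hmin' : ∀ Y ⊆ Z, Y.Nonempty → surplus I.G Z ≤ surplus I.G Y := fun Y hY h =>
    hmin Y h (Set.Pairwise.mono hY hZ)
  refine Tri.seq (Tri.fillSum (fun i j => b2n (j ∈ f '' nbhd I.G Z ∧ E i j))
    (fun i => b2n (i ∈ f '' {y | ∃ w ∈ nbhd I.G Z, I.G.Adj w y})) hM h.size (by decide)
    (fun i hi j hj τ hτ hI hR => ?_) fun i hi τ hτ hI hC => ?_) fun σ₁ ⟨s₁, t₁⟩ => ?_
  · have hm := h.toMem.congr (hτ.low (by decide))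
    simp only [Expr.eval, hI, hR, hτ aNbhd (by decide), hNe j hj, hm.adj_row hi hj, b2n_and]
  · have hm := h.toMem.congr (hτ.low (by decide))
    simp only [Expr.eval, hI, hm.alive i hi, hC, one_sub_sub_eq_b2n, b2n_and, one_sub_b2n]
    refine b2n_congr ?_
    rw [sum_b2n_eq_zero]
    constructor
    · rintro ⟨h1, h3⟩
      obtain ⟨y, rfl⟩ := (hmod.mem i).1 h1
      push Not at h3
      obtain ⟨_, -, ⟨z, hz, rfl⟩, hE⟩ := h3
      exact ⟨y, ⟨z, hz, ((hmod.adj y z).1 hE).symm⟩, rfl⟩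
    · rintro ⟨y, ⟨z, hz, hzy⟩, rfl⟩
      exact ⟨(hmod.mem _).2 ⟨y, rfl⟩, fun h =>
        h (f z) (hmod.lt z) ⟨⟨z, hz, rfl⟩, (hmod.adj y z).2 hzy.symm⟩⟩
  have c₁ := h.congr (s₁.low (by decide))
  have N₁ : ∀ i < n, σ₁ aNbhd i = b2n (i ∈ f '' nbhd I.G Z) := fun i hi => by
    rw [s₁ aNbhd (by decide), hNe i hi]
  refine Tri.seq (Tri.sum (fun i => b2n (i ∈ f '' nbhd I.G Z ∧
    i ∈ f '' {y | ∃ w ∈ nbhd I.G Z, I.G.Adj w y})) hM c₁.size (by decide)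
    fun i hi τ hτ hI => ?_) fun σ₂ ⟨s₂, k₂⟩ => ?_
  · simp only [Expr.eval, hI, hτ aNbhd (by decide), hτ aTouch (by decide), N₁ i hi, t₁ i hi,
      b2n_and]
  have c₂ := c₁.congr (s₂.low (by decide))
  refine Tri.seq (Tri.sum (fun i => b2n (i ∈ f '' nbhd I.G Z)) hM c₂.size (by decide)
    fun i hi τ hτ hI => ?_) fun σ₃ ⟨s₃, k₃⟩ => ?_
  · simp only [Expr.eval, hI, hτ aNbhd (by decide), s₂ aNbhd (by decide), N₁ i hi]
  have c₃ := c₂.congr (s₃.low (by decide))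
  have hs₃ : Same [aTouch, aI, aCount, aR, aKey] σ σ₃ :=
    ((s₁.mono (by decide)).trans (s₂.mono (by decide))).trans (s₃.mono (by decide))
  refine Tri.seq (Tri.sum (fun i => b2n (i ∈ f '' Z)) hM c₃.size (by decide)
    fun i hi τ hτ hI => ?_) fun σ₄ ⟨s₄, k₄⟩ => ?_
  · simp only [Expr.eval, hI, hτ aZ (by decide), hs₃ aZ (by decide), hZe i hi]
  have c₄ := c₃.congr (s₄.low (by decide))
  have hs₄ : Same [aTouch, aI, aCount, aR, aKey, aTmp] σ σ₄ :=
    (hs₃.mono (by decide)).trans (s₄.mono (by decide))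
  refine Tri.seq (Tri.fill 0 (fun i => b2n (i ∈ f '' (Z ∪ nbhd I.G Z)ᶜ)) hM c₄.size (by decide)
    (fun _ _ => rfl) fun i hi τ hτ hI ho => ?_) fun σ₅ ⟨s₅, a₅, _⟩ => ?_
  · simp only [Expr.eval, hI, ho i (.inr (by omega)), c₄.alive i hi, hτ aZ (by decide),
      hτ aNbhd (by decide), hs₄ aZ (by decide), hs₄ aNbhd (by decide), hZe i hi, hNe i hi,
      b2n_and, one_sub_b2n]
    refine b2n_congr ⟨?_, ?_⟩
    · rintro ⟨h1, h2, h3⟩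
      obtain ⟨y, rfl⟩ := (hmod.mem i).1 h1
      exact ⟨y, fun hy => hy.elim (fun hy => h2 ⟨y, hy, rfl⟩) fun hy => h3 ⟨y, hy, rfl⟩, rfl⟩
    · rintro ⟨y, hy, rfl⟩
      exact ⟨(hmod.mem _).2 ⟨y, rfl⟩, fun h => hy (.inl (hmod.image_iff.1 h)),
        fun h => hy (.inr (hmod.image_iff.1 h))⟩
  have c₅ : Conf n k₀ (f '' (Z ∪ nbhd I.G Z)ᶜ) E u St σ₅ := by
    refine c₄.update (s₅.eqOn _ (by decide)) (fun i hi j hj => ?_) (fun i hi => ?_) ?_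
    · rw [s₅ aAdj (by decide), c₄.adj i hi j hj]
    · simpa using a₅ i hi
    · rw [s₅ aUsed (by decide), c₄.used]
  have hcount : σ₅ aCount 0 ≤ 0 ↔ I.G.IsIndepSet (nbhd I.G Z) := by
    rw [s₅ aCount (by decide), s₄ aCount (by decide), s₃ aCount (by decide), k₂, sum_b2n_eq_zero]
    constructor
    · intro h1 x hx y hy _ hxy
      exact h1 (f y) (hmod.lt y) ⟨⟨y, hy, rfl⟩, y, ⟨x, hx, hxy⟩, rfl⟩
    · rintro h1 i - ⟨⟨y, hy, rfl⟩, h2⟩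
      obtain ⟨x, hx, hxy⟩ := hmod.image_iff.1 h2
      exact h1 hx hy hxy.ne hxy
  have hbest₅ : (σ₅ aBest 0 : ℤ) = n + surplus I.G Z := by
    rw [s₅ aBest (by decide), hs₄ aBest (by decide), hbest]
  have hN₅ : σ₅ aKey 0 = (nbhd I.G Z).ncard := by
    rw [s₅ aKey (by decide), s₄ aKey (by decide), k₃, sum_b2n_image hmod.inj hmod.lt]
  have hZ₅ : σ₅ aTmp 0 = Z.ncard := by
    rw [s₅ aTmp (by decide), k₄, sum_b2n_image hmod.inj hmod.lt]
  refine Tri.ite (fun he => ?_) fun he => ?_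
  · simp only [Expr.eval, one_sub_sub_eq_b2n, b2n_and, b2n_ne_zero, c₅.size] at he
    have hsur : surplus I.G Z = 1 := by omega
    have happ : I.FoldRuleApplies Z := ⟨⟨hne, hZ, hsur⟩, hcount.1 he.2⟩
    refine (foldStep_spec hM hmod c₅ (fun i hi => ?_) ?_ (fun i hi => ?_) hZ₅).mono ?_
    · rw [s₅ aNbhd (by decide), hs₄ aNbhd (by decide), hNe i hi]
    · refine Set.nonempty_of_ncard_ne_zero ?_
      unfold surplus at hsur
      omega
    · rw [s₅ aTouch (by decide), s₄ aTouch (by decide), s₃ aTouch (by decide),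
        s₂ aTouch (by decide), t₁ i hi]
    · rintro σ' ⟨w, hw, hc⟩
      refine ⟨I.fold Z, _, _, _, _, hmod.fold Z hw, ?_, I.card_fold_lt happ.1,
        I.measure_fold_le happ, I.hasVertexCover_fold happ hmin', hc⟩
      change I.k - Z.ncard = _
      rw [hk]; push_cast; ring
  · simp only [Expr.eval, one_sub_sub_eq_b2n, b2n_and, b2n_eq_zero, c₅.size] at he
    have hor : surplus I.G Z ≤ 0 ∨ ¬ I.G.IsIndepSet (nbhd I.G Z) := by
      by_contra hc
      push Not at hc
      exact he ⟨by omega, hcount.2 hc.2⟩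
    obtain ⟨z, hz⟩ := hne
    refine Tri.assign ⟨I.keep (Z ∪ nbhd I.G Z)ᶜ (nbhd I.G Z).ncard, _, _, _,
      u + (nbhd I.G Z).ncard, hmod.keep _ _, ?_, I.card_keep_lt _ (v := z) fun h => h (.inl hz),
      I.measure_keep_crown_le hZ, hasVertexCover_crown I.k hZ hs1 hmin' hor, ?_⟩
    · change I.k - (nbhd I.G Z).ncard = _
      rw [hk]; push_cast; ring
    · refine c₅.update (fun a ha => State.write_other _ _ _ ?_) (fun i hi j hj => ?_)
        (fun i hi => ?_) ?_
      · rintro rfl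
        revert ha; decide
      · rw [State.write_other _ _ _ (by decide), c₅.adj i hi j hj]
      · rw [State.write_other _ _ _ (by decide), c₅.alive i hi]
      · simp only [Expr.eval, State.write_self, c₅.used, hN₅]

/-- Branch on a vertex: put the first subinstance on the stack and continue with the second. -/
def branch : Prog :=
  .seq (.pick aV aI aN (.read aAlive (.var aI)))
  (.seq (.assign aAlive (.var aV) (.const 0))
  (.seq (.set aUsed (.add (.var aUsed) (.const 1)))
  (.seq push
  (.seq (.sum aCount aI aN (.and (.read aAlive (.var aI)) (adjE (.var aV) (.var aI))))
  (.seq (.fill aAlive aI aN (.const 0)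
    (.and (.read aAlive (.var aI)) (.not (adjE (.var aV) (.var aI)))))
    -- The subtraction undoes the unit spent on the chosen vertex in the instance put on the stack.
    (.set aUsed (.sub (.add (.var aUsed) (.var aCount)) (.const 1))))))))

theorem branch_spec (hM : (n + 2) ^ 2 ≤ M) (h : Conf n k₀ A E u St σ) (hmod : Models n I f A E)
    (hne : Nonempty I.V) :
    Tri M branch σ fun σ' => ∃ x : I.V, Conf n k₀ (f '' ({x} ∪ nbhd I.G {x})ᶜ) E
      (u + (nbhd I.G {x}).ncard) ((f '' {x}ᶜ, E, u + 1) :: St) σ' := by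
  have hM' : n ≤ M := by nlinarith
  obtain ⟨x₀⟩ := hne
  refine Tri.seq (Tri.pick (· ∈ A) hM' h.size (by decide)
    ⟨f x₀, hmod.lt x₀, (hmod.mem _).2 ⟨x₀, rfl⟩⟩ fun i hi τ hτ hI => ?_)
    fun σ₁ ⟨s₁, hlt, hx⟩ => ?_
  · simp only [Expr.eval, hI, hτ aAlive (by decide), h.alive i hi]
  obtain ⟨x, hx⟩ := (hmod.mem _).1 hx
  have c₁ := h.congr (s₁.low (by decide))
  refine Tri.seq (Tri.assign (Q := (· = _)) rfl) fun σ₂ e₂ =>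
    Tri.seq (Tri.assign (Q := (· = _)) rfl) fun σ₃ e₃ => ?_
  simp only [Expr.eval, ← hx] at e₂
  have s₂ : Same [aAlive] σ₁ σ₂ := by rw [e₂]; exact (Same.refl _ _).write (by decide) _ _
  simp only [Expr.eval, s₂ aUsed (by decide), c₁.used] at e₃
  have s₃ : Same [aAlive, aUsed] σ₁ σ₃ := by
    rw [e₃]; exact (s₂.mono (by decide)).write (by decide) _ _
  have c₃ : Conf n k₀ (f '' {x}ᶜ) E (u + 1) St σ₃ := by
    refine c₁.update (s₃.eqOn _ (by decide)) (fun i hi j hj => ?_) (fun i hi => ?_) ?_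
    · rw [s₃ aAdj (by decide), c₁.adj i hi j hj]
    · rw [e₃, State.write_other _ _ _ (by decide), e₂, State.write_cell, c₁.alive i hi]
      split_ifs with hix
      · rw [b2n_false]
        rintro ⟨y, hy, hyi⟩
        exact hy (hmod.inj (hyi.trans hix))
      · refine b2n_congr ⟨fun hi => ?_, ?_⟩
        · obtain ⟨y, rfl⟩ := (hmod.mem i).1 hi
          exact ⟨y, fun hy => hix (by rw [show y = x from hy]), rfl⟩
        · rintro ⟨y, -, rfl⟩
          exact (hmod.mem _).2 ⟨y, rfl⟩
    · rw [e₃, State.write_self]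
  refine Tri.seq (push_spec hM c₃) fun σ₄ ⟨s₄, c₄⟩ => ?_
  have v₄ : σ₄ aV 0 = f x := by rw [s₄ aV (by decide), s₃ aV (by decide), hx]
  refine Tri.seq (Tri.sum (fun i => b2n (i ∈ f '' nbhd I.G {x})) hM' c₄.size (by decide)
    fun i hi τ hτ hI => ?_) fun σ₅ ⟨s₅, k₅⟩ => ?_
  · have hm := c₄.toMem.congr (hτ.low (by decide))
    simp only [Expr.eval, hI, hm.alive i hi, hτ aV (by decide), v₄, hm.adj_row (hmod.lt x) hi,
      b2n_and]
    refine b2n_congr ⟨?_, ?_⟩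
    · rintro ⟨⟨y, hy, rfl⟩, hE⟩
      exact ⟨y, mem_nbhd_singleton.2 ((hmod.adj x y).1 hE), rfl⟩
    · rintro ⟨y, hy, rfl⟩
      exact ⟨⟨y, hy.1, rfl⟩, (hmod.adj x y).2 (mem_nbhd_singleton.1 hy)⟩
  have c₅ := c₄.congr (s₅.low (by decide))
  have v₅ : σ₅ aV 0 = f x := by rw [s₅ aV (by decide), v₄]
  refine Tri.seq (Tri.fill 0 (fun i => b2n (i ∈ f '' ({x} ∪ nbhd I.G {x})ᶜ)) hM' c₅.size
    (by decide) (fun _ _ => rfl) fun i hi τ hτ hI ho => ?_) fun σ₆ ⟨s₆, a₆, _⟩ =>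
    Tri.assign ⟨x, ?_⟩
  · simp only [Expr.eval, hI, ho i (.inr (by omega)), c₅.alive i hi, hτ aV (by decide), v₅,
      hτ aAdj (by decide), hτ aRow (by decide), c₅.adj_row (hmod.lt x) hi, b2n_and, one_sub_b2n]
    refine b2n_congr ⟨?_, ?_⟩
    · rintro ⟨⟨y, hy, rfl⟩, hE⟩
      exact ⟨y, fun h' => h'.elim hy fun h' =>
        hE ((hmod.adj x y).2 (mem_nbhd_singleton.1 h')), rfl⟩
    · rintro ⟨y, hy, rfl⟩
      exact ⟨⟨y, fun h' => hy (.inl h'), rfl⟩, fun h' =>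
        hy (.inr (mem_nbhd_singleton.2 ((hmod.adj x y).1 h')))⟩
  · have s₇ := (s₆.mono (S' := [aAlive, aI, aUsed]) (by decide)).write (a := aUsed) (by decide) 0
      (σ₆ aUsed 0 + σ₆ aCount 0 - 1)
    refine c₅.update (s₇.eqOn _ (by decide)) (fun i hi j hj => ?_) (fun i hi => ?_) ?_
    · rw [State.write_other _ _ _ (by decide), s₆ aAdj (by decide), c₅.adj i hi j hj]
    · have := a₆ i hi
      rw [zero_add] at this
      rw [State.write_other _ _ _ (by decide), this]
    · simp only [Expr.eval, State.write_self, s₆ aUsed (by decide), s₆ aCount (by decide), c₅.used,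
        k₅, sum_b2n_image hmod.inj hmod.lt]
      omega

end RAM


namespace RAM

variable {M n k₀ u : ℕ} {A : Set ℕ} {E : ℕ → ℕ → Prop} {σ : State} {I : Inst} {f : I.V → ℕ}
  {St : List Pending}

/-! ### The main loop -/

/-- Process the current instance: reduce it, accept it, reject it or branch. -/
def step : Prog :=
  .seq search (.ite (.le (.add (.var aN) (.const 2)) (.var aBest))
    (.seq (.sum aCount aI aN (.read aAlive (.var aI)))
      -- On a reduced instance vc* = |V|/2, so a nonnegative measure means |V| + 2u ≤ 2k₀. Recording
      -- the used budget `u` instead of the remaining one avoids negative numbers.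
      (.ite (.le (.add (.var aCount) (.add (.var aUsed) (.var aUsed)))
          (.add (.var aK) (.var aK)))
        (.ite (.le (.var aCount) (.const 0))
          (.seq (.set aAnswer (.const 1)) (.set aActive (.const 0))) branch)
        pop))
    reduce)

theorem Found.reduced (h : Found n I f n σ) (hmod : Models n I f A E) (hb : n + 2 ≤ σ aBest 0) :
    I.Reduced := by
  rw [Inst.reduced_iff]
  rintro Y ⟨x, hx⟩ hY
  rcases h with ⟨-, h⟩ | ⟨Z, -, -, h1, h2, -⟩
  · exact h x (hmod.lt x) Y hx hY
  · omega

/-- The possible results of processing an instance. -/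
inductive Outcome (n k₀ : ℕ) (I : Inst) (E : ℕ → ℕ → Prop) (f : I.V → ℕ) (u : ℕ)
    (St : List Pending) (σ : State) : Prop
  | reduced (h : Progress n k₀ I St σ)
  | rejected (hμ : I.measure < 0) (h : Popped n k₀ St σ)
  | accepted (hc : HasVertexCover I.G I.k) (h : σ aActive 0 = 0) (h' : σ aAnswer 0 = 1)
  | branched (hμ : 0 ≤ I.measure) (hr : I.Reduced) (x : I.V)
      (h : Conf n k₀ (f '' ({x} ∪ nbhd I.G {x})ᶜ) E (u + (nbhd I.G {x}).ncard)
        ((f '' {x}ᶜ, E, u + 1) :: St) σ)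

theorem step_spec (hM : (n + 2) ^ 2 ≤ M) (h : Conf n k₀ A E u St σ) (hmod : Models n I f A E)
    (hk : I.k = (k₀ : ℤ) - u) : Tri M step σ (Outcome n k₀ I E f u St) := by
  have hM' : n ≤ M := by nlinarith
  refine Tri.seq (search_spec hM h.toMem hmod) fun σ₁ ⟨s₁, hf⟩ => ?_
  have c₁ := h.congr (s₁.low (by decide))
  refine Tri.ite (fun he => ?_) fun he => ?_
  · simp only [Expr.eval, one_sub_sub_eq_b2n, b2n_ne_zero, c₁.size] at he
    have hr := hf.reduced hmod he
    have hv := Inst.vcStar_of_reduced hr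
    refine Tri.seq (Tri.sum (fun i => b2n (i ∈ f '' Set.univ)) hM' c₁.size (by decide)
      fun i hi τ hτ hI => ?_) fun σ₂ ⟨s₂, k₂⟩ => ?_
    · simp only [Expr.eval, hI, hτ aAlive (by decide), c₁.alive i hi]
      exact b2n_congr (by rw [hmod.mem, Set.image_univ, Set.mem_range])
    rw [sum_b2n_image hmod.inj hmod.lt, Set.ncard_univ, Nat.card_eq_fintype_card] at k₂
    have c₂ := c₁.congr (s₂.low (by decide))
    have hk' : (I.k : ℝ) = k₀ - u := by rw [hk]; push_cast; ring
    refine Tri.ite (fun he' => ?_) fun he' => ?_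
    · simp only [Expr.eval, one_sub_sub_eq_b2n, b2n_ne_zero, c₂.used, c₂.budget, k₂] at he'
      have hμ : 0 ≤ I.measure := by
        have : (Fintype.card I.V + (u + u) : ℝ) ≤ k₀ + k₀ := by exact_mod_cast he'
        rw [Inst.measure, hv, hk']
        linarith
      refine Tri.ite (fun he'' => ?_) fun he'' => ?_
      · simp only [Expr.eval, one_sub_sub_eq_b2n, b2n_ne_zero, k₂, Nat.le_zero] at he''
        have hV : IsEmpty I.V := Fintype.card_eq_zero_iff.1 he''
        refine Tri.seq (Tri.assign (Q := fun τ => τ aAnswer 0 = 1) (by simp [Expr.eval]))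
          fun σ₃ h₃ => Tri.assign (.accepted (Inst.hasVertexCover_of_isEmpty hV
            (Inst.k_nonneg_of_measure_nonneg hV hμ)) (by simp [Expr.eval]) ?_)
        rw [State.write_other _ _ _ (by decide), h₃]
      · simp only [Expr.eval, one_sub_sub_eq_b2n, b2n_eq_zero, k₂, not_le] at he''
        exact (branch_spec hM c₂ hmod (Fintype.card_pos_iff.1 he'')).mono fun σ' ⟨x, hx⟩ =>
          .branched hμ hr x hx
    · simp only [Expr.eval, one_sub_sub_eq_b2n, b2n_eq_zero, c₂.used, c₂.budget, k₂, not_le] at he'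
      refine (pop_spec hM c₂).mono fun σ' h' => .rejected ?_ h'
      have : (k₀ + k₀ : ℝ) < Fintype.card I.V + (u + u) := by exact_mod_cast he'
      rw [Inst.measure, hv, hk']
      linarith
  · simp only [Expr.eval, one_sub_sub_eq_b2n, b2n_eq_zero, c₁.size] at he
    rcases hf with ⟨hb, -⟩ | ⟨Z, hne, hZ, hb, hs, hZe, hNe, hmin⟩
    · exact absurd hb.ge he
    · refine (reduce_spec hM' c₁ hmod hk hne hZ hb hs hZe hNe ?_).mono fun σ' h' => .reduced h'
      rintro Y ⟨x, hx⟩ hY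
      exact hmin x (hmod.lt x) Y hx hY

/-- Process instances as long as the search goes on. -/
def mainLoop : Prog := .loop (.var aActive) step

/-- Started in `σ`, the main loop halts after at most `T` steps in a state satisfying `Q`. -/
def LoopTri (σ : State) (T : ℕ) (Q : State → Prop) : Prop :=
  ∃ t σ', Exec mainLoop σ t σ' ∧ t ≤ T ∧ Q σ'

theorem LoopTri.mono {T T' : ℕ} {Q : State → Prop} (h : LoopTri σ T Q) (hT : T ≤ T') :
    LoopTri σ T' Q := by
  obtain ⟨t, σ', h1, h2, h3⟩ := h
  exact ⟨t, σ', h1, h2.trans hT, h3⟩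

/-- The main loop may run exponentially often, so it is not covered by `Tri.loop` with its
polynomial bound; its iterations are counted one by one. The 3 is the cost of the loop test. -/
theorem LoopTri.step {T B : ℕ} (hB : step.time M + 3 = B) {R Q : State → Prop}
    (ha : σ aActive 0 = 1) (h : Tri M step σ R) (h' : ∀ σ', R σ' → LoopTri σ' T Q) :
    LoopTri σ (B + T) Q := by
  obtain ⟨t₁, σ₁, e₁, l₁, r₁⟩ := h
  obtain ⟨t₂, σ₂, e₂, l₂, r₂⟩ := h' _ r₁
  refine ⟨_, _, .loopTrue _ _ _ _ _ _ _ (by simp [Expr.eval, ha]) e₁ e₂, ?_, r₂⟩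
  simp only [Expr.cost]
  omega

theorem LoopTri.halt {Q : State → Prop} (ha : σ aActive 0 = 0) (h : Q σ) : LoopTri σ 3 Q :=
  ⟨_, _, .loopFalse _ _ _ (by simp [Expr.eval, ha]), by simp [Expr.cost], h⟩

/-- A bound on the number of iterations of the main loop. -/
noncomputable def iterations (I : Inst) : ℕ := ⌊treeBound (Fintype.card I.V) I.measure⌋₊

theorem treeBound_nonneg (n : ℕ) (μ : ℝ) : 0 ≤ treeBound n μ :=
  le_trans (by positivity) (succ_le_treeBound n μ)

theorem iterations_pos (I : Inst) : 1 ≤ iterations I := by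
  refine Nat.le_floor ?_
  have := succ_le_treeBound (Fintype.card I.V) I.measure
  have h0 : (0 : ℝ) ≤ Fintype.card I.V := Nat.cast_nonneg _
  push_cast
  linarith

theorem iterations_reduce {I J : Inst} (hc : Fintype.card J.V < Fintype.card I.V)
    (hμ : J.measure ≤ I.measure) : iterations J + 1 ≤ iterations I := by
  refine Nat.le_floor ?_
  push_cast
  exact (add_le_add (Nat.floor_le (treeBound_nonneg _ _)) le_rfl).trans (treeBound_reduce hc hμ)

theorem iterations_branch {I : Inst} (x : I.V) (hμ : 0 ≤ I.measure) (hr : I.Reduced) :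
    iterations (I.take x) + iterations (I.discard x) + 1 ≤ iterations I := by
  refine Nat.le_floor ?_
  push_cast
  exact (add_le_add (add_le_add (Nat.floor_le (treeBound_nonneg _ _))
    (Nat.floor_le (treeBound_nonneg _ _))) le_rfl).trans
    (treeBound_branch hμ (I.card_take_lt x) (I.card_discard_lt x)
      (I.measure_take_le x hr) (I.measure_discard_le x hr))

/-- The main loop decides the current instance: it stops if there is a vertex cover, and otherwise
goes on with the next instance on the stack. -/
theorem mainLoop_spec (hM : (n + 2) ^ 2 ≤ M) (N : ℕ) :
    ∀ (I : Inst) (f : I.V → ℕ) (A : Set ℕ) (E : ℕ → ℕ → Prop) (u : ℕ) (St : List Pending)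
      (σ : State), Fintype.card I.V < N → Models n I f A E → I.k = (k₀ : ℤ) - u →
      Conf n k₀ A E u St σ →
      (HasVertexCover I.G I.k →
        LoopTri σ (iterations I * (step.time M + 3) + 3) fun σ' => σ' aAnswer 0 = 1) ∧
      -- What happens after a failure enters as an arbitrary continuation of cost `T`; for the
      -- branch explored first, this continuation is the exploration of the branch on the stack.
      (¬ HasVertexCover I.G I.k → ∀ (T : ℕ) (Q : State → Prop),
        (∀ σ', Popped n k₀ St σ' → LoopTri σ' T Q) →
        LoopTri σ (iterations I * (step.time M + 3) + T) Q) := by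
  generalize hB : step.time M + 3 = B
  induction N with
  | zero => intro I f A E u St σ h; omega
  | succ N ih =>
    intro I f A E u St σ hN hmod hk h
    obtain ⟨m, hm⟩ := Nat.exists_eq_succ_of_ne_zero
      (Nat.one_le_iff_ne_zero.1 (iterations_pos I))
    have hstep := step_spec hM h hmod hk
    have hmB : ∀ T, iterations I * B + T = B + (m * B + T) := fun T => by
      rw [hm, Nat.succ_mul]; omega
    have hle : ∀ {a : ℕ} (T : ℕ), a + 1 ≤ iterations I → a * B + T ≤ m * B + T := fun {a} T ha =>
      Nat.add_le_add_right (Nat.mul_le_mul_right B (show a ≤ m by omega)) T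
    have htake : ∀ x, Models n (I.take x) (fun y => f y.1) (f '' {x}ᶜ) E ∧
        (I.take x).k = (k₀ : ℤ) - (u + 1 : ℕ) := fun x => by
      refine ⟨hmod.keep _ _, ?_⟩
      change I.k - (1 : ℕ) = _
      rw [hk]; push_cast; ring
    have hdisc : ∀ x, Models n (I.discard x) (fun y => f y.1) (f '' ({x} ∪ nbhd I.G {x})ᶜ) E ∧
        (I.discard x).k = (k₀ : ℤ) - (u + (nbhd I.G {x}).ncard : ℕ) := fun x => by
      refine ⟨hmod.keep _ _, ?_⟩
      change I.k - (nbhd I.G {x}).ncard = _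
      rw [hk]; push_cast; ring
    have hbr : ∀ {a b : ℕ} (T : ℕ), b + a + 1 ≤ iterations I →
        a * B + (b * B + T) ≤ m * B + T := fun {a b} T hab => by
      have h1 : (a + b) * B ≤ m * B := Nat.mul_le_mul_right B (by omega)
      rw [add_mul] at h1
      omega
    constructor
    · intro hc
      rw [hmB]
      refine LoopTri.step hB h.active hstep fun σ' ho => ?_
      rcases ho with ⟨J, g, A', E', u', h1, h2, h3, h4, h5, h6⟩ | ⟨hμ, -⟩ | ⟨-, h1, h2⟩ |
        ⟨hμ, hr, x, h1⟩
      · exact ((ih J g A' E' u' St σ' (by omega) h1 h2 h6).1 (h5.2 hc)).mono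
          (hle 3 (iterations_reduce h3 h4))
      · exact absurd hc (Inst.not_hasVertexCover_of_measure_neg hμ)
      · exact (LoopTri.halt h1 h2).mono (by omega)
      · have hi := iterations_branch x hμ hr
        have hD := ih (I.discard x) _ _ E _ _ σ' (by have := I.card_discard_lt x; omega)
          (hdisc x).1 (hdisc x).2 h1
        by_cases hd : HasVertexCover (I.discard x).G (I.discard x).k
        · exact (hD.1 hd).mono (hle 3 (by omega))
        · have ht := ((I.hasVertexCover_branch x).1 hc).resolve_right hd
          -- The discarding branch is explored first; when it fails, the instance popped is the one
          -- in which `x` was taken.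
          refine (hD.2 hd _ _ fun σ'' hp => ?_).mono (hbr 3 hi)
          exact (ih (I.take x) _ _ E _ _ σ'' (by have := I.card_take_lt x; omega)
            (htake x).1 (htake x).2 hp).1 ht
    · intro hc T Q hQ
      rw [hmB]
      refine LoopTri.step hB h.active hstep fun σ' ho => ?_
      rcases ho with ⟨J, g, A', E', u', h1, h2, h3, h4, h5, h6⟩ | ⟨-, h1⟩ | ⟨h1, -, -⟩ |
        ⟨hμ, hr, x, h1⟩
      · exact ((ih J g A' E' u' St σ' (by omega) h1 h2 h6).2 (fun h => hc (h5.1 h)) T Q hQ).mono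
          (hle T (iterations_reduce h3 h4))
      · exact (hQ σ' h1).mono (by omega)
      · exact absurd h1 hc
      · have hi := iterations_branch x hμ hr
        have hD := ih (I.discard x) _ _ E _ _ σ' (by have := I.card_discard_lt x; omega)
          (hdisc x).1 (hdisc x).2 h1
        refine (hD.2 (fun h => hc ((I.hasVertexCover_branch x).2 (.inr h))) _ _
          fun σ'' hp => ?_).mono (hbr T hi)
        exact (ih (I.take x) _ _ E _ _ σ'' (by have := I.card_take_lt x; omega)
          (htake x).1 (htake x).2 hp).2 (fun h => hc ((I.hasVertexCover_branch x).2 (.inl h))) T Q hQ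

/-! ### The complete program -/

/-- Prepare the memory for the main loop. -/
def setup : Prog :=
  -- Row offsets are accumulated by addition, for want of multiplication; the accumulator ends up
  -- holding n².
  .seq (.count aI aN (.seq (.assign aRow (.var aI) (.var aSq))
    (.set aSq (.add (.var aSq) (.var aN)))))
  (.seq (.fill aAlive aI aN (.const 0) (.const 1)) (.set aActive (.const 1)))

theorem input_other {n : ℕ} (G : SimpleGraph (Fin n)) (k : ℕ) {a : ℕ} (ha : 2 < a) (i : ℕ) :
    input G k a i = 0 := by
  unfold input
  rw [if_neg (by omega), if_neg (by omega), if_neg (by omega)]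

theorem input_adj {n : ℕ} (G : SimpleGraph (Fin n)) (k : ℕ) {i j : ℕ} (hj : j < n) :
    input G k aAdj (i * n + j) = b2n (∃ u v : Fin n, u = i ∧ v = j ∧ G.Adj u v) := by
  unfold input
  rw [if_neg (by omega), if_neg (by omega)]
  split_ifs with h
  · obtain ⟨-, u, v, huv, hadj⟩ := h
    obtain ⟨h1, h2⟩ := (index_inj hj v.2).1 huv
    exact (b2n_true ⟨u, v, h1.symm, h2.symm, hadj⟩).symm
  · refine (b2n_false fun ⟨u, v, hu, hv, hadj⟩ => h ⟨rfl, u, v, ?_, hadj⟩).symm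
    rw [hu, hv]

theorem setup_spec {n : ℕ} (hM : n ≤ M) (G : SimpleGraph (Fin n)) (k : ℕ) :
    Tri M setup (input G k) (Conf n k {i | i < n}
      (fun i j => ∃ u v : Fin n, u = i ∧ v = j ∧ G.Adj u v) 0 []) := by
  have hin : input G k aN 0 = n := by simp [input]
  refine Tri.seq (Tri.count (m := n) (Inv := fun j τ => Same [aI, aRow, aSq] (input G k) τ ∧
    τ aSq 0 = j * n ∧ ∀ i < j, τ aRow i = i * n) hM ?_ ?_ ?_ ?_) fun σ₁ ⟨s₁, q₁, r₁⟩ => ?_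
  · rintro j τ ⟨hτ, -⟩
    rw [hτ aN (by decide), hin]
  · rintro j τ x ⟨h1, h2⟩
    rw [State.write_other _ _ _ (show aSq ≠ aI by decide),
      State.write_other _ _ _ (show aRow ≠ aI by decide)]
    exact ⟨h1.write (by decide) _ _, h2⟩
  · exact ⟨Same.refl _ _, by rw [input_other G k (by decide), zero_mul], by simp⟩
  · rintro j hj τ ⟨h1, h2, h3⟩ hjI
    refine Tri.seq (Tri.assign (Q := (· = _)) rfl) fun τ' hτ' => Tri.assign ?_
    have e1 : τ aN 0 = n := by rw [h1 aN (by decide), hin]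
    subst hτ'
    simp only [Expr.eval, State.write_self, State.write_other _ _ _ (show aSq ≠ aRow by decide),
      State.write_other _ _ _ (show aN ≠ aRow by decide),
      State.write_other _ _ _ (show aRow ≠ aSq by decide),
      State.write_other _ _ _ (show aI ≠ aSq by decide),
      State.write_other _ _ _ (show aI ≠ aRow by decide), State.write_cell, hjI, h2, e1]
    refine ⟨⟨(h1.write (by decide) _ _).write (by decide) _ _, by simp [Nat.succ_mul],
      fun i hi => ?_⟩, trivial⟩
    split_ifs with h
    · rw [h]
    · exact h3 i (by omega)
  have n₁ : σ₁ aN 0 = n := by rw [s₁ aN (by decide), hin]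
  refine Tri.seq (Tri.fill 0 (fun _ => 1) hM n₁ (by decide) (fun _ _ => rfl)
    fun _ _ _ _ _ _ => rfl) fun σ₂ ⟨s₂, a₂, _⟩ => Tri.assign ?_
  have hs := (((s₁.mono (S' := [aI, aRow, aSq, aAlive, aActive]) (by decide)).trans
    (s₂.mono (by decide)))).write (a := aActive) (by decide) 0 1
  simp only [Expr.eval]
  refine ⟨⟨?_, ?_, fun i hi => ?_, ?_, fun i hi j hj => ?_, fun i hi => ?_, ?_⟩, ?_, ?_, ?_⟩
  · rw [hs aN (by decide), hin]
  · rw [hs aK (by decide)]; simp [input]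
  · rw [State.write_other _ _ _ (by decide), s₂ aRow (by decide), r₁ i hi]
  · rw [State.write_other _ _ _ (by decide), s₂ aSq (by decide), q₁]
  · rw [hs aAdj (by decide), input_adj G k hj]
  · have := a₂ i hi
    rw [zero_add] at this
    rw [State.write_other _ _ _ (by decide), this]
    exact (b2n_true hi).symm
  · rw [hs aUsed (by decide), input_other G k (by decide)]
  · change _ = 0
    rw [hs aTop (by decide), input_other G k (by decide)]
  · exact State.write_self _ _ _ _
  · rw [hs aAnswer (by decide), input_other G k (by decide)]

/-- A program for Vertex Cover above LP. -/
def vertexCover : Prog := .seq setup (.seq mainLoop (.set aN (.var aAnswer)))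

/-- The additive 7 consists of the last, failing loop test (3) and the final assignment (4). -/
theorem vertexCover_spec (n : ℕ) (G : SimpleGraph (Fin n)) (k : ℕ) :
    ∃ (t : ℕ) (σ : State), Exec vertexCover (input G k) t σ ∧
      (HasVertexCover G k → σ 0 0 = 1) ∧ (¬ HasVertexCover G k → σ 0 0 = 0) ∧
      t ≤ setup.time ((n + 2) ^ 2) + iterations ⟨Fin n, inferInstance, G, k⟩ *
        (step.time ((n + 2) ^ 2) + 3) + 7 := by
  set I : Inst := ⟨Fin n, inferInstance, G, k⟩ with hI
  obtain ⟨t₁, σ₁, e₁, l₁, h₁⟩ := setup_spec (M := (n + 2) ^ 2) (by nlinarith) G k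
  have hmod : Models n I (fun x : Fin n => (x : ℕ)) {i | i < n}
      (fun i j => ∃ u v : Fin n, u = i ∧ v = j ∧ G.Adj u v) :=
    ⟨Fin.val_injective, fun x => x.2, fun i => ⟨fun h => ⟨⟨i, h⟩, rfl⟩, fun ⟨x, hx⟩ => hx ▸ x.2⟩,
      fun x y => ⟨fun ⟨a, b, ha, hb, hab⟩ => by
        rwa [Fin.ext ha, Fin.ext hb] at hab, fun h => ⟨x, y, rfl, rfl, h⟩⟩⟩
  obtain ⟨hyes, hno⟩ := mainLoop_spec le_rfl _ I _ _ _ 0 [] σ₁ (Nat.lt_succ_self _) hmod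
    (by simp [hI]) h₁
  have hloop : LoopTri σ₁ (iterations I * (step.time ((n + 2) ^ 2) + 3) + 3) fun σ' =>
      (HasVertexCover G k → σ' aAnswer 0 = 1) ∧ (¬ HasVertexCover G k → σ' aAnswer 0 = 0) := by
    by_cases hc : HasVertexCover G k
    · obtain ⟨t, σ', h1, h2, h3⟩ := hyes hc
      exact ⟨t, σ', h1, h2, fun _ => h3, fun h => absurd hc h⟩
    · exact hno hc 3 _ fun σ' hp => LoopTri.halt hp.1 ⟨fun h => absurd h hc, fun _ => hp.2⟩
  obtain ⟨t₂, σ₂, e₂, l₂, h₂, h₂'⟩ := hloop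
  refine ⟨_, _, .seq _ _ _ _ _ _ _ e₁ (.seq _ _ _ _ _ _ _ e₂ (.assign _ _ _ _)), ?_, ?_, ?_⟩
  · simpa [Expr.eval] using h₂
  · simpa [Expr.eval] using h₂'
  · simp only [Expr.cost]
    omega

/-- As `y` is at least 1, it absorbs the additive terms: the time is at most (2D + 10)y. -/
theorem le_mul_of_le_add_mul_add {t D N y p K : ℝ} (h : t ≤ D + N * (D + 3) + 7) (hD : 0 ≤ D)
    (hK : D ≤ K * p) (hN : N ≤ y) (hy : 1 ≤ y) (hp : 1 ≤ p) : t ≤ (2 * K + 10) * p * y := by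
  have h1 : N * (D + 3) ≤ y * (D + 3) := mul_le_mul_of_nonneg_right hN (by linarith)
  have h2 : D + 7 ≤ y * (D + 7) := le_mul_of_one_le_left (by linarith) hy
  have h3 : (2 * D + 10) * y ≤ (2 * K + 10) * p * y :=
    mul_le_mul_of_nonneg_right (by linarith) (by linarith)
  linarith

theorem vertexCover_time : ∃ C c : ℕ, ∀ (n : ℕ) (G : SimpleGraph (Fin n)) (k t : ℕ),
    t ≤ setup.time ((n + 2) ^ 2) + iterations ⟨Fin n, inferInstance, G, k⟩ *
      (step.time ((n + 2) ^ 2) + 3) + 7 →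
    (t : ℝ) ≤ C * (n + 1 : ℝ) ^ c * (2.6181 : ℝ) ^ max ((k : ℝ) - vcStar G) 0 := by
  obtain ⟨C, c, hC⟩ := (Prog.seq setup step).time_le
  -- The loop bound (n + 2)² plus one is at most 5(n + 1)², which gives 5^c and the exponent 2c; the
  -- further 2 comes from `treeBound_le`.
  refine ⟨2 * (C * 5 ^ c) + 10, 2 * c + 2, fun n G k t ht => ?_⟩
  set I : Inst := ⟨Fin n, inferInstance, G, k⟩
  have h1 : setup.time ((n + 2) ^ 2) + step.time ((n + 2) ^ 2) ≤
      C * 5 ^ c * (n + 1) ^ (2 * c) := by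
    refine (hC ((n + 2) ^ 2)).trans ?_
    have : (n + 2) ^ 2 + 1 ≤ 5 * (n + 1) ^ 2 := by
      have : 5 * (n + 1) ^ 2 = (n + 2) ^ 2 + 1 + (4 * n ^ 2 + 6 * n) := by ring
      omega
    calc C * ((n + 2) ^ 2 + 1) ^ c ≤ C * (5 * (n + 1) ^ 2) ^ c :=
          Nat.mul_le_mul_left _ (Nat.pow_le_pow_left this c)
      _ = _ := by rw [mul_pow, ← pow_mul, mul_assoc]
  generalize setup.time ((n + 2) ^ 2) = a at h1 ht
  generalize step.time ((n + 2) ^ 2) = b at h1 ht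
  have h1' : ((a + b : ℕ) : ℝ) ≤ C * 5 ^ c * (n + 1 : ℝ) ^ (2 * c) := by exact_mod_cast h1
  have h2 : t ≤ (a + b) + iterations I * ((a + b) + 3) + 7 := by
    have : iterations I * (b + 3) ≤ iterations I * ((a + b) + 3) :=
      Nat.mul_le_mul_left _ (by omega)
    omega
  have h2' : (t : ℝ) ≤ (a + b : ℕ) + iterations I * ((a + b : ℕ) + 3) + 7 := by exact_mod_cast h2
  set x := (2.6181 : ℝ) ^ max ((k : ℝ) - vcStar G) 0 with hx
  have hx1 : 1 ≤ x := one_le_base_rpow (le_max_right _ _)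
  have h3 : (iterations I : ℝ) ≤ (n + 1 : ℝ) ^ 2 * x := by
    refine (Nat.floor_le (treeBound_nonneg _ _)).trans ((treeBound_le _ _).trans (le_of_eq ?_))
    have e1 : Fintype.card I.V = n := Fintype.card_fin n
    have e2 : I.measure = (k : ℝ) - vcStar G := by
      change ((k : ℤ) : ℝ) - vcStar G = _
      rw [Int.cast_natCast]
    rw [e1, e2]
  have hn1 : (1 : ℝ) ≤ n + 1 := by linarith [(Nat.cast_nonneg n : (0 : ℝ) ≤ n)]
  refine (le_mul_of_le_add_mul_add h2' (Nat.cast_nonneg _) h1' h3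
    (one_le_mul_of_one_le_of_one_le (one_le_pow₀ hn1) hx1) (one_le_pow₀ hn1)).trans (le_of_eq ?_)
  rw [pow_add]
  push_cast
  ring

end RAM

end VCLP

/-! ### The main theorem -/

theorem mainTheorem2 :
    -- a program decides the problem within the claimed time
    (∃ (P : VCLP.RAM.Prog) (C c : ℕ), ∀ (n : ℕ) (G : SimpleGraph (Fin n)) (k : ℕ),
      ∃ (t : ℕ) (σ : VCLP.RAM.State), VCLP.RAM.Exec P (VCLP.RAM.input G k) t σ ∧
        (VCLP.HasVertexCover G k → σ 0 0 = 1) ∧ (¬ VCLP.HasVertexCover G k → σ 0 0 = 0) ∧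
        (t : ℝ) ≤ C * (n + 1 : ℝ) ^ c * (2.6181 : ℝ) ^ max ((k : ℝ) - VCLP.vcStar G) 0) ∧
    -- the branching algorithm has a run on every instance; whatever choices are made, every run
    -- is correct and has a search tree of the claimed size
    (∀ I : VCLP.Inst, ∃ (b : Bool) (t : ℕ), I.Run b t) ∧
    (∃ C c : ℕ, ∀ (I : VCLP.Inst) (b : Bool) (t : ℕ), I.Run b t →
      (b = true ↔ VCLP.HasVertexCover I.G I.k) ∧
      (t : ℝ) ≤ C * (Fintype.card I.V + 1 : ℝ) ^ c * (2.6181 : ℝ) ^ max I.measure 0) ∧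
    -- preprocessing shrinks the graph and does not increase the measure
    (∀ I J : VCLP.Inst, I.Reduces J →
      Fintype.card J.V < Fintype.card I.V ∧ J.measure ≤ I.measure) ∧
    -- branching on any vertex of a reduced instance gives a drop of (1/2, 1)
    (∀ (I : VCLP.Inst) (u : I.V), I.Reduced →
      (I.take u).measure ≤ I.measure - 1 / 2 ∧ (I.discard u).measure ≤ I.measure - 1) := by
  refine ⟨?_, VCLP.Inst.exists_run, ⟨1, 2, fun I b t h => ⟨h.correct, ?_⟩⟩,
    fun I J h => ⟨h.card_lt, h.measure_le⟩,
    fun I u h => ⟨I.measure_take_le u h, I.measure_discard_le u h⟩⟩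
  · obtain ⟨C, c, hC⟩ := VCLP.RAM.vertexCover_time
    refine ⟨VCLP.RAM.vertexCover, C, c, fun n G k => ?_⟩
    obtain ⟨t, σ, h1, h2, h3, h4⟩ := VCLP.RAM.vertexCover_spec n G k
    exact ⟨t, σ, h1, h2, h3, hC n G k t h4⟩
  · have := h.le_treeBound.trans (VCLP.treeBound_le _ _)
    simpa using this
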